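/- Let $k$ be a commutative associative unital ring; all modules are $k$-modules. **Conventions.** For $n\ge 0$ let $\Sigma_n^+$ be the group of permutations of $\{0,\dots,n\}$, let $\Sigma_n\subset\Sigma_n^+$ be the subgroup of permutations fixing $0$, and let $\tau_n\in\Sigma_n^+$ be the cycle $0\mapsto 1\mapsto\cdots\mapsto n\mapsto 0$. A *$\Sigma^+$-module* (resp. *$\Sigma$-module*) is a sequence $W=\{W(n)\}_{n\ge 0}$ of right $k[\Sigma_n^+]$-modules (resp. right $k[\Sigma_n]$-modules); morphisms are sequences of equivariant linear maps. For a finite set $X$ with $n+1$ elements put $W((X)):=W(n)\times_{\Sigma_n^+}\mathrm{Bij}(\{0,\dots,n\},X)$. **Trees.** A *cyclic labeled $n$-tree* is a finite unrooted tree with at least one internal vertex, whose legs (open external edges) are labeled bijectively by $0,\dots,n$; every internal vertex $v$ has a non-empty finite set $\mathrm{edge}(v)$ of incident edges (legs included). Let $\mathrm{Tree}^+_n$ be the category of these trees and their isomorphisms preserving the labels of the legs, and let $\mathrm{UTree}^+_n$ be its extension by the exceptional tree, which consists of one edge with two free ends (for $n=1$) and has no vertices. For a tree $T$ put $W((T)):=\bigotimes_{v}W((\mathrm{edge}(v)))$,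 the tensor product over the internal vertices of $T$ (so that it is $k$ for the exceptional tree). Define $$\Psi_+(W)(n):=\operatorname*{colim}_{T\in \mathrm{Tree}^+_n}W((T)),\qquad \Gamma_+(W)(n):=\operatorname*{colim}_{T\in \mathrm{UTree}^+_n}W((T)),\qquad n\ge 0,$$ with $\Sigma^+_n$ acting by relabeling the legs. Both functors on the category of $\Sigma^+$-modules are triples (monads): the unit is given by the trees with one vertex, and the multiplication replaces each vertex of a tree that is decorated by a decorated tree by that decorated tree ("forgetting the braces"). A *non-unital cyclic operad* (resp. a *cyclic operad*) is an algebra over the triple $\Psi_+$ (resp. $\Gamma_+$). **Operads.** A *non-unital operad* is a $\Sigma$-module $\mathcal C$ with linear maps $\circ_i:\mathcal C(m)\otimes\mathcal C(n)\to\mathcal C(m+n-1)$ for $1\le i\le m$, $n\ge 0$, such that * for $f\in \mathcal C(a)$, $g\in \mathcal C(b)$, $h\in \mathcal C(c)$ with $1\le j\le a$, $b,c\ge 0$, $$(f\circ_j g)\circ_i h=\begin{cases}(f\circ_i h)\circ_{j+c-1}g,&1\le i<j,\\ f\circ_j(g\circ_{i-j+1}h),&j\le i<b+j,\\ (f\circ_{i-b+1}h)\circ_j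 g,&j+b\le i\le a+b-1;\end{cases}$$ * $(f\tau)\circ_i(g\sigma)=(f\circ_{\tau(i)}g)(\tau\circ_i\sigma)$ for $f\in\mathcal C(m)$, $g\in\mathcal C(n)$, $\tau\in\Sigma_m$, $\sigma\in\Sigma_n$, $1\le i\le m$, where $\tau\circ_i\sigma\in\Sigma_{m+n-1}$ is obtained by inserting $\sigma$ at the $i$th place in $\tau$. An *operadic unit* is an element $e\in\mathcal C(1)$ with $f\circ_i e=f$ for all $f\in\mathcal C(m)$, $1\le i\le m$, and $e\circ_1 g=g$ for all $g$. **Proposition.** For a $\Sigma^+$-module $\mathcal C$ and a $\Psi_+$- or $\Gamma_+$-algebra structure on $\mathcal C$ let $p\circ_i q$, for $p\in\mathcal C(m)$, $q\in\mathcal C(n)$, $1\le i\le m$, be the value of the structure morphism on the tree with two vertices, decorated by $p$ and $q$, in which the edge $i$ of the vertex decorated by $p$ is joined to the edge $0$ of the vertex decorated by $q$; the legs are numbered so that the legs $1,\dots,n$ of $q$ take the place of the leg $i$ of $p$. 1. A non-unital cyclic operad is the same as a non-unital operad whose $\Sigma_n$-actions on $\mathcal C(n)$ are extended, for each $n\ge0$,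 to $\Sigma_n^+$-actions such that, for $p\in\mathcal C(m)$, $q\in\mathcal C(n)$, $$(p\circ_i q)\tau_{m+n-1}=\begin{cases}(q\tau_n)\circ_n(p\tau_m),&\text{if } i=1\le m \text{ and } n\ge 1,\\ (p\tau_m)\circ_{i-1}q,&\text{if } 2\le i\le m \text{ and } n\ge 0.\end{cases}$$ That is: for each $\Sigma^+$-module $\mathcal C$, assigning to a $\Psi_+$-algebra structure the maps $\circ_i$ is a bijection from the set of $\Psi_+$-algebra structures on $\mathcal C$ onto the set of families $(\circ_i)$ that satisfy these conditions and make $\mathcal C$, with the restricted $\Sigma_n$-actions, a non-unital operad; and a morphism of $\Sigma^+$-modules between two $\Psi_+$-algebras is a morphism of algebras if and only if it commutes with all the $\circ_i$. 2. A (unital) cyclic operad is the same as a structure as in 1 for which, moreover, there exists a $\Sigma_1^+$-invariant operadic unit $e\in\mathcal C(1)$. That is: the same assignment is a bijection from the set of $\Gamma_+$-algebra structures on $\mathcal C$ onto the set of families $(\circ_i)$ as in 1 that have a $\Sigma^+_1$-invariant operadic unit; and a morphism of $\Sigma^+$-modules between two $\Gamma_+$-algebras is a morphism of algebras if and only if it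 commutes with all the $\circ_i$ and preserves the operadic units. -/

import Mathlib

universe u v

namespace CycOp

open CategoryTheory

/-! ### A combinatorial lemma

Two involutions of a finite set without a common fixed point: every orbit that contains a fixed
point of one of them contains exactly two such points. -/

theorem exists_unique_end_aux {Y : Type} [Finite Y] (a b : Y → Y)
    (ha : Function.Involutive a) (hb : Function.Involutive b)
    (hab : ∀ y, ¬ (a y = y ∧ b y = y)) (y : Y) (hy : b y = y) :
    ∃! z, z ≠ y ∧ (a z = z ∨ b z = z) ∧
      Relation.EqvGen (fun s t => a s = t ∨ b s = t) y z := by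
  let A : Equiv.Perm Y := ha.toPerm
  let B : Equiv.Perm Y := hb.toPerm
  have hA2 : A * A = 1 := by ext x; exact ha x
  have hB2 : B * B = 1 := by ext x; exact hb x
  have hBi : B⁻¹ = B := inv_eq_of_mul_eq_one_left hB2
  have hAi : A⁻¹ = A := inv_eq_of_mul_eq_one_left hA2
  let p := A * B
  have hpi : p⁻¹ = B * A := by simp only [p, mul_inv_rev, hBi, hAi]
  have hBp : ∀ k : ℤ, B * p ^ k = p ^ (-k) * B := by
    intro k
    have h1 : B * p * B⁻¹ = p⁻¹ := by
      rw [hpi, hBi]; simp only [p]; rw [mul_assoc, mul_assoc, hB2, mul_one]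
    have h2 : B * p ^ k * B⁻¹ = p ^ (-k) := by
      rw [← conj_zpow, h1, inv_zpow, zpow_neg]
    rw [← h2, inv_mul_cancel_right]
  have hBy : B y = y := hy
  have hbk : ∀ k : ℤ, b ((p ^ k) y) = (p ^ (-k)) y := by
    intro k
    have := congrArg (fun q : Equiv.Perm Y => q y) (hBp k)
    simp only [Equiv.Perm.mul_apply, hBy] at this
    exact this
  have hak : ∀ k : ℤ, a ((p ^ k) y) = (p ^ (1 - k)) y := by
    intro k
    have h : a ((p ^ k) y) = p (b ((p ^ k) y)) := by
      change A _ = A (B (b _)); congr 1; exact (hb _).symm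
    rw [h, hbk, ← Equiv.Perm.mul_apply, ← zpow_one_add, sub_eq_add_neg]
  have hE : ∀ z, Relation.EqvGen (fun s t => a s = t ∨ b s = t) y z ↔ ∃ k : ℤ, z = (p ^ k) y := by
    intro z
    constructor
    · intro h
      have key : ∀ s t, Relation.EqvGen (fun s t => a s = t ∨ b s = t) s t →
          ((∃ k : ℤ, s = (p ^ k) y) ↔ ∃ k : ℤ, t = (p ^ k) y) := by
        intro s t hst
        induction hst with
        | rel s t h =>
          rcases h with h | h
          · constructor
            · rintro ⟨k, rfl⟩; exact ⟨1 - k, by rw [← h, hak]⟩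
            · rintro ⟨k, hk⟩; exact ⟨1 - k, by rw [← hak, ← hk, ← h, ha]⟩
          · constructor
            · rintro ⟨k, rfl⟩; exact ⟨- k, by rw [← h, hbk]⟩
            · rintro ⟨k, hk⟩; exact ⟨- k, by rw [← hbk, ← hk, ← h, hb]⟩
        | refl s => exact Iff.rfl
        | symm s t _ ih => exact ih.symm
        | trans s t w _ _ ih1 ih2 => exact ih1.trans ih2
      exact (key y z h).1 ⟨0, by simp⟩
    · rintro ⟨k, rfl⟩
      have hst : ∀ w, Relation.EqvGen (fun s t => a s = t ∨ b s = t) w (p w) := fun w =>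
        .trans _ (b w) _ (.rel _ _ (Or.inr rfl)) (.rel _ _ (Or.inl rfl))
      induction k using Int.induction_on with
      | zero => exact .refl _
      | succ i ih =>
        refine .trans _ _ _ ih ?_
        rw [add_comm, zpow_one_add]; exact hst _
      | pred i ih =>
        refine .trans _ _ _ ih (.symm _ _ ?_)
        have := hst ((p ^ (-(i : ℤ) - 1)) y)
        rwa [← Equiv.Perm.mul_apply, ← zpow_one_add, add_sub_cancel] at this
  set N := Function.minimalPeriod (p • ·) y with hN
  have hNpos : 0 < N := Function.minimalPeriod_pos_of_mem_periodicPts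
    ((MulAction.injective p).mem_periodicPts y)
  have hdvd : ∀ j k : ℤ, (p ^ j) y = (p ^ k) y ↔ (N : ℤ) ∣ j - k := by
    intro j k
    rw [← MulAction.zpow_smul_eq_iff_minimalPeriod_dvd, Equiv.Perm.smul_def, sub_eq_neg_add,
      zpow_add, Equiv.Perm.mul_apply, zpow_neg, Equiv.Perm.inv_eq_iff_eq]
  have hN2 : 2 ≤ N := by
    by_contra hlt
    have h1 : N = 1 := by omega
    have h2 : (p ^ (1 : ℤ)) y = (p ^ (0 : ℤ)) y := (hdvd _ _).2 (by simp [h1])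
    refine hab y ⟨?_, hy⟩
    have h3 := hak 0
    simp only [sub_zero] at h3
    rw [h2] at h3
    simpa using h3
  refine ⟨(p ^ (((N + 1) / 2 : ℕ) : ℤ)) y, ⟨?_, ?_, (hE _).2 ⟨_, rfl⟩⟩, ?_⟩
  · intro h
    have h0 : (p ^ (((N + 1) / 2 : ℕ) : ℤ)) y = (p ^ (0 : ℤ)) y := by simpa using h
    rw [hdvd, sub_zero, Int.natCast_dvd_natCast] at h0
    have := Nat.le_of_dvd (by omega) h0
    omega
  · rw [hak, hbk, hdvd, hdvd]
    rcases Nat.even_or_odd' N with ⟨M, hM | hM⟩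
    · right; exact ⟨-1, by omega⟩
    · left; exact ⟨-1, by omega⟩
  · rintro z ⟨hz1, hz2, hz3⟩
    obtain ⟨k, rfl⟩ := (hE z).1 hz3
    rw [hdvd]
    have hk0 : ¬ (N : ℤ) ∣ k := by
      intro h
      apply hz1
      have := (hdvd k 0).2 (by simpa using h)
      simpa using this
    rw [hak, hbk, hdvd, hdvd] at hz2
    rcases Nat.even_or_odd' N with ⟨M, hM | hM⟩
    · rcases hz2 with ⟨c, hc⟩ | ⟨c, hc⟩
      · exfalso
        rw [hM] at hc; push_cast at hc
        have : 2 * (M * c + k) = 1 := by linarith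
        omega
      · rw [hM] at hc; push_cast at hc
        have h1 : k = M * (-c) := by linarith
        rcases Int.even_or_odd' c with ⟨d, hd | hd⟩
        · exact absurd ⟨-d, by rw [h1, hM, hd]; push_cast; ring⟩ hk0
        · refine ⟨-d - 1, ?_⟩
          have : (N + 1) / 2 = M := by omega
          rw [this, h1, hd, hM]; push_cast; ring
    · have hMM : (N + 1) / 2 = M + 1 := by omega
      have hodd : IsCoprime (N : ℤ) 2 := by
        rw [hM]; push_cast; exact ⟨1, -M, by ring⟩
      rw [hMM]
      rcases hz2 with ⟨c, hc⟩ | ⟨c, hc⟩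
      · refine hodd.dvd_of_dvd_mul_left ⟨-c - 1, ?_⟩
        have : (N : ℤ) = 2 * M + 1 := by exact_mod_cast hM
        push_cast
        linear_combination -hc + this
      · exact absurd (hodd.dvd_of_dvd_mul_left ⟨-c, by linear_combination -hc⟩) hk0

theorem exists_unique_end {Y : Type} [Finite Y] (a b : Y → Y)
    (ha : Function.Involutive a) (hb : Function.Involutive b)
    (hab : ∀ y, ¬ (a y = y ∧ b y = y)) (y : Y) (hy : a y = y ∨ b y = y) :
    ∃! z, z ≠ y ∧ (a z = z ∨ b z = z) ∧
      Relation.EqvGen (fun s t => a s = t ∨ b s = t) y z := by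
  rcases hy with hy | hy
  · have := exists_unique_end_aux b a hb ha (fun y h => hab y h.symm) y hy
    simpa only [or_comm] using this
  · exact exists_unique_end_aux a b ha hb hab y hy

/-! ### Cyclic labeled trees

An unrooted tree with legs labeled by `0, …, n` is given by its set `V` of (internal) vertices, by
the finite set of flags at every vertex, and by its edges. The flags at the vertex `v` are numbered
by `0, …, r v`, so that the set `edge(v)` of the edges incident with `v` is `Fin (r v + 1)`. -/

/-- The ends of the edges of a tree with vertices `V` and legs `0, …, n`: an edge ends either in a
flag at a vertex or in the free end of a leg. -/
abbrev Ends (V : Type) (r : V → ℕ) (n : ℕ) : Type := (Σ v : V, Fin (r v + 1)) ⊕ Fin (n + 1)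

/-- The point in which an end lies: a vertex, or the free end of a leg. -/
def Ends.node {V : Type} {r : V → ℕ} {n : ℕ} : Ends V r n → V ⊕ Fin (n + 1)
  | .inl f => .inl f.1
  | .inr x => .inr x

/-- Cyclic labeled trees with the set `V` of vertices, where the vertex `v` has the valence
`r v + 1`, and with the legs `0, …, n`. The edges match the ends in pairs. The last two conditions
say that the graph, with the vertices and the free ends of the legs as its points, is connected and
that it has one point more than it has edges, that is, that it is a tree. The exceptional tree,
which has two legs and no vertices, is included. -/
structure CTree (V : Type) [Fintype V] (r : V → ℕ) (n : ℕ) where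
  edge : Ends V r n → Ends V r n → Prop
  symm : ∀ x y, edge x y → edge y x
  irrefl : ∀ x, ¬ edge x x
  existsUnique : ∀ x, ∃! y, edge x y
  connected : ∀ P : V ⊕ Fin (n + 1) → Prop,
    (∀ x y, edge x y → P x.node → P y.node) → ∀ a b, P a → P b
  card : Fintype.card (Ends V r n) + 2 = 2 * Fintype.card (V ⊕ Fin (n + 1))

namespace CTree

section subst
variable {V : Type} [Fintype V] {r : V → ℕ} {n : ℕ} {U : V → Type} [∀ v, Fintype (U v)]
  {s : ∀ v, U v → ℕ}

/-- The other end of the edge that ends in `x`. -/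
noncomputable def opp (T : CTree V r n) (x : Ends V r n) : Ends V r n :=
  (T.existsUnique x).choose

theorem edge_opp (T : CTree V r n) (x : Ends V r n) : T.edge x (T.opp x) :=
  (T.existsUnique x).choose_spec.1

theorem edge_iff (T : CTree V r n) (x y : Ends V r n) : T.edge x y ↔ T.opp x = y :=
  ⟨fun h => ((T.existsUnique x).choose_spec.2 y h).symm, fun h => h ▸ T.edge_opp x⟩

theorem opp_opp (T : CTree V r n) (x : Ends V r n) : T.opp (T.opp x) = x :=
  (T.edge_iff _ _).1 (T.symm _ _ (T.edge_opp x))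

theorem opp_ne (T : CTree V r n) (x : Ends V r n) : T.opp x ≠ x :=
  fun h => T.irrefl x ((T.edge_iff x x).2 h)

/-! #### Substitution of trees into the vertices of a tree

Given a tree `T` and for every vertex `v` of `T` a tree `S v` whose legs are labeled by the flags at
`v`, the tree `T.subst S` has as its vertices those of all the `S v`. Its edges arise by following
the edges of the `S v` and of `T`, where the free end of the leg `j` of `S v` is glued to the flag
`j` at `v`. -/

/-- All the ends that occur: those of the `S v` and the free ends of the legs of `T`. -/
abbrev Wire (V : Type) (r : V → ℕ) (U : V → Type) (s : ∀ v, U v → ℕ) (n : ℕ) : Type :=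
  (Σ v : V, Ends (U v) (s v) (r v)) ⊕ Fin (n + 1)

/-- The ends of `T`; the flag `j` at `v` is the free end of the leg `j` of `S v`. -/
def Wire.ofOuter : Ends V r n → Wire V r U s n
  | .inl f => .inl ⟨f.1, .inr f.2⟩
  | .inr x => .inr x

/-- The ends of the tree that results from the substitution. -/
def Wire.ofEnd : Ends (Σ v, U v) (fun p => s p.1 p.2) n → Wire V r U s n
  | .inl f => .inl ⟨f.1.1, .inl ⟨f.1.2, f.2⟩⟩
  | .inr x => .inr x

/-- The ends are joined by an edge of one of the `S v`, or by an edge of `T`. -/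
inductive Step (T : CTree V r n) (S : ∀ v, CTree (U v) (s v) (r v)) :
    Wire V r U s n → Wire V r U s n → Prop
  | inner (v : V) (x y : Ends (U v) (s v) (r v)) (h : (S v).edge x y) :
      Step T S (.inl ⟨v, x⟩) (.inl ⟨v, y⟩)
  | outer (x y : Ends V r n) (h : T.edge x y) : Step T S (Wire.ofOuter x) (Wire.ofOuter y)

theorem Wire.ofEnd_injective :
    Function.Injective (Wire.ofEnd : Ends (Σ v, U v) (fun p => s p.1 p.2) n → Wire V r U s n) := by
  rintro (⟨⟨v, u⟩, f⟩ | x) (⟨⟨v', u'⟩, f'⟩ | x') h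
  · simp only [Wire.ofEnd, Sum.inl.injEq, Sigma.mk.injEq] at h
    obtain ⟨rfl, h⟩ := h
    simp only [heq_eq_eq, Sum.inl.injEq, Sigma.mk.injEq] at h
    obtain ⟨rfl, h⟩ := h
    simp only [heq_eq_eq] at h
    rw [h]
  · simp [Wire.ofEnd] at h
  · simp [Wire.ofEnd] at h
  · simp only [Wire.ofEnd, Sum.inr.injEq] at h
    rw [h]

/-- The involution given by the edges of the trees `S v`. -/
noncomputable def inn (S : ∀ v, CTree (U v) (s v) (r v)) : Wire V r U s n → Wire V r U s n
  | .inl p => .inl ⟨p.1, (S p.1).opp p.2⟩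
  | .inr x => .inr x

/-- The involution given by the edges of the tree `T`. -/
noncomputable def out (T : CTree V r n) : Wire V r U s n → Wire V r U s n
  | .inl ⟨v, .inl f⟩ => .inl ⟨v, .inl f⟩
  | .inl ⟨v, .inr j⟩ => Wire.ofOuter (T.opp (.inl ⟨v, j⟩))
  | .inr x => Wire.ofOuter (T.opp (.inr x))

theorem out_ofOuter (T : CTree V r n) (x : Ends V r n) :
    out T (Wire.ofOuter x : Wire V r U s n) = Wire.ofOuter (T.opp x) := by
  rcases x with ⟨v, j⟩ | x <;> rfl

theorem inn_inn (S : ∀ v, CTree (U v) (s v) (r v)) :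
    Function.Involutive (inn S : Wire V r U s n → _) := by
  rintro (⟨v, x⟩ | x)
  · simp [inn, opp_opp]
  · rfl

theorem out_out (T : CTree V r n) :
    Function.Involutive (out T : Wire V r U s n → _) := by
  rintro (⟨v, f | j⟩ | x)
  · rfl
  · change out T (Wire.ofOuter _) = _; rw [out_ofOuter, opp_opp]; rfl
  · change out T (Wire.ofOuter _) = _; rw [out_ofOuter, opp_opp]; rfl

theorem Wire.ofOuter_injective :
    Function.Injective (Wire.ofOuter : Ends V r n → Wire V r U s n) := by
  rintro (⟨v, f⟩ | x) (⟨v', f'⟩ | x') h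
  · simp only [Wire.ofOuter, Sum.inl.injEq, Sigma.mk.injEq] at h
    obtain ⟨rfl, h⟩ := h
    simp only [heq_eq_eq, Sum.inr.injEq] at h
    rw [h]
  · simp [Wire.ofOuter] at h
  · simp [Wire.ofOuter] at h
  · simp only [Wire.ofOuter, Sum.inr.injEq] at h
    rw [h]

theorem inn_ne (S : ∀ v, CTree (U v) (s v) (r v)) (p : Σ v : V, Ends (U v) (s v) (r v)) :
    inn S (.inl p : Wire V r U s n) ≠ .inl p := by
  obtain ⟨v, x⟩ := p
  simp [inn, opp_ne]

theorem out_ne (T : CTree V r n) (x : Ends V r n) :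
    out T (Wire.ofOuter x : Wire V r U s n) ≠ Wire.ofOuter x := by
  rw [out_ofOuter]
  exact fun h => T.opp_ne x (Wire.ofOuter_injective h)

theorem fixed_iff (T : CTree V r n) (S : ∀ v, CTree (U v) (s v) (r v)) (y : Wire V r U s n) :
    (inn S y = y ∨ out T y = y) ↔ ∃ e, Wire.ofEnd e = y := by
  rcases y with ⟨v, f | j⟩ | x
  · exact ⟨fun _ => ⟨.inl ⟨⟨v, f.1⟩, f.2⟩, rfl⟩, fun _ => Or.inr rfl⟩
  · constructor
    · rintro (h | h)
      · exact absurd h (inn_ne S _)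
      · exact absurd h (out_ne T (.inl ⟨v, j⟩))
    · rintro ⟨e | e, he⟩
      · obtain ⟨⟨v', u⟩, f⟩ := e
        simp only [Wire.ofEnd, Sum.inl.injEq, Sigma.mk.injEq] at he
        obtain ⟨rfl, he⟩ := he
        simp at he
      · simp [Wire.ofEnd] at he
  · exact ⟨fun _ => ⟨.inr x, rfl⟩, fun _ => Or.inl rfl⟩

theorem eqvGen_step_iff (T : CTree V r n) (S : ∀ v, CTree (U v) (s v) (r v))
    (y z : Wire V r U s n) :
    Relation.EqvGen (Step T S) y z ↔
      Relation.EqvGen (fun p q => inn S p = q ∨ out T p = q) y z := by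
  constructor <;> intro h
  · induction h with
    | rel p q h =>
      refine .rel _ _ ?_
      cases h with
      | inner v x y h => left; simp only [inn, ((S v).edge_iff x y).1 h]
      | outer x y h => right; rw [out_ofOuter, (T.edge_iff x y).1 h]
    | refl => exact .refl _
    | symm _ _ _ ih => exact .symm _ _ ih
    | trans _ _ _ _ _ ih ih' => exact .trans _ _ _ ih ih'
  · induction h with
    | rel p q h =>
      rcases h with rfl | rfl
      · rcases p with ⟨v, x⟩ | x
        · exact .rel _ _ (.inner v x _ ((S v).edge_opp x))
        · exact .refl _
      · rcases p with ⟨v, f | j⟩ | x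
        · exact .refl _
        · exact .rel _ _ (.outer _ _ (T.edge_opp (.inl ⟨v, j⟩)))
        · exact .rel _ _ (.outer _ _ (T.edge_opp (.inr x)))
    | refl => exact .refl _
    | symm _ _ _ ih => exact .symm _ _ ih
    | trans _ _ _ _ _ ih ih' => exact .trans _ _ _ ih ih'

/-- The substitution of the trees `S v` into the vertices of `T`. -/
def subst (T : CTree V r n) (S : ∀ v, CTree (U v) (s v) (r v)) :
    CTree (Σ v, U v) (fun p => s p.1 p.2) n where
  edge x y := x ≠ y ∧ Relation.EqvGen (Step T S) (Wire.ofEnd x) (Wire.ofEnd y)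
  symm x y h := ⟨h.1.symm, .symm _ _ h.2⟩
  irrefl x h := h.1 rfl
  existsUnique x := by
    have := exists_unique_end (inn S) (out T) (inn_inn S) (out_out T) ?_ (Wire.ofEnd x)
      ((fixed_iff T S _).2 ⟨x, rfl⟩)
    · obtain ⟨z, ⟨hz1, hz2, hz3⟩, hz⟩ := this
      obtain ⟨y, rfl⟩ := (fixed_iff T S _).1 hz2
      refine ⟨y, ⟨fun h => hz1 (by rw [h]), (eqvGen_step_iff T S _ _).2 hz3⟩, ?_⟩
      rintro y' ⟨h1, h2⟩
      exact Wire.ofEnd_injective (hz _ ⟨fun h => h1 (Wire.ofEnd_injective h).symm,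
        (fixed_iff T S _).2 ⟨_, rfl⟩, (eqvGen_step_iff T S _ _).1 h2⟩)
    · rintro (⟨v, x⟩ | x) ⟨h1, h2⟩
      · exact inn_ne S _ h1
      · exact out_ne T (.inr x) h2
  connected P hP := by
    let Q : Wire V r U s n → Prop := fun y =>
      ∃ e, Relation.EqvGen (Step T S) y (Wire.ofEnd e) ∧ P e.node
    have hQ : ∀ y z, Relation.EqvGen (Step T S) y z → Q y → Q z := by
      rintro y z h ⟨e, h1, h2⟩
      exact ⟨e, .trans _ _ _ (.symm _ _ h) h1, h2⟩
    have hQe : ∀ e, Q (Wire.ofEnd e) ↔ P e.node := by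
      intro e
      refine ⟨?_, fun h => ⟨e, .refl _, h⟩⟩
      rintro ⟨e', h1, h2⟩
      by_cases h : e' = e
      · rwa [← h]
      · exact hP e' e ⟨h, .symm _ _ h1⟩ h2
    let PS : ∀ v, U v ⊕ Fin (r v + 1) → Prop := fun v =>
      Sum.elim (fun u => P (.inl ⟨v, u⟩)) (fun j => Q (.inl ⟨v, .inr j⟩))
    have hPS : ∀ v (x : Ends (U v) (s v) (r v)), PS v x.node ↔ Q (.inl ⟨v, x⟩) := by
      rintro v (⟨u, f⟩ | j)
      · exact (hQe (.inl ⟨⟨v, u⟩, f⟩)).symm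
      · exact Iff.rfl
    have hS : ∀ v a b, PS v a → PS v b := fun v => (S v).connected (PS v) (fun x y h => by
      rw [hPS, hPS]; exact hQ _ _ (.rel _ _ (.inner v x y h)))
    let PT : V ⊕ Fin (n + 1) → Prop :=
      Sum.elim (fun v => ∀ a, PS v a) (fun x => P (.inr x))
    have hPT : ∀ x : Ends V r n, PT x.node ↔ Q (Wire.ofOuter x) := by
      rintro (⟨v, j⟩ | x)
      · exact ⟨fun h => h (.inr j), fun h a => hS v (.inr j) a h⟩
      · exact (hQe (.inr x)).symm
    have hT : ∀ a b, PT a → PT b := T.connected PT (fun x y h => by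
      rw [hPT, hPT]; exact hQ _ _ (.rel _ _ (.outer x y h)))
    rintro (⟨v, u⟩ | x) (⟨v', u'⟩ | x') h
    · exact hT (.inl v) (.inl v') (fun a => hS v (.inl u) a h) (.inl u')
    · exact hT (.inl v) (.inr x') (fun a => hS v (.inl u) a h)
    · exact hT (.inr x) (.inl v') h (.inl u')
    · exact hT (.inr x) (.inr x') h
  card := by
    have hT := T.card
    have hS := fun v => (S v).card
    simp only [Fintype.card_sum, Fintype.card_sigma, Fintype.card_fin] at hT hS ⊢
    have h2 := Finset.sum_congr (rfl : (Finset.univ : Finset V) = Finset.univ) (fun v _ => hS v)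
    simp only [Finset.sum_add_distrib, Finset.mul_sum, mul_add, Finset.sum_const, Finset.card_univ,
      smul_eq_mul, Fintype.sum_sigma] at h2 hT ⊢
    simp only [mul_one, ← Finset.mul_sum, Fintype.card_sigma] at h2 hT ⊢
    omega

end subst

section iso
variable {V V' : Type} {r : V → ℕ} {r' : V' → ℕ} {n n' : ℕ}

/-- The bijection of ends given by a bijection of vertices, bijections of the flags at
corresponding vertices, and a bijection of the labels of the legs. -/
def Ends.map (e : V' ≃ V) (φ : ∀ v, Fin (r' v + 1) ≃ Fin (r (e v) + 1))
    (l : Fin (n' + 1) ≃ Fin (n + 1)) : Ends V' r' n' ≃ Ends V r n :=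
  Equiv.sumCongr ((Equiv.sigmaCongrRight φ).trans (e.sigmaCongrLeft (β := fun v => Fin (r v + 1)))) l

theorem Ends.map_inl (e : V' ≃ V) (φ : ∀ v, Fin (r' v + 1) ≃ Fin (r (e v) + 1))
    (l : Fin (n' + 1) ≃ Fin (n + 1)) (f : Σ v, Fin (r' v + 1)) :
    Ends.map e φ l (.inl f) = .inl ⟨e f.1, φ f.1 f.2⟩ := rfl

theorem Ends.map_inr (e : V' ≃ V) (φ : ∀ v, Fin (r' v + 1) ≃ Fin (r (e v) + 1))
    (l : Fin (n' + 1) ≃ Fin (n + 1)) (x : Fin (n' + 1)) :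
    Ends.map (r := r) e φ l (.inr x) = .inr (l x) := rfl

theorem Ends.node_map (e : V' ≃ V) (φ : ∀ v, Fin (r' v + 1) ≃ Fin (r (e v) + 1))
    (l : Fin (n' + 1) ≃ Fin (n + 1)) (x : Ends V' r' n') :
    (Ends.map e φ l x).node = Equiv.sumCongr e l x.node := by
  rcases x with f | x <;> rfl

variable [Fintype V] [Fintype V']

/-- Transport of a tree along such bijections. -/
def pull (T : CTree V r n) (e : V' ≃ V) (φ : ∀ v, Fin (r' v + 1) ≃ Fin (r (e v) + 1))
    (l : Fin (n' + 1) ≃ Fin (n + 1)) : CTree V' r' n' where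
  edge x y := T.edge (Ends.map e φ l x) (Ends.map e φ l y)
  symm _ _ h := T.symm _ _ h
  irrefl _ h := T.irrefl _ h
  existsUnique x := by
    obtain ⟨y, h1, h2⟩ := T.existsUnique (Ends.map e φ l x)
    refine ⟨(Ends.map e φ l).symm y, by simpa using h1, fun z hz => ?_⟩
    rw [Equiv.eq_symm_apply]
    exact h2 _ hz
  connected P hP a b hab := by
    have := T.connected (fun a => P ((Equiv.sumCongr e l).symm a)) (fun x y h => by
      obtain ⟨x, rfl⟩ := (Ends.map e φ l).surjective x
      obtain ⟨y, rfl⟩ := (Ends.map e φ l).surjective y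
      simp only [Ends.node_map, Equiv.symm_apply_apply]
      exact hP x y h) (Equiv.sumCongr e l a) (Equiv.sumCongr e l b)
    simp only [Equiv.symm_apply_apply] at this
    exact this hab
  card := by
    rw [Fintype.card_congr (Ends.map e φ l), Fintype.card_congr (Equiv.sumCongr e l)]
    exact T.card

/-- Change of the labels of the legs. -/
def relegs (T : CTree V r n) (l : Fin (n' + 1) ≃ Fin (n + 1)) : CTree V r n' :=
  T.pull (.refl _) (fun _ => .refl _) l

theorem edge_iff_of_imp (T : CTree V r n) (T' : CTree V' r' n') (m : Ends V' r' n' ≃ Ends V r n)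
    (h : ∀ x y, T'.edge x y → T.edge (m x) (m y)) (x y : Ends V' r' n') :
    T'.edge x y ↔ T.edge (m x) (m y) := by
  refine ⟨h x y, fun hxy => ?_⟩
  have h1 := (T.edge_iff _ _).1 (h x _ (T'.edge_opp x))
  rw [(T.edge_iff _ _).1 hxy] at h1
  rw [m.injective h1]
  exact T'.edge_opp x

end iso

/-- Substitution is compatible with isomorphisms of trees. -/
theorem subst_map {V V' : Type} [Fintype V] [Fintype V'] {r : V → ℕ} {r' : V' → ℕ} {n n' : ℕ}
    {U : V → Type} {U' : V' → Type} [∀ v, Fintype (U v)] [∀ v, Fintype (U' v)]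
    {s : ∀ v, U v → ℕ} {s' : ∀ v, U' v → ℕ}
    (T : CTree V r n) (T' : CTree V' r' n')
    (S : ∀ v, CTree (U v) (s v) (r v)) (S' : ∀ v, CTree (U' v) (s' v) (r' v))
    (e : V' ≃ V) (φ : ∀ v, Fin (r' v + 1) ≃ Fin (r (e v) + 1))
    (l : Fin (n' + 1) ≃ Fin (n + 1))
    (hT : ∀ x y, T'.edge x y ↔ T.edge (Ends.map e φ l x) (Ends.map e φ l y))
    (ε : ∀ v, U' v ≃ U (e v)) (ψ : ∀ v u, Fin (s' v u + 1) ≃ Fin (s (e v) (ε v u) + 1))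
    (hS : ∀ v x y, (S' v).edge x y ↔
      (S (e v)).edge (Ends.map (ε v) (ψ v) (φ v) x) (Ends.map (ε v) (ψ v) (φ v) y)) :
    ∀ x y, (T'.subst S').edge x y ↔ (T.subst S).edge
      (Ends.map (r' := fun p : Σ v, U' v => s' p.1 p.2) (r := fun p : Σ v, U v => s p.1 p.2)
        ((Equiv.sigmaCongrRight ε).trans (e.sigmaCongrLeft (β := U))) (fun p => ψ p.1 p.2)
        l x)
      (Ends.map (r' := fun p : Σ v, U' v => s' p.1 p.2) (r := fun p : Σ v, U v => s p.1 p.2)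
        ((Equiv.sigmaCongrRight ε).trans (e.sigmaCongrLeft (β := U))) (fun p => ψ p.1 p.2)
        l y) := by
  apply edge_iff_of_imp
  rintro x y ⟨hne, h⟩
  refine ⟨fun h => hne ((Ends.map _ _ _).injective h), ?_⟩
  let M : Wire V' r' U' s' n' → Wire V r U s n := Sum.map
    (fun p => ⟨e p.1, Ends.map (ε p.1) (ψ p.1) (φ p.1) p.2⟩) l
  have hM : ∀ z, Wire.ofEnd (Ends.map (r' := fun p : Σ v, U' v => s' p.1 p.2)
      (r := fun p : Σ v, U v => s p.1 p.2)
        ((Equiv.sigmaCongrRight ε).trans (e.sigmaCongrLeft (β := U))) (fun p => ψ p.1 p.2)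
        l z) = M (Wire.ofEnd z) := by
    rintro (f | x) <;> rfl
  have hM' : ∀ z, M (Wire.ofOuter z) = Wire.ofOuter (Ends.map e φ l z) := by
    rintro (f | x) <;> rfl
  rw [hM, hM]
  generalize Wire.ofEnd x = x at h
  generalize Wire.ofEnd y = y at h
  induction h with
  | rel p q h =>
    refine .rel _ _ ?_
    cases h with
    | inner v x y h => exact .inner (e v) _ _ ((hS v x y).1 h)
    | outer x y h => rw [hM', hM']; exact .outer _ _ ((hT x y).1 h)
  | refl => exact .refl _
  | symm _ _ _ ih => exact .symm _ _ ih
  | trans _ _ _ _ _ ih ih' => exact .trans _ _ _ ih ih'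

/-- The tree with one vertex, whose flag `j` belongs to the leg `j`. -/
def corolla (n : ℕ) : CTree Unit (fun _ => n) n where
  edge x y := (∃ j, x = .inl ⟨(), j⟩ ∧ y = .inr j) ∨ (∃ j, x = .inr j ∧ y = .inl ⟨(), j⟩)
  symm x y := by
    rintro (⟨j, rfl, rfl⟩ | ⟨j, rfl, rfl⟩)
    · exact Or.inr ⟨j, rfl, rfl⟩
    · exact Or.inl ⟨j, rfl, rfl⟩
  irrefl x := by
    rintro (⟨j, rfl, h⟩ | ⟨j, rfl, h⟩) <;> simp at h
  existsUnique x := by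
    rcases x with ⟨⟨⟩, j⟩ | j
    · refine ⟨.inr j, Or.inl ⟨j, rfl, rfl⟩, ?_⟩
      rintro y (⟨i, h, rfl⟩ | ⟨i, h, rfl⟩)
      · simp at h; rw [h]
      · simp at h
    · refine ⟨.inl ⟨(), j⟩, Or.inr ⟨j, rfl, rfl⟩, ?_⟩
      rintro y (⟨i, h, rfl⟩ | ⟨i, h, rfl⟩)
      · simp at h
      · simp at h; rw [h]
  connected P hP := by
    have h1 : ∀ j, P (.inl ()) ↔ P (.inr j) := fun j =>
      ⟨hP (.inl ⟨(), j⟩) (.inr j) (Or.inl ⟨j, rfl, rfl⟩),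
        hP (.inr j) (.inl ⟨(), j⟩) (Or.inr ⟨j, rfl, rfl⟩)⟩
    have h2 : ∀ a, P a ↔ P (.inl ()) := by
      rintro (⟨⟩ | j)
      · exact Iff.rfl
      · exact (h1 j).symm
    intro a b h
    exact (h2 b).2 ((h2 a).1 h)
  card := by
    simp only [Fintype.card_sum, Fintype.card_sigma, Fintype.card_fin, Finset.univ_unique,
      Finset.sum_singleton, Fintype.card_unit]
    omega

theorem corolla_map {n : ℕ} (σ : Equiv.Perm (Fin (n + 1))) (a b : Ends Unit (fun _ => n) n) :
    (corolla n).edge a b ↔ (corolla n).edge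
      (Ends.map (r := fun _ : Unit => n) (.refl _) (fun _ => σ) σ a)
      (Ends.map (r := fun _ : Unit => n) (.refl _) (fun _ => σ) σ b) := by
  apply edge_iff_of_imp
  rintro x y (⟨j, rfl, rfl⟩ | ⟨j, rfl, rfl⟩)
  · exact Or.inl ⟨σ j, rfl, rfl⟩
  · exact Or.inr ⟨σ j, rfl, rfl⟩

/-- Substitution of corollas changes nothing. -/
theorem subst_corolla {V : Type} [Fintype V] {r : V → ℕ} {n : ℕ} (T : CTree V r n)
    (x y : Ends V r n) :
    T.edge x y ↔ (T.subst (fun v => corolla (r v))).edge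
      (Ends.map (r := fun p : Σ _ : V, Unit => r p.1) (Equiv.sigmaPUnit V).symm
        (fun _ => .refl _) (.refl _) x)
      (Ends.map (r := fun p : Σ _ : V, Unit => r p.1) (Equiv.sigmaPUnit V).symm
        (fun _ => .refl _) (.refl _) y) := by
  apply edge_iff_of_imp
  intro x y h
  refine ⟨fun h' => T.irrefl x ?_, ?_⟩
  · rw [(Ends.map _ _ _).injective h'] at h ⊢
    exact h
  · have key : ∀ z : Ends V r n, Relation.EqvGen (Step T (fun v => corolla (r v)))
        (Wire.ofEnd (Ends.map (r := fun p : Σ _ : V, Unit => r p.1) (Equiv.sigmaPUnit V).symm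
        (fun _ => .refl _) (.refl _) z)) (Wire.ofOuter z) := by
      rintro (⟨v, j⟩ | x)
      · exact .rel _ _ (.inner v _ _ (Or.inl ⟨j, rfl, rfl⟩))
      · exact .refl _
    exact .trans _ _ _ (key x) (.trans _ _ _ (.rel _ _ (.outer x y h)) (.symm _ _ (key y)))

/-- Substitution into a corolla changes nothing. -/
theorem corolla_subst {U : Type} [Fintype U] {s : U → ℕ} {n : ℕ} (S : CTree U s n)
    (x y : Ends U s n) :
    S.edge x y ↔ ((corolla n).subst (fun _ => S)).edge
      (Ends.map (r := fun p : Σ _ : Unit, U => s p.2) (Equiv.uniqueSigma (fun _ : Unit => U)).symm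
        (fun _ => .refl _) (.refl _) x)
      (Ends.map (r := fun p : Σ _ : Unit, U => s p.2) (Equiv.uniqueSigma (fun _ : Unit => U)).symm
        (fun _ => .refl _) (.refl _) y) := by
  apply edge_iff_of_imp
  intro x y h
  refine ⟨fun h' => S.irrefl x ?_, ?_⟩
  · rw [(Ends.map _ _ _).injective h'] at h ⊢
    exact h
  · have key : ∀ z : Ends U s n, Relation.EqvGen (Step (corolla n) (fun _ => S))
        (Wire.ofEnd (Ends.map (r := fun p : Σ _ : Unit, U => s p.2)
          (Equiv.uniqueSigma (fun _ : Unit => U)).symm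
        (fun _ => .refl _) (.refl _) z)) (.inl ⟨(), z⟩) := by
      rintro (⟨v, j⟩ | x)
      · exact .refl _
      · exact .rel _ _ (Step.outer (U := fun _ => U) (s := fun _ => s) (S := fun _ => S)
          (T := corolla n) (.inr x) (.inl ⟨(), x⟩) (Or.inr ⟨x, rfl, rfl⟩))
    exact .trans _ _ _ (key x) (.trans _ _ _ (.rel _ _ (Step.inner (U := fun _ => U)
      (s := fun _ => s) (S := fun _ => S) (T := corolla n) () x y h)) (.symm _ _ (key y)))

section assoc
variable {V : Type} [Fintype V] {r : V → ℕ} {n : ℕ} {U : V → Type} [∀ v, Fintype (U v)]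
  {s : ∀ v, U v → ℕ} {Z : ∀ v, U v → Type} [∀ v u, Fintype (Z v u)] {t : ∀ v u, Z v u → ℕ}

/-- All the ends that occur in an iterated substitution. -/
abbrev Wire₃ (V : Type) (r : V → ℕ) (U : V → Type) (s : ∀ v, U v → ℕ)
    (Z : ∀ v, U v → Type) (t : ∀ v u, Z v u → ℕ) (n : ℕ) : Type :=
  (Σ p : Σ v : V, U v, Ends (Z p.1 p.2) (t p.1 p.2) (s p.1 p.2)) ⊕ Ends V r n

/-- The ends of the trees of the middle level. -/
def toWire₃ (v : V) : Ends (U v) (s v) (r v) → Wire₃ V r U s Z t n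
  | .inl f => .inl ⟨⟨v, f.1⟩, .inr f.2⟩
  | .inr j => .inr (.inl ⟨v, j⟩)

/-- The involution given by the trees of the middle level. -/
noncomputable def mid (S : ∀ v, CTree (U v) (s v) (r v)) : Wire₃ V r U s Z t n → Wire₃ V r U s Z t n
  | .inl ⟨p, .inl f⟩ => .inl ⟨p, .inl f⟩
  | .inl ⟨p, .inr j⟩ => toWire₃ p.1 ((S p.1).opp (.inl ⟨p.2, j⟩))
  | .inr (.inl f) => toWire₃ f.1 ((S f.1).opp (.inr f.2))
  | .inr (.inr x) => .inr (.inr x)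

/-- The involution given by the trees of the outer and of the inner level. -/
noncomputable def side (T : CTree V r n)
    (R : ∀ v u, CTree (Z v u) (t v u) (s v u)) : Wire₃ V r U s Z t n → Wire₃ V r U s Z t n
  | .inl p => .inl ⟨p.1, (R p.1.1 p.1.2).opp p.2⟩
  | .inr x => .inr (T.opp x)

theorem mid_toWire₃ (S : ∀ v, CTree (U v) (s v) (r v)) (v : V) (x : Ends (U v) (s v) (r v)) :
    mid S (toWire₃ v x : Wire₃ V r U s Z t n) = toWire₃ v ((S v).opp x) := by
  rcases x with f | j <;> rfl

/-- The ends of the tree that results from the iterated substitution. -/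
def toWire₃' : Ends (Σ p : Σ v, U v, Z p.1 p.2) (fun q => t q.1.1 q.1.2 q.2) n →
    Wire₃ V r U s Z t n
  | .inl f => .inl ⟨f.1.1, .inl ⟨f.1.2, f.2⟩⟩
  | .inr x => .inr (.inr x)

theorem toWire₃'_injective : Function.Injective (toWire₃' :
    Ends (Σ p : Σ v, U v, Z p.1 p.2) (fun q => t q.1.1 q.1.2 q.2) n → Wire₃ V r U s Z t n) := by
  rintro (⟨⟨v, u⟩, f⟩ | x) (⟨⟨v', u'⟩, f'⟩ | x') h
  · simp only [toWire₃', Sum.inl.injEq, Sigma.mk.injEq] at h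
    obtain ⟨rfl, h⟩ := h
    simp only [heq_eq_eq, Sum.inl.injEq, Sigma.mk.injEq] at h
    obtain ⟨rfl, h⟩ := h
    simp only [heq_eq_eq] at h
    rw [h]
  · simp [toWire₃'] at h
  · simp [toWire₃'] at h
  · simp only [toWire₃', Sum.inr.injEq] at h
    rw [h]

/-- The reassociation of the flags of an iterated substitution. -/
abbrev assocMap : Ends (Σ p : Σ v, U v, Z p.1 p.2) (fun q => t q.1.1 q.1.2 q.2) n ≃
    Ends (Σ v, Σ u, Z v u) (fun q => t q.1 q.2.1 q.2.2) n :=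
  Ends.map (r := fun q : Σ v, Σ u, Z v u => t q.1 q.2.1 q.2.2) (Equiv.sigmaAssoc Z)
    (fun _ => .refl _) (.refl _)

/-- Substitution is associative. -/
theorem subst_subst (T : CTree V r n) (S : ∀ v, CTree (U v) (s v) (r v))
    (R : ∀ v u, CTree (Z v u) (t v u) (s v u)) :
    ∀ x y, ((T.subst S).subst (fun p => R p.1 p.2)).edge x y ↔
      (T.subst (fun v => (S v).subst (R v))).edge (assocMap x) (assocMap y) := by
  apply edge_iff_of_imp
  intro x y hxy
  let E := Relation.EqvGen
    (fun p q : Wire₃ V r U s Z t n => side T R p = q ∨ mid S p = q)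
  have hR : ∀ v u a b, (R v u).edge a b → E (.inl ⟨⟨v, u⟩, a⟩) (.inl ⟨⟨v, u⟩, b⟩) :=
    fun v u a b h => .rel _ _ (Or.inl (by simp only [side, ((R v u).edge_iff a b).1 h]))
  have hT : ∀ a b, T.edge a b → E (.inr a) (.inr b) :=
    fun a b h => .rel _ _ (Or.inl (by simp only [side, (T.edge_iff a b).1 h]))
  have hS : ∀ v a b, (S v).edge a b → E (toWire₃ v a) (toWire₃ v b) :=
    fun v a b h => .rel _ _ (Or.inr (by rw [mid_toWire₃, ((S v).edge_iff a b).1 h]))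
  -- first bracketing
  have h1 : E (toWire₃' x) (toWire₃' y) := by
    let A : Wire V r U s n → Wire₃ V r U s Z t n :=
      Sum.elim (fun p => toWire₃ p.1 p.2) (fun x => .inr (.inr x))
    have hA : ∀ p q, Relation.EqvGen (Step T S) p q → E (A p) (A q) := by
      intro p q h
      induction h with
      | rel p q h =>
        cases h with
        | inner v x y h => exact hS v x y h
        | outer x y h =>
          have : ∀ z : Ends V r n, A (Wire.ofOuter z) = .inr z := by rintro (f | z) <;> rfl
          rw [this, this]; exact hT x y h
      | refl => exact .refl _
      | symm _ _ _ ih => exact .symm _ _ ih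
      | trans _ _ _ _ _ ih ih' => exact .trans _ _ _ ih ih'
    let B : Wire (Σ v, U v) (fun p => s p.1 p.2) (fun p => Z p.1 p.2) (fun p => t p.1 p.2) n →
        Wire₃ V r U s Z t n := Sum.elim .inl (fun x => .inr (.inr x))
    have hB : ∀ p q, Relation.EqvGen (Step (T.subst S) (fun p => R p.1 p.2)) p q →
        E (B p) (B q) := by
      intro p q h
      induction h with
      | rel p q h =>
        cases h with
        | inner v x y h => exact hR v.1 v.2 x y h
        | outer x y h =>
          have : ∀ z : Ends (Σ v, U v) (fun p => s p.1 p.2) n,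
              B (Wire.ofOuter z) = A (Wire.ofEnd z) := by rintro (f | z) <;> rfl
          rw [this, this]; exact hA _ _ h.2
      | refl => exact .refl _
      | symm _ _ _ ih => exact .symm _ _ ih
      | trans _ _ _ _ _ ih ih' => exact .trans _ _ _ ih ih'
    have hBe : ∀ z, B (Wire.ofEnd z) = toWire₃' z := by rintro (f | z) <;> rfl
    rw [← hBe, ← hBe]
    exact hB _ _ hxy.2
  -- second bracketing
  have h2 : ∀ a b, (T.subst (fun v => (S v).subst (R v))).edge (assocMap a) (assocMap b) →
      E (toWire₃' a) (toWire₃' b) := by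
    let A : ∀ v, Wire (U v) (s v) (Z v) (t v) (r v) → Wire₃ V r U s Z t n := fun v =>
      Sum.elim (fun p => .inl ⟨⟨v, p.1⟩, p.2⟩) (fun j => .inr (.inl ⟨v, j⟩))
    have hA : ∀ v p q, Relation.EqvGen (Step (S v) (R v)) p q → E (A v p) (A v q) := by
      intro v p q h
      induction h with
      | rel p q h =>
        cases h with
        | inner u x y h => exact hR v u x y h
        | outer x y h =>
          have : ∀ z : Ends (U v) (s v) (r v), A v (Wire.ofOuter z) = toWire₃ v z := by
            rintro (f | z) <;> rfl
          rw [this, this]; exact hS v x y h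
      | refl => exact .refl _
      | symm _ _ _ ih => exact .symm _ _ ih
      | trans _ _ _ _ _ ih ih' => exact .trans _ _ _ ih ih'
    let B : Wire V r (fun v => Σ u, Z v u) (fun v q => t v q.1 q.2) n →
        Wire₃ V r U s Z t n :=
      Sum.elim (fun p => A p.1 (Wire.ofEnd p.2)) (fun x => .inr (.inr x))
    have hB : ∀ p q, Relation.EqvGen (Step T (fun v => (S v).subst (R v))) p q →
        E (B p) (B q) := by
      intro p q h
      induction h with
      | rel p q h =>
        cases h with
        | inner v x y h => exact hA v _ _ h.2
        | outer x y h =>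
          have : ∀ z : Ends V r n, B (Wire.ofOuter z) = .inr z := by rintro (f | z) <;> rfl
          rw [this, this]; exact hT x y h
      | refl => exact .refl _
      | symm _ _ _ ih => exact .symm _ _ ih
      | trans _ _ _ _ _ ih ih' => exact .trans _ _ _ ih ih'
    have hBe : ∀ z : Ends (Σ p : Σ v, U v, Z p.1 p.2) (fun q => t q.1.1 q.1.2 q.2) n,
        B (Wire.ofEnd (assocMap z)) = toWire₃' z := by rintro (f | z) <;> rfl
    intro a b h
    rw [← hBe, ← hBe]
    exact hB _ _ h.2
  obtain ⟨z, hz⟩ := assocMap.surjective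
    ((T.subst (fun v => (S v).subst (R v))).opp (assocMap x))
  have h3 := (T.subst (fun v => (S v).subst (R v))).edge_opp (assocMap x)
  rw [← hz] at h3
  have hmid : ∀ z : Ends (Σ p : Σ v, U v, Z p.1 p.2) (fun q => t q.1.1 q.1.2 q.2) n,
      mid S (toWire₃' z) = toWire₃' z := by rintro (f | z) <;> rfl
  have huniq := exists_unique_end (side T R) (mid S) ?_ ?_ ?_ (toWire₃' x) (Or.inr (hmid x))
  · have hzy : z = y := toWire₃'_injective (huniq.unique
      ⟨fun h => ?_, Or.inr (hmid z), h2 _ _ h3⟩ ⟨fun h => hxy.1 (toWire₃'_injective h).symm,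
        Or.inr (hmid y), h1⟩)
    · rw [← hzy]; exact h3
    · rw [toWire₃'_injective h] at h3
      exact irrefl _ _ h3
  · rintro (p | x)
    · simp [side, opp_opp]
    · simp [side, opp_opp]
  · rintro (⟨p, f | j⟩ | (f | x))
    · rfl
    · change mid S (toWire₃ _ _) = _; rw [mid_toWire₃, opp_opp]; rfl
    · change mid S (toWire₃ _ _) = _; rw [mid_toWire₃, opp_opp]; rfl
    · rfl
  · rintro (⟨p, x⟩ | x) ⟨h, -⟩
    · simp [side, opp_ne] at h
    · simp [side, opp_ne] at h

end assoc
end CTree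

/-! ### Multilinear maps on modules given by generators and relations -/

section multilinear
variable {k : Type*} [CommRing k] {ι : Type*} [Fintype ι] {N : Type*} [AddCommGroup N] [Module k N]

theorem exists_multilinear_free {D : ι → Type*} (g : (∀ i, D i) → N) :
    ∃ F : MultilinearMap k (fun i => D i →₀ k) N,
      ∀ d : ∀ i, D i, F (fun i => Finsupp.single (d i) 1) = g d := by
  classical
  refine ⟨(MultilinearMap.fromDFinsuppEquiv D k (fun p => MultilinearMap.mkPiRing k ι (g p))).compLinearMap
    (fun i => (finsuppLequivDFinsupp (ι := D i) (M := k) k).toLinearMap), fun d => ?_⟩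
  rw [MultilinearMap.compLinearMap_apply]
  have : (fun i => (finsuppLequivDFinsupp (ι := D i) (M := k) k).toLinearMap
      (Finsupp.single (d i) 1)) = fun i => DFinsupp.single (d i) (1 : k) := by
    funext i; simp
  rw [this, MultilinearMap.fromDFinsuppEquiv_single (M := fun i _ => k)]
  simp

theorem exists_multilinear_quotient {M : ι → Type*} [∀ i, AddCommGroup (M i)]
    [∀ i, Module k (M i)] (P : ∀ i, Submodule k (M i)) (F : MultilinearMap k M N)
    (hF : ∀ [DecidableEq ι], ∀ x i, ∀ z ∈ P i, F (Function.update x i z) = 0) :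
    ∃ G : MultilinearMap k (fun i => M i ⧸ P i) N,
      ∀ x : ∀ i, M i, G (fun i => (P i).mkQ (x i)) = F x := by
  classical
  have h1 : ∀ x y : ∀ i, M i, (∀ i, x i - y i ∈ P i) → F x = F y := by
    intro x y hxy
    have : ∀ s : Finset ι, F (s.piecewise x y) = F y := by
      intro s
      induction s using Finset.induction_on with
      | empty => simp
      | insert a s ha ih =>
        rw [Finset.piecewise_insert]
        have e : x a = y a + (x a - y a) := by abel
        rw [e, F.map_update_add, hF _ _ _ (hxy a), add_zero, ← ih]
        congr 1
        rw [Function.update_eq_self_iff, Finset.piecewise_eq_of_notMem _ _ _ ha]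
    simpa using this Finset.univ
  let out : ∀ i, (M i ⧸ P i) → M i := fun i => Function.surjInv (P i).mkQ_surjective
  have hout : ∀ i q, (P i).mkQ (out i q) = q := fun i => Function.surjInv_eq _
  have h2 : ∀ x : ∀ i, M i, F (fun i => out i ((P i).mkQ (x i))) = F x := by
    intro x
    apply h1
    intro i
    rw [← Submodule.Quotient.mk_eq_zero, Submodule.Quotient.mk_sub, sub_eq_zero]
    exact hout i _
  have h3 : ∀ (q : ∀ i, M i ⧸ P i) (i : ι) (z : M i),
      F (fun j => out j (Function.update q i ((P i).mkQ z) j)) =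
        F (Function.update (fun j => out j (q j)) i z) := by
    intro q i z
    rw [← h2 (Function.update (fun j => out j (q j)) i z)]
    congr 1
    funext j
    by_cases hj : j = i
    · subst hj; simp
    · simp only [Function.update_of_ne hj, hout]
  refine ⟨MultilinearMap.mk' (fun q => F (fun i => out i (q i))) ?_ ?_, fun x => h2 x⟩
  · intro q i a b
    obtain ⟨a, rfl⟩ := (P i).mkQ_surjective a
    obtain ⟨b, rfl⟩ := (P i).mkQ_surjective b
    rw [← map_add, h3, h3, h3, F.map_update_add]
  · intro q i c a
    obtain ⟨a, rfl⟩ := (P i).mkQ_surjective a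
    rw [← map_smul, h3, h3, F.map_update_smul]

theorem exists_multilinear_presented {D : ι → Type*} (R : ∀ i, Set (D i →₀ k))
    (g : (∀ i, D i) → N)
    (hg : ∀ [DecidableEq ι], ∀ i (d : ∀ i, D i), ∀ z ∈ R i,
      Finsupp.linearCombination k (fun x => g (Function.update d i x)) z = 0) :
    ∃ G : MultilinearMap k (fun i => (D i →₀ k) ⧸ Submodule.span k (R i)) N,
      ∀ d : ∀ i, D i, G (fun i => (Submodule.span k (R i)).mkQ (Finsupp.single (d i) 1)) = g d := by
  classical
  obtain ⟨F, hF⟩ := exists_multilinear_free (k := k) g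
  have h0 : ∀ (i : ι) (s : Finset ι) (x : ∀ i, D i →₀ k) (z : D i →₀ k), z ∈ R i →
      (∀ j, j ∉ s → j ≠ i → ∃ d, x j = Finsupp.single d 1) → F (Function.update x i z) = 0 := by
    intro i s
    induction s using Finset.induction_on with
    | empty =>
      intro x z hz hx
      rcases isEmpty_or_nonempty (D i) with hD | hD
      · exact F.map_coord_zero i (by rw [Function.update_self]; exact Subsingleton.elim _ _)
      · obtain ⟨d0⟩ := hD
        have : ∀ j, ∃ d : D j, j ≠ i → x j = Finsupp.single d 1 := by
          intro j
          by_cases hj : j = i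
          · subst hj; exact ⟨d0, fun h => absurd rfl h⟩
          · obtain ⟨d, hd⟩ := hx j (by simp) hj; exact ⟨d, fun _ => hd⟩
        choose d hd using this
        have e : ∀ z, Function.update x i z =
            Function.update (fun j => (Finsupp.single (d j) 1 : D j →₀ k)) i z := by
          intro z
          funext j
          by_cases hj : j = i
          · subst hj; simp
          · simp [Function.update_of_ne hj, hd j hj]
        rw [e, ← hg i d z hz]
        have : F.toLinearMap (fun j => (Finsupp.single (d j) 1 : D j →₀ k)) i =
            Finsupp.linearCombination k (fun x => g (Function.update d i x)) := by
          apply Finsupp.lhom_ext'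
          intro a
          ext
          simp only [LinearMap.comp_apply, Finsupp.lsingle_apply, MultilinearMap.toLinearMap_apply,
            Finsupp.linearCombination_single, one_smul]
          rw [← hF]
          congr 1
          funext j
          by_cases hj : j = i
          · subst hj; simp
          · simp [Function.update_of_ne hj]
        exact LinearMap.congr_fun this z
    | insert a s ha ih =>
      intro x z hz hx
      by_cases hai : a = i
      · subst hai
        exact ih x z hz (fun j hj hji => hx j (by simp [hj, hji]) hji)
      · have key : ∀ y : D a →₀ k, F (Function.update (Function.update x i z) a y) = 0 := by
          intro y
          induction y using Finsupp.induction_linear with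
          | zero => exact F.map_coord_zero a (by simp)
          | add y y' h h' => rw [F.map_update_add, h, h', add_zero]
          | single d c =>
            have : (Finsupp.single d c : D a →₀ k) = c • Finsupp.single d 1 := by simp
            rw [this, F.map_update_smul, Function.update_comm (Ne.symm hai), ih _ z hz, smul_zero]
            intro j hj hji
            by_cases hja : j = a
            · subst hja; exact ⟨d, by simp⟩
            · rw [Function.update_of_ne hja]; exact hx j (by simp [hj, hja]) hji
        have := key (Function.update x i z a)
        rwa [Function.update_eq_self] at this
  have h1 : ∀ [DecidableEq ι], ∀ x i, ∀ z ∈ Submodule.span k (R i),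
      F (Function.update x i z) = 0 := by
    intro hdec x i z hz
    induction hz using Submodule.span_induction with
    | mem z hz =>
      rw [Subsingleton.elim hdec (fun a b => Classical.propDecidable (a = b))]
      exact h0 i Finset.univ x z hz (fun j hj => absurd (Finset.mem_univ j) hj)
    | zero => exact F.map_coord_zero i (by simp)
    | add y z _ _ h h' => rw [F.map_update_add, h, h', add_zero]
    | smul c z _ h => rw [F.map_update_smul, h, smul_zero]
  obtain ⟨G, hG⟩ := exists_multilinear_quotient (fun i => Submodule.span k (R i)) F h1
  exact ⟨G, fun d => by rw [hG, hF]⟩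
end multilinear

/-! ### Cyclic Σ-modules -/

/-- Cyclic Σ-modules, that is, sequences of right `k[Σ⁺_n]`-modules, where `Σ⁺_n` is the group of
the permutations of `{0, …, n}`. The action of `σ` sends `x` to `x σ`. -/
structure CycMod (k : Type u) [CommRing k] where
  X : ℕ → Type (max u v)
  [grp : ∀ n, AddCommGroup (X n)]
  [mod : ∀ n, Module k (X n)]
  act : ∀ n, Equiv.Perm (Fin (n + 1)) → X n →ₗ[k] X n
  act_one : ∀ n x, act n 1 x = x
  act_mul : ∀ n σ τ x, act n (σ * τ) x = act n τ (act n σ x)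

attribute [instance] CycMod.grp CycMod.mod

namespace CycMod
variable {k : Type u} [CommRing k]

/-- Morphisms: sequences of equivariant linear maps. -/
@[ext]
structure Hom (W W' : CycMod.{u, v} k) where
  app : ∀ n, W.X n →ₗ[k] W'.X n
  equivariant : ∀ n σ x, app n (W.act n σ x) = W'.act n σ (app n x)

instance : Category (CycMod.{u, v} k) where
  Hom := Hom
  id W := ⟨fun _ => LinearMap.id, fun _ _ _ => rfl⟩
  comp f g := ⟨fun n => g.app n ∘ₗ f.app n, fun n σ x => by simp [f.equivariant, g.equivariant]⟩

@[ext]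
theorem hom_ext {W W' : CycMod.{u, v} k} {f g : W ⟶ W'} (h : ∀ n x, f.app n x = g.app n x) :
    f = g := by
  apply Hom.ext
  funext n
  exact LinearMap.ext (h n)

theorem id_app (W : CycMod.{u, v} k) (n : ℕ) (x : W.X n) : Hom.app (𝟙 W) n x = x := rfl

theorem comp_app {W W' W'' : CycMod.{u, v} k} (f : W ⟶ W') (g : W' ⟶ W'') (n : ℕ) (x : W.X n) :
    Hom.app (f ≫ g) n x = g.app n (f.app n x) := rfl

/-- Auxiliary to `tr`. -/
def trAux (W : CycMod.{u, v} k) : ∀ {a b : ℕ}, a = b → (Fin (a + 1) ≃ Fin (b + 1)) →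
    W.X b →ₗ[k] W.X a
  | a, _, rfl, φ => W.act a φ

/-- The map `x ↦ x φ` for a bijection `φ : {0, …, a} → {0, …, b}`. This is the identification
of the values of `W` on finite sets of the same cardinality. As `a = b`, it is just the action of
the permutation `φ`. -/
def tr (W : CycMod.{u, v} k) {a b : ℕ} (φ : Fin (a + 1) ≃ Fin (b + 1)) : W.X b →ₗ[k] W.X a :=
  W.trAux (Nat.succ_injective (Fin.equiv_iff_eq.1 ⟨φ⟩)) φ

theorem tr_self (W : CycMod.{u, v} k) {a : ℕ} (φ : Equiv.Perm (Fin (a + 1))) :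
    W.tr φ = W.act a φ := rfl

theorem tr_refl (W : CycMod.{u, v} k) {a : ℕ} (x : W.X a) :
    W.tr (Equiv.refl (Fin (a + 1))) x = x := W.act_one a x

theorem tr_trans (W : CycMod.{u, v} k) {a b c : ℕ} (φ : Fin (a + 1) ≃ Fin (b + 1))
    (ψ : Fin (b + 1) ≃ Fin (c + 1)) (x : W.X c) : W.tr (φ.trans ψ) x = W.tr φ (W.tr ψ x) := by
  obtain rfl : a = b := Nat.succ_injective (Fin.equiv_iff_eq.1 ⟨φ⟩)
  obtain rfl : a = c := Nat.succ_injective (Fin.equiv_iff_eq.1 ⟨ψ⟩)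
  exact W.act_mul a ψ φ x

theorem tr_finCongr (W : CycMod.{u, v} k) {V : Type} {r : V → ℕ} (w : ∀ v, W.X (r v)) {a b : V}
    (h : a = b) : W.tr (finCongr (by rw [h]) : Fin (r b + 1) ≃ Fin (r a + 1)) (w a) = w b := by
  subst h
  exact W.tr_refl _

theorem hom_tr {W W' : CycMod.{u, v} k} (f : W ⟶ W') {a b : ℕ} (φ : Fin (a + 1) ≃ Fin (b + 1))
    (x : W.X b) : f.app a (W.tr φ x) = W'.tr φ (f.app b x) := by
  obtain rfl : a = b := Nat.succ_injective (Fin.equiv_iff_eq.1 ⟨φ⟩)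
  exact f.equivariant a φ x

end CycMod

/-! ### The tree triples

The value of `Ψ_+(W)` at `n` is the colimit over the category of the cyclic labeled trees `T` with
legs `0, …, n` and their isomorphisms of the tensor products of `W((edge(v)))` over the vertices
`v` of `T`. It is built here as the quotient of the free module on the trees whose vertices are
decorated by elements of `W` by the relations that identify isomorphic decorated trees and that
make the decorations multilinear. It suffices to use the trees with the sets `Fin m` of vertices.
The parameter `ext` tells whether the exceptional tree is admitted: for `ext = False` every tree
must have a vertex, for `ext = True` there is no condition. -/

section Psi
variable {k : Type u} [CommRing k]

/-- The decorated trees `(T, w)` and `(T', w')` are isomorphic, by an isomorphism that respects the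
labels of the legs. -/
def DIso (W : CycMod.{u, v} k) {n : ℕ} {V V' : Type} [Fintype V] [Fintype V'] {r : V → ℕ}
    {r' : V' → ℕ} (T : CTree V r n) (w : ∀ v, W.X (r v)) (T' : CTree V' r' n)
    (w' : ∀ v, W.X (r' v)) : Prop :=
  ∃ (e : V' ≃ V) (φ : ∀ v, Fin (r' v + 1) ≃ Fin (r (e v) + 1)),
    (∀ x y, T'.edge x y ↔
      T.edge (CTree.Ends.map e φ (.refl _) x) (CTree.Ends.map e φ (.refl _) y)) ∧
    ∀ v, w' v = W.tr (φ v) (w (e v))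

/-- Decorated trees. -/
structure DTree (ext : Prop) (W : CycMod.{u, v} k) (n : ℕ) where
  m : ℕ
  r : Fin m → ℕ
  tree : CTree (Fin m) r n
  ok : ext ∨ Nonempty (Fin m)
  dec : ∀ v, W.X (r v)

/-- Change of the decoration of the vertex `v` to `x`. -/
def DTree.withDec {ext : Prop} {W : CycMod.{u, v} k} {n : ℕ} (D : DTree ext W n) (v : Fin D.m)
    (x : W.X (D.r v)) : DTree ext W n where
  m := D.m
  r := D.r
  tree := D.tree
  ok := D.ok
  dec := Function.update D.dec v x

variable {ext : Prop} {W W' W'' : CycMod.{u, v} k} {n : ℕ}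

/-- The relations. -/
inductive Rel (ext : Prop) (W : CycMod.{u, v} k) (n : ℕ) : (DTree ext W n →₀ k) → Prop
  | iso (D D' : DTree ext W n) (h : DIso W D.tree D.dec D'.tree D'.dec) :
      Rel ext W n (Finsupp.single D 1 - Finsupp.single D' 1)
  | add (D : DTree ext W n) (v : Fin D.m) (x y : W.X (D.r v)) :
      Rel ext W n (Finsupp.single (D.withDec v (x + y)) 1 -
        (Finsupp.single (D.withDec v x) 1 + Finsupp.single (D.withDec v y) 1))
  | smul (D : DTree ext W n) (v : Fin D.m) (c : k) (x : W.X (D.r v)) :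
      Rel ext W n (Finsupp.single (D.withDec v (c • x)) 1 - Finsupp.single (D.withDec v x) c)

/-- The module of decorated trees with the legs `0, …, n`. -/
abbrev PsiX (ext : Prop) (W : CycMod.{u, v} k) (n : ℕ) : Type (max u v) :=
  (DTree ext W n →₀ k) ⧸ Submodule.span k {z | Rel ext W n z}

namespace PsiX

/-- The class of a decorated tree. -/
noncomputable def mk (D : DTree ext W n) : PsiX ext W n :=
  (Submodule.span k {z | Rel ext W n z}).mkQ (Finsupp.single D 1)

theorem mk_iso (D D' : DTree ext W n) (h : DIso W D.tree D.dec D'.tree D'.dec) :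
    mk D = mk D' := by
  rw [mk, mk, ← sub_eq_zero, ← map_sub]
  exact (Submodule.Quotient.mk_eq_zero _).2 (Submodule.subset_span (.iso D D' h))

theorem mk_add (D : DTree ext W n) (v : Fin D.m) (x y : W.X (D.r v)) :
    mk (D.withDec v (x + y)) = mk (D.withDec v x) + mk (D.withDec v y) := by
  rw [mk, mk, mk, ← sub_eq_zero, ← map_add, ← map_sub]
  exact (Submodule.Quotient.mk_eq_zero _).2 (Submodule.subset_span (.add D v x y))

theorem mk_smul (D : DTree ext W n) (v : Fin D.m) (c : k) (x : W.X (D.r v)) :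
    mk (D.withDec v (c • x)) = c • mk (D.withDec v x) := by
  have : Finsupp.single (D.withDec v x) c = c • Finsupp.single (D.withDec v x) 1 := by simp
  rw [mk, mk, ← sub_eq_zero, ← map_smul, ← map_sub, ← this]
  exact (Submodule.Quotient.mk_eq_zero _).2 (Submodule.subset_span (.smul D v c x))

theorem span_mk : Submodule.span k (Set.range (mk : DTree ext W n → PsiX ext W n)) = ⊤ := by
  rw [eq_top_iff]
  rintro x -
  obtain ⟨x, rfl⟩ := (Submodule.span k {z | Rel ext W n z}).mkQ_surjective x
  induction x using Finsupp.induction_linear with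
  | zero => rw [map_zero]; exact zero_mem _
  | add x y hx hy => rw [map_add]; exact add_mem hx hy
  | single D c =>
    have : (Finsupp.single D c : DTree ext W n →₀ k) = c • Finsupp.single D 1 := by simp
    rw [this, map_smul]
    exact Submodule.smul_mem _ _ (Submodule.subset_span ⟨D, rfl⟩)

theorem lift_aux {N : Type*} [AddCommGroup N] [Module k N] (F : DTree ext W n → N)
    (hiso : ∀ D D' : DTree ext W n, DIso W D.tree D.dec D'.tree D'.dec → F D = F D')
    (hadd : ∀ (D : DTree ext W n) v x y,
      F (D.withDec v (x + y)) = F (D.withDec v x) + F (D.withDec v y))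
    (hsmul : ∀ (D : DTree ext W n) v (c : k) x,
      F (D.withDec v (c • x)) = c • F (D.withDec v x))
    (z : DTree ext W n →₀ k) (hz : Rel ext W n z) : Finsupp.linearCombination k F z = 0 := by
  cases hz with
  | iso D D' h => simp [hiso D D' h]
  | add D v x y => simp [hadd]
  | smul D v c x => simp [hsmul]

/-- The universal property. -/
noncomputable def lift {N : Type*} [AddCommGroup N] [Module k N] (F : DTree ext W n → N)
    (hiso : ∀ D D' : DTree ext W n, DIso W D.tree D.dec D'.tree D'.dec → F D = F D')
    (hadd : ∀ (D : DTree ext W n) v x y,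
      F (D.withDec v (x + y)) = F (D.withDec v x) + F (D.withDec v y))
    (hsmul : ∀ (D : DTree ext W n) v (c : k) x,
      F (D.withDec v (c • x)) = c • F (D.withDec v x)) : PsiX ext W n →ₗ[k] N :=
  Submodule.liftQ _ (Finsupp.linearCombination k F)
    (Submodule.span_le.2 fun z hz => lift_aux F hiso hadd hsmul z hz)

theorem lift_mk {N : Type*} [AddCommGroup N] [Module k N] (F : DTree ext W n → N) (hiso hadd hsmul)
    (D : DTree ext W n) : lift F hiso hadd hsmul (mk D) = F D := by
  simp [lift, mk]

theorem lin_ext {N : Type*} [AddCommGroup N] [Module k N] {f g : PsiX ext W n →ₗ[k] N}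
    (h : ∀ D, f (mk D) = g (mk D)) : f = g :=
  LinearMap.ext_on_range span_mk h

section cls
variable {V V' : Type} [Fintype V] [Fintype V'] {r : V → ℕ} {r' : V' → ℕ}

/-- Numbering of the vertices of a decorated tree. -/
noncomputable def reindex (h : ext ∨ Nonempty V) (T : CTree V r n) (w : ∀ v, W.X (r v)) :
    DTree ext W n where
  m := Fintype.card V
  r i := r ((Fintype.equivFin V).symm i)
  tree := T.pull (Fintype.equivFin V).symm (fun _ => .refl _) (.refl _)
  ok := h.imp_right fun h => h.map (Fintype.equivFin V)
  dec i := w ((Fintype.equivFin V).symm i)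

/-- The class of a decorated tree with any finite set of vertices. -/
noncomputable def cls (h : ext ∨ Nonempty V) (T : CTree V r n) (w : ∀ v, W.X (r v)) :
    PsiX ext W n := mk (reindex h T w)

theorem sigma_finCongr {a b : V} (h : a = b) (j : Fin (r b + 1)) :
    (⟨a, finCongr (by rw [h]) j⟩ : Σ v, Fin (r v + 1)) = ⟨b, j⟩ := by
  subst h; rfl

theorem cls_iso (h : ext ∨ Nonempty V) (h' : ext ∨ Nonempty V') (T : CTree V r n)
    (w : ∀ v, W.X (r v)) (T' : CTree V' r' n) (w' : ∀ v, W.X (r' v)) (H : DIso W T w T' w') :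
    cls h T w = cls h' T' w' := by
  obtain ⟨e, φ, h1, h2⟩ := H
  have hE : ∀ i, (Fintype.equivFin V).symm (((Fintype.equivFin V').symm.trans
      (e.trans (Fintype.equivFin V))) i) = e ((Fintype.equivFin V').symm i) := by
    intro i; simp
  have : DIso W (T.pull (Fintype.equivFin V).symm (fun _ => .refl _) (.refl _))
      (fun i => w ((Fintype.equivFin V).symm i))
      (T'.pull (Fintype.equivFin V').symm (fun _ => .refl _) (.refl _))
      (fun i => w' ((Fintype.equivFin V').symm i)) := by
    refine ⟨(Fintype.equivFin V').symm.trans (e.trans (Fintype.equivFin V)),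
      fun i => (φ ((Fintype.equivFin V').symm i)).trans (finCongr (congrArg (fun v => r v + 1) (hE i)).symm), ?_, ?_⟩
    · have key : ∀ z, CTree.Ends.map (r := r) (r' := fun i => r ((Fintype.equivFin V).symm i))
          (Fintype.equivFin V).symm (fun _ => .refl _) (.refl _)
          (CTree.Ends.map (r := fun i => r ((Fintype.equivFin V).symm i))
            (r' := fun i => r' ((Fintype.equivFin V').symm i))
            ((Fintype.equivFin V').symm.trans (e.trans (Fintype.equivFin V)))
            (fun i => (φ ((Fintype.equivFin V').symm i)).trans (finCongr (congrArg (fun v => r v + 1) (hE i)).symm))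
            (.refl (Fin (n + 1))) z) =
          CTree.Ends.map e φ (.refl _) (CTree.Ends.map (r := r')
            (Fintype.equivFin V').symm (fun _ => .refl _) (.refl _) z) := by
        rintro (⟨i, j⟩ | x)
        · exact congrArg Sum.inl (sigma_finCongr (hE i) _)
        · rfl
      intro x y
      change T'.edge _ _ ↔ T.edge _ _
      refine (h1 _ _).trans ?_
      rw [← key, ← key]
    · intro i
      change w' _ = _
      rw [h2, CycMod.tr_trans]
      congr 1
      exact (W.tr_finCongr w (hE i)).symm
  exact mk_iso _ _ this

theorem mk_eq_cls (D : DTree ext W n) : mk D = cls D.ok D.tree D.dec :=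
  have : DIso W D.tree D.dec
      (D.tree.pull (Fintype.equivFin (Fin D.m)).symm (fun _ => .refl _) (.refl _))
      (fun i => D.dec ((Fintype.equivFin (Fin D.m)).symm i)) :=
    ⟨(Fintype.equivFin _).symm, fun _ => .refl _, fun _ _ => Iff.rfl,
      fun _ => (W.tr_refl _).symm⟩
  mk_iso _ _ this

theorem reindex_update [DecidableEq V] (h : ext ∨ Nonempty V) (T : CTree V r n)
    (w : ∀ v, W.X (r v)) (i : Fin (Fintype.card V))
    (x : W.X (r ((Fintype.equivFin V).symm i))) :
    reindex h T (Function.update w ((Fintype.equivFin V).symm i) x) =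
      (reindex h T w).withDec i x := by
  have : (fun j => Function.update w ((Fintype.equivFin V).symm i) x
      ((Fintype.equivFin V).symm j)) = Function.update
        (fun j => w ((Fintype.equivFin V).symm j)) i x := by
    funext j
    by_cases hj : j = i
    · subst hj; rw [Function.update_self, Function.update_self]
    · rw [Function.update_of_ne hj, Function.update_of_ne (by simpa using hj)]
  simp only [reindex, DTree.withDec]
  congr 1

theorem cls_add [DecidableEq V] (h : ext ∨ Nonempty V) (T : CTree V r n) (w : ∀ v, W.X (r v))
    (v : V) (x y : W.X (r v)) : cls h T (Function.update w v (x + y)) =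
      cls h T (Function.update w v x) + cls h T (Function.update w v y) := by
  obtain ⟨i, rfl⟩ := (Fintype.equivFin V).symm.surjective v
  simp only [cls, reindex_update]
  exact mk_add _ _ _ _

theorem cls_smul [DecidableEq V] (h : ext ∨ Nonempty V) (T : CTree V r n) (w : ∀ v, W.X (r v))
    (v : V) (c : k) (x : W.X (r v)) : cls h T (Function.update w v (c • x)) =
      c • cls h T (Function.update w v x) := by
  obtain ⟨i, rfl⟩ := (Fintype.equivFin V).symm.surjective v
  simp only [cls, reindex_update]
  exact mk_smul _ _ _ _

end cls

/-- Change of the labels of the legs. -/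
noncomputable def relabel {n n' : ℕ} (l : Fin (n' + 1) ≃ Fin (n + 1)) : PsiX ext W n →ₗ[k] PsiX ext W n' :=
  lift (fun D => mk ⟨D.m, D.r, D.tree.relegs l, D.ok, D.dec⟩)
    (fun D D' ⟨e, φ, h1, h2⟩ => mk_iso _ _ ⟨e, φ, fun x y => by
      have key : ∀ z : Ends (Fin D'.m) D'.r n',
          CTree.Ends.map e φ (.refl _) (CTree.Ends.map (r := D'.r) (.refl _) (fun _ => .refl _) l z) =
          CTree.Ends.map (r := D.r) (.refl _) (fun _ => .refl _) l
            (CTree.Ends.map e φ (.refl _) z) := by rintro (f | z) <;> rfl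
      change D'.tree.edge _ _ ↔ D.tree.edge _ _
      exact (h1 _ _).trans (iff_of_eq (congrArg₂ _ (key x) (key y))), h2⟩)
    (fun D v x y => mk_add ⟨D.m, D.r, D.tree.relegs l, D.ok, D.dec⟩ v x y)
    (fun D v c x => mk_smul ⟨D.m, D.r, D.tree.relegs l, D.ok, D.dec⟩ v c x)

end PsiX
end Psi

section multi_ext
variable {k : Type*} [CommRing k] {ι : Type*} [Fintype ι] {N : Type*} [AddCommGroup N] [Module k N]
  {M : ι → Type*} [∀ i, AddCommGroup (M i)] [∀ i, Module k (M i)]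

theorem multi_ext (A : ∀ i, Set (M i)) (hA : ∀ i, Submodule.span k (A i) = ⊤)
    (F G : MultilinearMap k M N) (h : ∀ x : ∀ i, M i, (∀ i, x i ∈ A i) → F x = G x) (x : ∀ i, M i) :
    F x = G x := by
  classical
  have key : ∀ (s : Finset ι) (x : ∀ i, M i), (∀ j, j ∉ s → x j ∈ A j) → F x = G x := by
    intro s
    induction s using Finset.induction_on with
    | empty => exact fun x hx => h x (fun i => hx i (by simp))
    | insert a s ha ih =>
      intro x hx
      have h2 : ∀ y : M a, F (Function.update x a y) = G (Function.update x a y) := by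
        intro y
        have hy : y ∈ Submodule.span k (A a) := by rw [hA]; trivial
        induction hy using Submodule.span_induction with
        | mem y hy =>
          apply ih
          intro j hj
          by_cases hja : j = a
          · subst hja; rwa [Function.update_self]
          · rw [Function.update_of_ne hja]; exact hx j (by simp [hj, hja])
        | zero => rw [F.map_coord_zero a (by simp), G.map_coord_zero a (by simp)]
        | add y z _ _ h h' => rw [F.map_update_add, G.map_update_add, h, h']
        | smul c z _ h => rw [F.map_update_smul, G.map_update_smul, h]
      simpa using h2 (x a)
  exact key Finset.univ x (fun j hj => absurd (Finset.mem_univ j) hj)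

end multi_ext

section Psi
variable {k : Type u} [CommRing k] {ext : Prop} {W W' W'' : CycMod.{u, v} k} {n n' : ℕ}

namespace PsiX

theorem relabel_mk (l : Fin (n' + 1) ≃ Fin (n + 1)) (D : DTree ext W n) :
    relabel l (mk D) =
      mk ⟨D.m, D.r, D.tree.relegs l, D.ok, D.dec⟩ := lift_mk _ _ _ _ _

theorem relabel_cls {V : Type} [Fintype V] {r : V → ℕ} (h : ext ∨ Nonempty V) (T : CTree V r n)
    (w : ∀ v, W.X (r v)) (l : Fin (n' + 1) ≃ Fin (n + 1)) :
    relabel l (cls h T w) = cls h (T.relegs l) w := by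
  refine (relabel_mk l _).trans (congrArg mk ?_)
  have : ((T.pull (Fintype.equivFin V).symm (fun _ => .refl _) (.refl _)).relegs l :
      CTree (Fin (Fintype.card V)) (fun i => r ((Fintype.equivFin V).symm i)) n') =
      (T.relegs l).pull (Fintype.equivFin V).symm (fun _ => .refl _) (.refl _) := by
    simp only [CTree.relegs, CTree.pull, CTree.mk.injEq]
    funext x y
    rcases x with x | x <;> rcases y with y | y <;> rfl
  simp only [reindex]
  rw [← this]
  rfl

theorem relabel_refl (x : PsiX ext W n) : relabel (.refl _) x = x := by
  have : (relabel (.refl _) : PsiX ext W n →ₗ[k] _) = LinearMap.id := by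
    apply lin_ext
    intro D
    rw [relabel_mk]
    refine mk_iso _ _ ⟨.refl _, fun _ => .refl _, fun x y => ?_, fun v => (W.tr_refl _).symm⟩
    rcases x with x | x <;> rcases y with y | y <;> rfl
  exact LinearMap.congr_fun this x

theorem relabel_trans {n'' : ℕ} (l : Fin (n' + 1) ≃ Fin (n + 1)) (l' : Fin (n'' + 1) ≃ Fin (n' + 1))
    (x : PsiX ext W n) : relabel (l'.trans l) x = relabel l' (relabel l x) := by
  have : (relabel (l'.trans l) : PsiX ext W n →ₗ[k] _) = (relabel l') ∘ₗ (relabel l) := by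
    apply lin_ext
    intro D
    rw [relabel_mk, LinearMap.comp_apply, relabel_mk, relabel_mk]
    refine mk_iso _ _ ⟨.refl _, fun _ => .refl _, fun x y => ?_, fun v => (W.tr_refl _).symm⟩
    rcases x with x | x <;> rcases y with y | y <;> rfl
  exact LinearMap.congr_fun this x

end PsiX

/-- The value of the functor `Ψ_+` (or `Γ_+`) at `W`; permutations act by the labels of the legs. -/
noncomputable def Psi (ext : Prop) (W : CycMod.{u, v} k) : CycMod.{u, v} k where
  X n := PsiX ext W n
  act n σ := PsiX.relabel σ
  act_one n x := PsiX.relabel_refl x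
  act_mul n σ τ x := PsiX.relabel_trans σ τ x

theorem Psi_tr (l : Fin (n' + 1) ≃ Fin (n + 1)) (x : PsiX ext W n) :
    (Psi ext W).tr l x = PsiX.relabel l x := by
  obtain rfl : n' = n := Nat.succ_injective (Fin.equiv_iff_eq.1 ⟨l⟩)
  rfl

namespace PsiX

theorem cls_iso_dec {V V' : Type} [Fintype V] [Fintype V'] {r : V → ℕ} {r' : V' → ℕ}
    (f : W ⟶ W') (T : CTree V r n) (w : ∀ v, W.X (r v)) (T' : CTree V' r' n) (w' : ∀ v, W.X (r' v))
    (H : DIso W T w T' w') :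
    DIso W' T (fun v => f.app _ (w v)) T' (fun v => f.app _ (w' v)) := by
  obtain ⟨e, φ, h1, h2⟩ := H
  exact ⟨e, φ, h1, fun v => (congrArg _ (h2 v)).trans (CycMod.hom_tr f _ _)⟩

theorem cls_app_update {V : Type} [Fintype V] [DecidableEq V] {r : V → ℕ} (f : W ⟶ W')
    (w : ∀ v, W.X (r v)) (v : V) (x : W.X (r v)) :
    (fun u => f.app _ (Function.update w v x u)) =
      Function.update (fun u => f.app _ (w u)) v (f.app _ x) := by
  funext u
  exact Function.apply_update (fun u => f.app (r u)) w v x u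

/-- The map that applies `f` to all the decorations. -/
noncomputable def map (f : W ⟶ W') (n : ℕ) : PsiX ext W n →ₗ[k] PsiX ext W' n :=
  lift (fun D => cls D.ok D.tree (fun v => f.app _ (D.dec v)))
    (fun _ _ H => cls_iso _ _ _ _ _ _ (cls_iso_dec f _ _ _ _ H))
    (fun D v x y => by
      change cls D.ok D.tree (fun u => f.app (D.r u) (Function.update D.dec v _ u)) =
        cls D.ok D.tree (fun u => f.app (D.r u) (Function.update D.dec v _ u)) +
        cls D.ok D.tree (fun u => f.app (D.r u) (Function.update D.dec v _ u))
      rw [cls_app_update, cls_app_update, cls_app_update, map_add]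
      exact cls_add _ _ _ _ _ _)
    (fun D v c x => by
      change cls D.ok D.tree (fun u => f.app (D.r u) (Function.update D.dec v _ u)) =
        c • cls D.ok D.tree (fun u => f.app (D.r u) (Function.update D.dec v _ u))
      rw [cls_app_update, cls_app_update, map_smul]
      exact cls_smul _ _ _ _ _ _)

theorem map_cls {V : Type} [Fintype V] {r : V → ℕ} (f : W ⟶ W') (h : ext ∨ Nonempty V)
    (T : CTree V r n) (w : ∀ v, W.X (r v)) :
    map f n (cls h T w) = cls h T (fun v => f.app _ (w v)) := by
  refine (lift_mk _ _ _ _ _).trans ?_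
  exact (mk_eq_cls (reindex h T (fun v => f.app _ (w v)))).symm

theorem lin_ext_cls {N : Type*} [AddCommGroup N] [Module k N] {f g : PsiX ext W n →ₗ[k] N}
    (h : ∀ D : DTree ext W n, f (cls D.ok D.tree D.dec) = g (cls D.ok D.tree D.dec)) (x) :
    f x = g x :=
  LinearMap.congr_fun (lin_ext fun D => by rw [mk_eq_cls, h]) x

end PsiX

theorem Psi_hom_ext {f g : Psi ext W ⟶ W'}
    (h : ∀ n (D : DTree ext W n),
      f.app n (PsiX.cls D.ok D.tree D.dec) = g.app n (PsiX.cls D.ok D.tree D.dec)) : f = g :=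
  CycMod.hom_ext fun n x => PsiX.lin_ext_cls (f := f.app n) (g := g.app n) (h n) x

/-- The morphism of cyclic Σ-modules that applies `f` to all the decorations. -/
noncomputable def Psi.map (ext : Prop) (f : W ⟶ W') : Psi ext W ⟶ Psi ext W' where
  app n := PsiX.map f n
  equivariant n σ x := by
    change PsiX.map f n (PsiX.relabel σ x) = PsiX.relabel σ (PsiX.map f n x)
    refine PsiX.lin_ext_cls (f := PsiX.map f n ∘ₗ PsiX.relabel σ)
      (g := PsiX.relabel σ ∘ₗ PsiX.map f n) (fun D => ?_) x
    rw [LinearMap.comp_apply, LinearMap.comp_apply, PsiX.map_cls, PsiX.relabel_cls,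
      PsiX.relabel_cls, PsiX.map_cls]

theorem Psi.map_app (f : W ⟶ W') (x : PsiX ext W n) :
    (Psi.map ext f).app n x = PsiX.map f n x := rfl

/-- The functor `Ψ_+` (or `Γ_+`). -/
noncomputable def PsiFunctor (ext : Prop) (k : Type u) [CommRing k] :
    CycMod.{u, v} k ⥤ CycMod.{u, v} k where
  obj W := Psi ext W
  map f := Psi.map ext f
  map_id W := Psi_hom_ext fun n D => PsiX.map_cls _ _ _ _
  map_comp f g := Psi_hom_ext fun n D => by
    change PsiX.map _ n _ = PsiX.map _ n (PsiX.map _ n _)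
    rw [PsiX.map_cls, PsiX.map_cls, PsiX.map_cls]
    rfl

/-- The unit of the triple sends `x` to the corolla decorated by `x`. -/
noncomputable def etaHom (ext : Prop) (W : CycMod.{u, v} k) : W ⟶ Psi ext W where
  app n :=
    { toFun := fun x => PsiX.cls (Or.inr ⟨()⟩) (CTree.corolla n) (fun _ => x)
      map_add' := fun x y => by
        have := PsiX.cls_add (ext := ext) (W := W) (Or.inr ⟨()⟩) (CTree.corolla n) (fun _ => x) () x y
        simp only [Function.update_eq_const_of_subsingleton] at this
        exact this
      map_smul' := fun c x => by
        have := PsiX.cls_smul (ext := ext) (W := W) (Or.inr ⟨()⟩) (CTree.corolla n) (fun _ => x) () c x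
        simp only [Function.update_eq_const_of_subsingleton] at this
        exact this }
  equivariant n σ x := by
    change PsiX.cls _ _ _ = PsiX.relabel σ (PsiX.cls _ _ _)
    rw [PsiX.relabel_cls]
    have H : DIso W ((CTree.corolla n).relegs σ) (fun _ => x) (CTree.corolla n)
        (fun _ => W.act n σ x) :=
      ⟨.refl _, fun _ => σ, fun a b => by
        have := CTree.corolla_map σ a b
        rcases a with a | a <;> rcases b with b | b <;> exact this, fun _ => rfl⟩
    exact (PsiX.cls_iso _ _ _ _ _ _ H).symm

end Psi

section Psi
variable {k : Type u} [CommRing k] {ext : Prop} {W W' : CycMod.{u, v} k} {n n' : ℕ}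

theorem ok_sigma {V : Type} {U : V → Type} (h : ext ∨ Nonempty V)
    (h' : ∀ v, ext ∨ Nonempty (U v)) : ext ∨ Nonempty (Σ v, U v) := by
  rcases h with h | ⟨⟨v⟩⟩
  · exact Or.inl h
  · exact (h' v).imp_right fun ⟨u⟩ => ⟨⟨v, u⟩⟩

namespace PsiX

section subst
variable {V : Type} [Fintype V] {r : V → ℕ}

/-- Substitution of decorated trees. -/
noncomputable def substTrees (h : ext ∨ Nonempty V) (T : CTree V r n)
    (D : ∀ v, DTree ext W (r v)) : PsiX ext W n :=
  cls (ok_sigma h fun v => (D v).ok) (T.subst fun v => (D v).tree) (fun p => (D p.1).dec p.2)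

theorem substTrees_iso (h : ext ∨ Nonempty V) (T : CTree V r n)
    (D D' : ∀ v, DTree ext W (r v))
    (H : ∀ v, DIso W (D v).tree (D v).dec (D' v).tree (D' v).dec) :
    substTrees h T D = substTrees h T D' := by
  choose ε ψ h1 h2 using H
  exact cls_iso _ _ _ _ _ _ ⟨(Equiv.sigmaCongrRight ε).trans
    ((Equiv.refl V).sigmaCongrLeft (β := fun v => Fin (D v).m)), fun p => ψ p.1 p.2,
    CTree.subst_map T T (fun v => (D v).tree) (fun v => (D' v).tree) (.refl V) (fun _ => .refl _) (.refl _)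
      (fun x y => by rcases x with x | x <;> rcases y with y | y <;> rfl) ε ψ h1,
    fun p => h2 p.1 p.2⟩

theorem substTrees_withDec [DecidableEq V] (h : ext ∨ Nonempty V) (T : CTree V r n)
    (D : ∀ v, DTree ext W (r v)) (i : V) (v : Fin (D i).m) (x : W.X ((D i).r v)) :
    substTrees h T (Function.update D i ((D i).withDec v x)) =
      cls (ok_sigma h fun v => (D v).ok) (T.subst fun v => (D v).tree)
        (Function.update (fun p : Σ v, Fin (D v).m => (D p.1).dec p.2) ⟨i, v⟩ x) := by
  have : Function.update D i ((D i).withDec v x) = fun j =>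
      ⟨(D j).m, (D j).r, (D j).tree, (D j).ok, fun u =>
        Function.update (fun p : Σ v, Fin (D v).m => (D p.1).dec p.2) ⟨i, v⟩ x ⟨j, u⟩⟩ := by
    funext j
    by_cases hj : j = i
    · subst hj
      rw [Function.update_self, DTree.withDec]
      congr 1
      funext u
      by_cases hu : u = v
      · subst hu; rw [Function.update_self, Function.update_self]
      · rw [Function.update_of_ne hu, Function.update_of_ne (by simpa using hu)]
    · rw [Function.update_of_ne hj]
      have : (fun u => Function.update (fun p : Σ v, Fin (D v).m => (D p.1).dec p.2) ⟨i, v⟩ x ⟨j, u⟩)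
          = (D j).dec := by
        funext u
        rw [Function.update_of_ne]
        intro h
        exact hj (congrArg Sigma.fst h)
      rw [this]
  rw [this]
  rfl

theorem exists_substMulti (h : ext ∨ Nonempty V) (T : CTree V r n) :
    ∃ G : MultilinearMap k (fun v => PsiX ext W (r v)) (PsiX ext W n),
      ∀ D : ∀ v, DTree ext W (r v), G (fun v => mk (D v)) = substTrees h T D := by
  refine exists_multilinear_presented (fun v => {z | Rel ext W (r v) z}) (substTrees h T) ?_
  intro _ i d z hz
  refine lift_aux (fun x => substTrees h T (Function.update d i x)) ?_ ?_ ?_ z hz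
  · intro D D' H
    apply substTrees_iso
    intro v
    by_cases hv : v = i
    · subst hv
      let P : DTree ext W (r v) → DTree ext W (r v) → Prop :=
        fun D D' => DIso W D.tree D.dec D'.tree D'.dec
      change P _ _
      rw [Function.update_self, Function.update_self]
      exact H
    · rw [Function.update_of_ne hv, Function.update_of_ne hv]
      exact ⟨.refl _, fun _ => .refl _, fun x y => by
        rcases x with x | x <;> rcases y with y | y <;> rfl, fun _ => (W.tr_refl _).symm⟩
  · intro D v x y
    obtain ⟨d', hd, rfl⟩ : ∃ d' : ∀ v, DTree ext W (r v),
        (∀ z, Function.update d i z = Function.update d' i z) ∧ d' i = D :=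
      ⟨Function.update d i D, fun z => by simp, by simp⟩
    simp only [hd, substTrees_withDec]
    exact cls_add _ _ _ _ _ _
  · intro D v c x
    obtain ⟨d', hd, rfl⟩ : ∃ d' : ∀ v, DTree ext W (r v),
        (∀ z, Function.update d i z = Function.update d' i z) ∧ d' i = D :=
      ⟨Function.update d i D, fun z => by simp, by simp⟩
    simp only [hd, substTrees_withDec]
    exact cls_smul _ _ _ _ _ _

/-- Substitution of linear combinations of decorated trees into the vertices of a tree. -/
noncomputable def substMulti (h : ext ∨ Nonempty V) (T : CTree V r n) :
    MultilinearMap k (fun v => PsiX ext W (r v)) (PsiX ext W n) :=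
  (exists_substMulti h T).choose

theorem substMulti_mk (h : ext ∨ Nonempty V) (T : CTree V r n) (D : ∀ v, DTree ext W (r v)) :
    substMulti h T (fun v => mk (D v)) = substTrees h T D :=
  (exists_substMulti h T).choose_spec D

theorem substMulti_cls (h : ext ∨ Nonempty V) (T : CTree V r n) {U : V → Type} [∀ v, Fintype (U v)]
    {s : ∀ v, U v → ℕ} (h' : ∀ v, ext ∨ Nonempty (U v)) (S : ∀ v, CTree (U v) (s v) (r v))
    (w : ∀ v u, W.X (s v u)) :
    substMulti h T (fun v => cls (h' v) (S v) (w v)) =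
      cls (ok_sigma h h') (T.subst S) (fun p => w p.1 p.2) := by
  refine (substMulti_mk h T fun v => reindex (h' v) (S v) (w v)).trans ?_
  have H : DIso W (T.subst S) (fun p => w p.1 p.2)
      (T.subst fun v => (reindex (ext := ext) (h' v) (S v) (w v)).tree)
      (fun p => (reindex (ext := ext) (h' p.1) (S p.1) (w p.1)).dec p.2) :=
    ⟨(Equiv.sigmaCongrRight fun v => (Fintype.equivFin (U v)).symm).trans
      ((Equiv.refl V).sigmaCongrLeft (β := U)), fun p => .refl _,
      CTree.subst_map T T S (fun v => (reindex (ext := ext) (h' v) (S v) (w v)).tree) (.refl V)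
        (fun _ => .refl _) (.refl _)
        (fun x y => by rcases x with x | x <;> rcases y with y | y <;> rfl)
        (fun v => (Fintype.equivFin (U v)).symm) (fun _ _ => .refl _) (fun v x y => Iff.rfl),
      fun p => (W.tr_refl _).symm⟩
  exact (cls_iso _ _ _ _ _ _ H).symm

theorem multi_ext_cls {N : Type*} [AddCommGroup N] [Module k N]
    (F G : MultilinearMap k (fun v => PsiX ext W (r v)) N)
    (h : ∀ D : ∀ v, DTree ext W (r v),
      F (fun v => cls (D v).ok (D v).tree (D v).dec) =
        G (fun v => cls (D v).ok (D v).tree (D v).dec)) (x : ∀ v, PsiX ext W (r v)) :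
    F x = G x := by
  refine multi_ext (fun v => Set.range (mk : DTree ext W (r v) → _)) (fun v => span_mk) F G ?_ x
  intro x hx
  choose D hD using hx
  obtain rfl : (fun v => cls (D v).ok (D v).tree (D v).dec) = x := by
    funext v; rw [← hD, mk_eq_cls]
  exact h D

end subst

theorem substMulti_iso {V V' : Type} [Fintype V] [Fintype V'] {r : V → ℕ} {r' : V' → ℕ}
    (h : ext ∨ Nonempty V) (h' : ext ∨ Nonempty V') (T : CTree V r n) (T' : CTree V' r' n)
    (x : ∀ v, PsiX ext W (r v)) (x' : ∀ v, PsiX ext W (r' v)) (H : DIso (Psi ext W) T x T' x') :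
    substMulti h T x = substMulti h' T' x' := by
  obtain ⟨e, φ, h1, h2⟩ := H
  obtain rfl : x' = fun v => relabel (φ v) (x (e v)) :=
    funext fun v => (h2 v).trans (Psi_tr (φ v) (x (e v)))
  classical
  have hupd : ∀ (m : ∀ v, PsiX ext W (r v)) (v : V') (z : PsiX ext W (r (e v))),
      (fun u => relabel (φ u) (Function.update m (e v) z (e u))) =
        Function.update (fun u => relabel (φ u) (m (e u))) v (relabel (φ v) z) := by
    intro m v z
    funext u
    by_cases hu : u = v
    · subst hu; rw [Function.update_self, Function.update_self]
    · rw [Function.update_of_ne hu, Function.update_of_ne (e.injective.ne hu)]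
  let G : MultilinearMap k (fun v => PsiX ext W (r v)) (PsiX ext W n) :=
    MultilinearMap.mk' (fun x => substMulti h' T' (fun v => relabel (φ v) (x (e v))))
      (by
        intro m i a b
        obtain ⟨i, rfl⟩ := e.surjective i
        rw [hupd, hupd, hupd, map_add, MultilinearMap.map_update_add])
      (by
        intro m i c a
        obtain ⟨i, rfl⟩ := e.surjective i
        rw [hupd, hupd, map_smul, MultilinearMap.map_update_smul])
  refine multi_ext_cls (substMulti h T) G (fun D => ?_) x
  change _ = substMulti h' T' _
  simp only [relabel_cls]
  rw [substMulti_cls, substMulti_cls]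
  exact cls_iso _ _ _ _ _ _ ⟨(Equiv.sigmaCongrRight fun v => .refl _).trans
    (e.sigmaCongrLeft (β := fun v => Fin (D v).m)), fun p => .refl _,
    CTree.subst_map T T' (fun v => (D v).tree) (fun v => (D (e v)).tree.relegs (φ v)) e φ (.refl _) h1
      (fun v => .refl _) (fun _ _ => .refl _)
      (fun v x y => Iff.rfl), fun p => (W.tr_refl _).symm⟩

/-- Forgetting the braces: a tree decorated by decorated trees becomes a decorated tree. -/
noncomputable def mu (n : ℕ) : PsiX ext (Psi ext W) n →ₗ[k] PsiX ext W n :=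
  lift (fun D => substMulti D.ok D.tree D.dec)
    (fun D D' H => substMulti_iso _ _ _ _ _ _ H)
    (fun D v x y => (substMulti D.ok D.tree).map_update_add D.dec v x y)
    (fun D v c x => (substMulti D.ok D.tree).map_update_smul D.dec v c x)

theorem mu_cls {V : Type} [Fintype V] {r : V → ℕ} (h : ext ∨ Nonempty V) (T : CTree V r n)
    (x : ∀ v, PsiX ext W (r v)) :
    mu n (cls (W := Psi ext W) h T x) = substMulti h T x := by
  refine (lift_mk _ _ _ _ _).trans ?_
  refine (substMulti_iso h _ T _ x _ ?_).symm
  exact ⟨(Fintype.equivFin _).symm, fun _ => .refl _, fun _ _ => Iff.rfl,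
    fun _ => ((Psi ext W).tr_refl _).symm⟩

theorem relabel_substMulti {V : Type} [Fintype V] {r : V → ℕ} (h : ext ∨ Nonempty V)
    (T : CTree V r n) (l : Fin (n' + 1) ≃ Fin (n + 1)) (x : ∀ v, PsiX ext W (r v)) :
    relabel l (substMulti h T x) = substMulti h (T.relegs l) x := by
  refine multi_ext_cls ((relabel l).compMultilinearMap (substMulti h T)) (substMulti h (T.relegs l))
    (fun D => ?_) x
  rw [LinearMap.compMultilinearMap_apply, substMulti_cls, substMulti_cls, relabel_cls]
  have H : DIso W ((T.subst fun v => (D v).tree).relegs l) (fun p => (D p.1).dec p.2)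
      ((T.relegs l).subst fun v => (D v).tree) (fun p => (D p.1).dec p.2) := by
    refine ⟨.refl _, fun _ => .refl _, fun x y => ?_, fun p => (W.tr_refl _).symm⟩
    have := CTree.subst_map T (T.relegs l) (fun v => (D v).tree) (fun v => (D v).tree) (.refl V)
      (fun _ => .refl _) l (fun x y => Iff.rfl) (fun v => .refl _) (fun _ _ => .refl _)
      (fun v x y => by rcases x with x | x <;> rcases y with y | y <;> rfl) x y
    refine this.trans (iff_of_eq (congrArg₂ _ ?_ ?_))
    · rcases x with x | x <;> rfl
    · rcases y with x | x <;> rfl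
  exact cls_iso _ _ _ _ _ _ H

theorem map_substMulti {V : Type} [Fintype V] {r : V → ℕ} (h : ext ∨ Nonempty V)
    (T : CTree V r n) (f : W ⟶ W') (x : ∀ v, PsiX ext W (r v)) :
    map f n (substMulti h T x) = substMulti h T (fun v => map f (r v) (x v)) := by
  refine multi_ext_cls ((map f n).compMultilinearMap (substMulti h T))
    ((substMulti h T).compLinearMap fun v => map f (r v)) (fun D => ?_) x
  rw [LinearMap.compMultilinearMap_apply, MultilinearMap.compLinearMap_apply]
  simp only [map_cls]
  rw [substMulti_cls, substMulti_cls, map_cls]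

end PsiX

/-- The multiplication of the triple. -/
noncomputable def muHom (ext : Prop) (W : CycMod.{u, v} k) : Psi ext (Psi ext W) ⟶ Psi ext W where
  app n := PsiX.mu n
  equivariant n σ x := by
    change PsiX.mu n (PsiX.relabel σ x) = PsiX.relabel σ (PsiX.mu n x)
    refine PsiX.lin_ext_cls (f := PsiX.mu n ∘ₗ PsiX.relabel σ)
      (g := PsiX.relabel σ ∘ₗ PsiX.mu n) (fun D => ?_) x
    rw [LinearMap.comp_apply, LinearMap.comp_apply, PsiX.relabel_cls]
    exact (PsiX.mu_cls _ _ _).trans ((congrArg _ (PsiX.mu_cls _ _ _)).trans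
      (PsiX.relabel_substMulti _ _ _ _)).symm

theorem mu_eta (D : DTree ext W n) :
    PsiX.mu n ((etaHom ext (Psi ext W)).app n (PsiX.cls D.ok D.tree D.dec)) =
      PsiX.cls D.ok D.tree D.dec := by
  refine (PsiX.mu_cls (Or.inr ⟨()⟩) (CTree.corolla n)
    (fun _ => PsiX.cls D.ok D.tree D.dec)).trans ?_
  refine (PsiX.substMulti_cls _ _ (fun _ => D.ok) (fun _ => D.tree) (fun _ => D.dec)).trans ?_
  have H : DIso W ((CTree.corolla n).subst fun _ => D.tree) (fun p => D.dec p.2) D.tree D.dec :=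
    ⟨(Equiv.uniqueSigma (fun _ : Unit => Fin D.m)).symm, fun _ => .refl _,
      CTree.corolla_subst D.tree, fun _ => (W.tr_refl _).symm⟩
  exact PsiX.cls_iso _ _ _ _ _ _ H

theorem mu_map_eta (D : DTree ext W n) :
    PsiX.mu n (PsiX.map (etaHom ext W) n (PsiX.cls D.ok D.tree D.dec)) =
      PsiX.cls D.ok D.tree D.dec := by
  rw [PsiX.map_cls]
  refine (PsiX.mu_cls _ _ _).trans ?_
  refine (PsiX.substMulti_cls _ _ (fun _ => Or.inr ⟨()⟩) (fun v => CTree.corolla (D.r v))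
    (fun v _ => D.dec v)).trans ?_
  have H : DIso W (D.tree.subst fun v => CTree.corolla (D.r v)) (fun p => D.dec p.1)
      D.tree D.dec :=
    ⟨(Equiv.sigmaPUnit (Fin D.m)).symm, fun _ => .refl _,
      CTree.subst_corolla D.tree, fun _ => (W.tr_refl _).symm⟩
  exact PsiX.cls_iso _ _ _ _ _ _ H

theorem mu_naturality (f : W ⟶ W') (D : DTree ext (Psi ext W) n) :
    PsiX.mu n (PsiX.map (Psi.map ext f) n (PsiX.cls D.ok D.tree D.dec)) =
      PsiX.map f n (PsiX.mu n (PsiX.cls D.ok D.tree D.dec)) := by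
  rw [PsiX.map_cls]
  exact (PsiX.mu_cls _ _ _).trans ((congrArg _ (PsiX.mu_cls _ _ _)).trans
    (PsiX.map_substMulti _ _ _ _)).symm

theorem substMulti_substMulti {V : Type} [Fintype V] {r : V → ℕ} {U : V → Type}
    [∀ v, Fintype (U v)] {s : ∀ v, U v → ℕ} (h : ext ∨ Nonempty V) (h' : ∀ v, ext ∨ Nonempty (U v))
    (T : CTree V r n) (S : ∀ v, CTree (U v) (s v) (r v)) (x : ∀ v u, PsiX ext W (s v u)) :
    PsiX.substMulti h T (fun v => PsiX.substMulti (h' v) (S v) (x v)) =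
      PsiX.substMulti (ok_sigma h h') (T.subst S) (fun p => x p.1 p.2) := by
  refine PsiX.multi_ext_cls
    ((PsiX.substMulti h T).compMultilinearMap fun v => PsiX.substMulti (h' v) (S v))
    (PsiX.substMulti (ok_sigma h h') (T.subst S)) (fun D => ?_) (fun p : Σ v, U v => x p.1 p.2)
  change PsiX.substMulti h T (fun v => PsiX.substMulti (h' v) (S v) fun u =>
    PsiX.cls (D ⟨v, u⟩).ok (D ⟨v, u⟩).tree (D ⟨v, u⟩).dec) = _
  simp only [PsiX.substMulti_cls]
  have H : DIso W (T.subst fun v => (S v).subst fun u => (D ⟨v, u⟩).tree)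
      (fun p => (D ⟨p.1, p.2.1⟩).dec p.2.2)
      ((T.subst S).subst fun p => (D p).tree) (fun p => (D p.1).dec p.2) :=
    ⟨Equiv.sigmaAssoc (fun v u => Fin (D ⟨v, u⟩).m), fun _ => .refl _,
      CTree.subst_subst T S (fun v u => (D ⟨v, u⟩).tree), fun _ => (W.tr_refl _).symm⟩
  exact PsiX.cls_iso _ _ _ _ _ _ H

theorem mu_mu (D : DTree ext (Psi ext (Psi ext W)) n) :
    PsiX.mu n (PsiX.map (muHom ext W) n (PsiX.cls D.ok D.tree D.dec)) =
      PsiX.mu n (PsiX.mu n (PsiX.cls D.ok D.tree D.dec)) := by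
  rw [PsiX.map_cls]
  refine (PsiX.mu_cls _ _ _).trans (Eq.trans ?_ (congrArg _ (PsiX.mu_cls _ _ _)).symm)
  refine PsiX.multi_ext_cls ((PsiX.substMulti D.ok D.tree).compLinearMap fun v => PsiX.mu (D.r v))
    ((PsiX.mu n).compMultilinearMap (PsiX.substMulti D.ok D.tree)) (fun E => ?_) D.dec
  rw [LinearMap.compMultilinearMap_apply, MultilinearMap.compLinearMap_apply]
  rw [PsiX.substMulti_cls]
  have h1 : (fun v => PsiX.mu (D.r v) (PsiX.cls (E v).ok (E v).tree (E v).dec)) =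
      fun v => PsiX.substMulti (E v).ok (E v).tree (E v).dec := funext fun v => PsiX.mu_cls _ _ _
  exact (congrArg (PsiX.substMulti D.ok D.tree) h1).trans
    ((substMulti_substMulti _ (fun v => (E v).ok) _ (fun v => (E v).tree)
      fun v u => (E v).dec u).trans (PsiX.mu_cls _ _ _).symm)

/-- The triple with the functor `Ψ_+` (or `Γ_+`): the unit is given by the corollas and the
multiplication forgets the braces. -/
noncomputable def treeMonad (ext : Prop) (k : Type u) [CommRing k] :
    Monad (CycMod.{u, v} k) where
  toFunctor := PsiFunctor ext k
  η :=
    { app := fun W => etaHom ext W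
      naturality := fun _ _ f => CycMod.hom_ext fun _ _ => (PsiX.map_cls f _ _ _).symm }
  μ :=
    { app := fun W => muHom ext W
      naturality := fun _ _ f => Psi_hom_ext fun _ D => mu_naturality f D }
  left_unit _ := Psi_hom_ext fun _ D => mu_eta D
  right_unit _ := Psi_hom_ext fun _ D => mu_map_eta D
  assoc _ := Psi_hom_ext fun _ D => mu_mu D

end Psi

/-! ### Operads in terms of the compositions `∘_i` -/

/-- The group `Σ_n`, identified with the permutations of `{0, …, n}` that fix `0`. -/
def Sig (n : ℕ) : Subgroup (Equiv.Perm (Fin (n + 1))) where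
  carrier := {σ | σ 0 = 0}
  one_mem' := rfl
  mul_mem' {σ τ} (hσ : σ 0 = 0) (hτ : τ 0 = 0) := by
    change σ (τ 0) = 0
    rw [hτ, hσ]
  inv_mem' {σ} (hσ : σ 0 = 0) := by
    change σ⁻¹ 0 = 0
    rw [Equiv.Perm.inv_eq_iff_eq, hσ]

theorem Sig.pos {n : ℕ} (σ : Sig n) {i : ℕ} (h : 1 ≤ i ∧ i ≤ n) :
    1 ≤ (σ.1 ⟨i, by omega⟩ : ℕ) ∧ (σ.1 ⟨i, by omega⟩ : ℕ) ≤ n := by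
  refine ⟨?_, by omega⟩
  have h1 : σ.1 ⟨i, by omega⟩ ≠ 0 := by
    have h0 : σ.1 0 = 0 := σ.2
    intro h2
    rw [← h0] at h2
    have := congrArg Fin.val (σ.1.injective h2)
    simp at this
    omega
  rw [Nat.one_le_iff_ne_zero]
  exact fun h => h1 (Fin.ext h)

/-- The labels `0, …, m + n - 1` of the slots of `p ∘_i q`, where `p` has the slots `0, …, m` and
`q` has the slots `0, …, n`: these are the slots of `p` other than `i` and the slots of `q` other
than `0`, where the slots `1, …, n` of `q` take the place of the slot `i` of `p`. -/
def slots {m n l i : ℕ} (h : 1 ≤ i ∧ i ≤ m) (hl : l + 1 = m + n) :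
    Fin (l + 1) ≃ {j : Fin (m + 1) // (j : ℕ) ≠ i} ⊕ {j : Fin (n + 1) // (j : ℕ) ≠ 0} where
  toFun x :=
    if h1 : (x : ℕ) < i then .inl ⟨⟨x, by omega⟩, by simp; omega⟩
    else if h2 : (x : ℕ) < i + n then .inr ⟨⟨x + 1 - i, by omega⟩, by simp; omega⟩
    else .inl ⟨⟨x + 1 - n, by omega⟩, by simp; omega⟩
  invFun := Sum.elim
    (fun j => if h1 : (j.1 : ℕ) < i then ⟨j.1, by omega⟩ else ⟨j.1 + n - 1, by omega⟩)
    (fun j => ⟨i + j.1 - 1, by omega⟩)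
  left_inv x := by
    obtain ⟨x, hx⟩ := x
    dsimp only
    split_ifs with h1 h2
    · simp [h1]
    · simp only [Sum.elim_inr, Fin.mk.injEq]; omega
    · simp only [Sum.elim_inl]
      split_ifs <;> simp only [Fin.mk.injEq] <;> omega
  right_inv x := by
    rcases x with ⟨⟨j, hj⟩, hj'⟩ | ⟨⟨j, hj⟩, hj'⟩
    · simp only [ne_eq] at hj'
      dsimp only [Sum.elim_inl]
      by_cases h1 : j < i
      · simp [h1]
      · have h2 : ¬ j + n - 1 < i := by omega
        have h3 : ¬ j + n - 1 < i + n := by omega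
        simp only [h1, h2, h3, dite_false, Sum.inl.injEq, Subtype.mk.injEq, Fin.mk.injEq]
        omega
    · simp only [ne_eq] at hj'
      dsimp only [Sum.elim_inr]
      have h2 : ¬ i + j - 1 < i := by omega
      have h3 : i + j - 1 < i + n := by omega
      simp only [h2, h3, dite_false, dite_true, Sum.inr.injEq, Subtype.mk.injEq, Fin.mk.injEq]
      omega

theorem slots_zero {m n l i : ℕ} (h : 1 ≤ i ∧ i ≤ m) (hl : l + 1 = m + n) :
    slots h hl 0 = .inl ⟨0, by simp; omega⟩ := by
  have h1 : ((0 : Fin (l + 1)) : ℕ) < i := by simp; omega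
  simp only [slots, Equiv.coe_fn_mk, h1, dite_true]
  rfl

/-- The permutation `τ ∘_i σ`, which inserts `σ` at the `i`th place in `τ`. -/
def insertPerm {m n l i : ℕ} (h : 1 ≤ i ∧ i ≤ m) (hl : l + 1 = m + n) (τ : Sig m) (σ : Sig n) :
    Sig l :=
  ⟨((slots h hl).trans (Equiv.sumCongr
      (τ.1.subtypeEquiv fun j => by
        rw [not_iff_not, ← Fin.ext_iff (b := ⟨i, by omega⟩), ← Fin.ext_iff, τ.1.apply_eq_iff_eq])
      (σ.1.subtypeEquiv fun j => by
        have h0 : σ.1 0 = 0 := σ.2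
        rw [not_iff_not]
        conv_rhs => rw [← Fin.val_zero (n + 1), ← Fin.ext_iff, ← h0, σ.1.apply_eq_iff_eq]
        rw [Fin.ext_iff, Fin.val_zero]))).trans (slots (Sig.pos τ h) hl).symm, by
    have h0 : τ.1 0 = 0 := τ.2
    change (slots (Sig.pos τ h) hl).symm (Equiv.sumCongr _ _ (slots h hl 0)) = 0
    rw [slots_zero, Equiv.symm_apply_eq, slots_zero]
    simp [h0]⟩

section Biased
variable {k : Type u} [CommRing k]

/-- Σ-modules, that is, sequences of right `k[Σ_n]`-modules. -/
structure SigmaMod (k : Type u) [CommRing k] where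
  X : ℕ → Type (max u v)
  [grp : ∀ n, AddCommGroup (X n)]
  [mod : ∀ n, Module k (X n)]
  act : ∀ n, Sig n → X n →ₗ[k] X n
  act_one : ∀ n x, act n 1 x = x
  act_mul : ∀ n σ τ x, act n (σ * τ) x = act n τ (act n σ x)

attribute [instance] SigmaMod.grp SigmaMod.mod

/-- The restriction of the actions from `Σ⁺_n` to `Σ_n`. -/
def CycMod.res (W : CycMod.{u, v} k) : SigmaMod.{u, v} k where
  X := W.X
  act n σ := W.act n σ.1
  act_one n x := W.act_one n x
  act_mul n σ τ x := W.act_mul n σ.1 τ.1 x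

/-- Families of compositions `∘_i : X(m) ⊗ X(n) → X(m + n - 1)`, `1 ≤ i ≤ m`, `0 ≤ n`.
Here `l` stands for `m + n - 1`. -/
abbrev Comp (k : Type u) [CommRing k] (X : ℕ → Type (max u v)) [∀ n, AddCommGroup (X n)]
    [∀ n, Module k (X n)] : Type (max u v) :=
  ∀ m n l i : ℕ, 1 ≤ i ∧ i ≤ m → l + 1 = m + n → X m →ₗ[k] X n →ₗ[k] X l

/-- Non-unital operads in the partial-composition form. -/
structure IsNonunitalOperad (S : SigmaMod.{u, v} k) (comp : Comp.{u, v} k S.X) : Prop where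
  /-- `(f ∘_j g) ∘_i h = (f ∘_i h) ∘_{j+c-1} g` for `1 ≤ i < j` -/
  assoc_before : ∀ (a b c i j j' s s' t : ℕ) (hj : 1 ≤ j ∧ j ≤ a) (hs : s + 1 = a + b)
    (hi : 1 ≤ i ∧ i ≤ s) (ht : t + 1 = s + c) (hi' : 1 ≤ i ∧ i ≤ a) (hs' : s' + 1 = a + c)
    (hj' : 1 ≤ j' ∧ j' ≤ s') (ht' : t + 1 = s' + b), i < j → j' + 1 = j + c →
    ∀ (f : S.X a) (g : S.X b) (h : S.X c),
      comp s c t i hi ht (comp a b s j hj hs f g) h =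
        comp s' b t j' hj' ht' (comp a c s' i hi' hs' f h) g
  /-- `(f ∘_j g) ∘_i h = f ∘_j (g ∘_{i-j+1} h)` for `j ≤ i < b + j` -/
  assoc_inside : ∀ (a b c i j i' s s' t : ℕ) (hj : 1 ≤ j ∧ j ≤ a) (hs : s + 1 = a + b)
    (hi : 1 ≤ i ∧ i ≤ s) (ht : t + 1 = s + c) (hi' : 1 ≤ i' ∧ i' ≤ b) (hs' : s' + 1 = b + c)
    (ht' : t + 1 = a + s'), j ≤ i → i < b + j → i' + j = i + 1 →
    ∀ (f : S.X a) (g : S.X b) (h : S.X c),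
      comp s c t i hi ht (comp a b s j hj hs f g) h =
        comp a s' t j hj ht' f (comp b c s' i' hi' hs' g h)
  /-- `(f ∘_j g) ∘_i h = (f ∘_{i-b+1} h) ∘_j g` for `j + b ≤ i ≤ a + b - 1` -/
  assoc_after : ∀ (a b c i j i' s s' t : ℕ) (hj : 1 ≤ j ∧ j ≤ a) (hs : s + 1 = a + b)
    (hi : 1 ≤ i ∧ i ≤ s) (ht : t + 1 = s + c) (hi' : 1 ≤ i' ∧ i' ≤ a) (hs' : s' + 1 = a + c)
    (hj' : 1 ≤ j ∧ j ≤ s') (ht' : t + 1 = s' + b), j + b ≤ i → i' + b = i + 1 →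
    ∀ (f : S.X a) (g : S.X b) (h : S.X c),
      comp s c t i hi ht (comp a b s j hj hs f g) h =
        comp s' b t j hj' ht' (comp a c s' i' hi' hs' f h) g
  /-- `(f τ) ∘_i (g σ) = (f ∘_{τ(i)} g) (τ ∘_i σ)` -/
  equivariance : ∀ (m n l i : ℕ) (hi : 1 ≤ i ∧ i ≤ m) (hl : l + 1 = m + n) (τ : Sig m) (σ : Sig n)
    (f : S.X m) (g : S.X n),
      comp m n l i hi hl (S.act m τ f) (S.act n σ g) =
        S.act l (insertPerm hi hl τ σ)
          (comp m n l (τ.1 ⟨i, by omega⟩ : ℕ) (Sig.pos τ hi) hl f g)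

/-- `e` is an operadic unit: `f ∘_i e = f` and `e ∘_1 g = g`. -/
structure IsOperadicUnit (S : SigmaMod.{u, v} k) (comp : Comp.{u, v} k S.X) (e : S.X 1) :
    Prop where
  comp_unit : ∀ (m i : ℕ) (hi : 1 ≤ i ∧ i ≤ m) (f : S.X m), comp m 1 m i hi rfl f e = f
  unit_comp : ∀ (n : ℕ) (g : S.X n),
    comp 1 n n 1 ⟨le_rfl, le_rfl⟩ (Nat.add_comm n 1) e g = g

/-- Non-unital operads whose `Σ_n`-actions are extended to `Σ⁺_n`-actions, where the cycle
`τ_n = (0, 1, …, n)` satisfies the cyclicity conditions. -/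
structure IsNonunitalCyclic (W : CycMod.{u, v} k) (comp : Comp.{u, v} k W.X) : Prop where
  operad : IsNonunitalOperad W.res comp
  /-- `(p ∘_1 q) τ_{m+n-1} = (q τ_n) ∘_n (p τ_m)`, where `n ≥ 1` -/
  rotate_one : ∀ (m n l : ℕ) (hm : 1 ≤ 1 ∧ 1 ≤ m) (hn : 1 ≤ n ∧ n ≤ n) (hl : l + 1 = m + n)
    (hl' : l + 1 = n + m) (p : W.X m) (q : W.X n),
      W.act l (finRotate (l + 1)) (comp m n l 1 hm hl p q) =
        comp n m l n hn hl' (W.act n (finRotate (n + 1)) q) (W.act m (finRotate (m + 1)) p)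
  /-- `(p ∘_i q) τ_{m+n-1} = (p τ_m) ∘_{i-1} q` for `2 ≤ i ≤ m`, where `i' = i - 1` -/
  rotate_succ : ∀ (m n l i i' : ℕ) (hi : 1 ≤ i ∧ i ≤ m) (hi' : 1 ≤ i' ∧ i' ≤ m)
    (hl : l + 1 = m + n), i' + 1 = i → ∀ (p : W.X m) (q : W.X n),
      W.act l (finRotate (l + 1)) (comp m n l i hi hl p q) =
        comp m n l i' hi' hl (W.act m (finRotate (m + 1)) p) q

/-- Such non-unital operads with a unit: there is an operadic unit that is invariant under `Σ⁺_1`. -/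
structure IsUnitalCyclic (W : CycMod.{u, v} k) (comp : Comp.{u, v} k W.X) : Prop
    extends IsNonunitalCyclic W comp where
  exists_unit : ∃ e : W.X 1, IsOperadicUnit W.res comp e ∧ ∀ σ, W.act 1 σ e = e

end Biased

/-! ### The compositions of an algebra over a tree triple -/

section Graft

/-- The first vertex of the tree below has the flags `0, …, m`, the second one `0, …, n`. -/
abbrev arity (m n : ℕ) (b : Bool) : ℕ := cond b n m

/-- The edges of the tree below: the flag `i` of the first vertex is joined to the flag `0` of the
second one, and the other flags belong to the legs. -/
inductive HalfEdge {m n l i : ℕ} (h : 1 ≤ i ∧ i ≤ m) (hl : l + 1 = m + n) :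
    Ends Bool (arity m n) l → Ends Bool (arity m n) l → Prop
  | join : HalfEdge h hl (.inl ⟨false, (⟨i, by omega⟩ : Fin (m + 1))⟩)
      (.inl ⟨true, (0 : Fin (n + 1))⟩)
  | left (x : Fin (l + 1)) (j : {j : Fin (m + 1) // (j : ℕ) ≠ i}) (hx : slots h hl x = .inl j) :
      HalfEdge h hl (.inr x) (.inl ⟨false, j.1⟩)
  | right (x : Fin (l + 1)) (j : {j : Fin (n + 1) // (j : ℕ) ≠ 0}) (hx : slots h hl x = .inr j) :
      HalfEdge h hl (.inr x) (.inl ⟨true, j.1⟩)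

/-- The tree with two vertices that describes the composition `∘_i`. -/
def graft {m n l i : ℕ} (h : 1 ≤ i ∧ i ≤ m) (hl : l + 1 = m + n) :
    CTree Bool (arity m n) l where
  edge x y := HalfEdge h hl x y ∨ HalfEdge h hl y x
  symm _ _ := Or.symm
  irrefl x := by rintro (h | h) <;> cases h
  existsUnique x := by
    rcases x with ⟨_ | _, j⟩ | x
    · by_cases hj : (j : ℕ) = i
      · obtain rfl : j = (⟨i, Nat.lt_succ_of_le h.2⟩ : Fin (m + 1)) := Fin.ext hj
        refine ⟨.inl ⟨true, (0 : Fin (n + 1))⟩, Or.inl .join, ?_⟩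
        rintro y (h' | h')
        · cases h'; rfl
        · generalize hz : (Sum.inl ⟨false, (⟨i, by omega⟩ : Fin (m + 1))⟩ :
            Ends Bool (arity m n) l) = z at h'
          cases h' with
          | join => simp at hz
          | left x j hx => simp at hz; exact absurd (congrArg Fin.val hz).symm j.2
          | right x j hx => simp at hz
      · refine ⟨.inr ((slots h hl).symm (.inl ⟨j, hj⟩)), Or.inr (.left _ ⟨j, hj⟩ (by simp)), ?_⟩
        rintro y (h' | h')
        · cases h'; exact absurd rfl hj
        · generalize hz : (Sum.inl ⟨false, j⟩ : Ends Bool (arity m n) l) = z at h'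
          cases h' with
          | join => simp at hz
          | left x j' hx =>
            simp at hz
            subst hz
            rw [← hx, Equiv.symm_apply_apply]
          | right x j hx => simp at hz
    · by_cases hj : (j : ℕ) = 0
      · obtain rfl : j = (0 : Fin (n + 1)) := Fin.ext hj
        refine ⟨.inl ⟨false, (⟨i, by omega⟩ : Fin (m + 1))⟩, Or.inr .join, ?_⟩
        rintro y (h' | h')
        · cases h'
        · generalize hz : (Sum.inl ⟨true, (0 : Fin (n + 1))⟩ :
            Ends Bool (arity m n) l) = z at h'
          cases h' with
          | join => rfl
          | left x j hx => simp at hz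
          | right x j hx => simp at hz; exact absurd (congrArg Fin.val hz).symm j.2
      · refine ⟨.inr ((slots h hl).symm (.inr ⟨j, hj⟩)), Or.inr (.right _ ⟨j, hj⟩ (by simp)), ?_⟩
        rintro y (h' | h')
        · cases h'
        · generalize hz : (Sum.inl ⟨true, j⟩ : Ends Bool (arity m n) l) = z at h'
          cases h' with
          | join => simp at hz; exact absurd (congrArg Fin.val hz) hj
          | left x j' hx => simp at hz
          | right x j' hx =>
            simp at hz
            subst hz
            rw [← hx, Equiv.symm_apply_apply]
    · rcases hs : slots h hl x with j | j
      · refine ⟨.inl ⟨false, j.1⟩, Or.inl (.left x j hs), ?_⟩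
        rintro y (h' | h')
        · cases h' with
          | left _ j' hx => rw [hs] at hx; cases hx; rfl
          | right _ j' hx => rw [hs] at hx; cases hx
        · cases h'
      · refine ⟨.inl ⟨true, j.1⟩, Or.inl (.right x j hs), ?_⟩
        rintro y (h' | h')
        · cases h' with
          | left _ j' hx => rw [hs] at hx; cases hx
          | right _ j' hx => rw [hs] at hx; cases hx; rfl
        · cases h'
  connected P hP := by
    have h1 : P (.inl false) ↔ P (.inl true) :=
      ⟨hP _ _ (Or.inl .join), hP _ _ (Or.inr .join)⟩
    have h2 : ∀ a, P a ↔ P (.inl false) := by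
      rintro ((_ | _) | x)
      · exact Iff.rfl
      · exact h1.symm
      · rcases hs : slots h hl x with j | j
        · exact ⟨hP _ _ (Or.inl (.left x j hs)), hP _ _ (Or.inr (.left x j hs))⟩
        · rw [h1]
          exact ⟨hP _ _ (Or.inl (.right x j hs)), hP _ _ (Or.inr (.right x j hs))⟩
    intro a b hab
    exact (h2 b).2 ((h2 a).1 hab)
  card := by
    simp [arity]
    omega

end Graft

section Circ
variable {k : Type u} [CommRing k] {ext : Prop} {W : CycMod.{u, v} k}

/-- The decoration of the two-vertex tree by `p` and `q`. -/
def graftDec {m n : ℕ} (p : W.X m) (q : W.X n) : ∀ b : Bool, W.X (arity m n b)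
  | false => p
  | true => q

theorem graftDec_left {m n : ℕ} (p p' : W.X m) (q : W.X n) :
    graftDec p q = Function.update (graftDec p' q) false (p : W.X (arity m n false)) := by
  funext b
  cases b with
  | false => rw [Function.update_self]; rfl
  | true => rw [Function.update_of_ne (by simp)]; rfl

theorem graftDec_right {m n : ℕ} (p : W.X m) (q q' : W.X n) :
    graftDec p q = Function.update (graftDec p q') true (q : W.X (arity m n true)) := by
  funext b
  cases b with
  | false => rw [Function.update_of_ne (by simp)]; rfl
  | true => rw [Function.update_self]; rfl

/-- The class of the two-vertex tree decorated by `p` and `q`, as a bilinear map. -/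
noncomputable def graftCls (ext : Prop) (W : CycMod.{u, v} k) {m n l i : ℕ} (h : 1 ≤ i ∧ i ≤ m)
    (hl : l + 1 = m + n) : W.X m →ₗ[k] W.X n →ₗ[k] PsiX ext W l :=
  LinearMap.mk₂ k
    (fun p q => PsiX.cls (ext := ext) (Or.inr ⟨true⟩) (graft h hl) (graftDec p q))
    (fun p p' q => by
      rw [graftDec_left (p + p') 0 q, graftDec_left p 0 q, graftDec_left p' 0 q]
      exact PsiX.cls_add _ _ _ _ _ _)
    (fun c p q => by
      rw [graftDec_left (c • p) 0 q, graftDec_left p 0 q]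
      exact PsiX.cls_smul _ _ _ _ _ _)
    (fun p q q' => by
      rw [graftDec_right p (q + q') 0, graftDec_right p q 0, graftDec_right p q' 0]
      exact PsiX.cls_add _ _ _ _ _ _)
    (fun c p q => by
      rw [graftDec_right p (c • q) 0, graftDec_right p q 0]
      exact PsiX.cls_smul _ _ _ _ _ _)

/-- The compositions `p ∘_i q`: the values of `a` on the two-vertex trees. -/
noncomputable def circ (a : (treeMonad ext k).obj W ⟶ W) : Comp.{u, v} k W.X :=
  fun _ _ l _ h hl => (graftCls ext W h hl).compr₂ (a.app l)

/-- The triple `Ψ_+`. -/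
noncomputable abbrev PsiPlus (k : Type u) [CommRing k] : Monad (CycMod.{u, v} k) := treeMonad False k

/-- The triple `Γ_+`. -/
noncomputable abbrev GammaPlus (k : Type u) [CommRing k] : Monad (CycMod.{u, v} k) := treeMonad True k

/-- The morphism `a` is the structure morphism of an algebra over the triple `T`. -/
structure IsAlgebra {C : Type*} [Category C] (T : Monad C) (A : C) (a : T.obj A ⟶ A) : Prop where
  unit : T.η.app A ≫ a = 𝟙 A
  assoc : T.map a ≫ a = T.μ.app A ≫ a

/-- The morphism `f` is a morphism of algebras with the structure morphisms `a` and `a'`. -/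
def IsAlgebraHom {C : Type*} [Category C] (T : Monad C) {A A' : C} (a : T.obj A ⟶ A)
    (a' : T.obj A' ⟶ A') (f : A ⟶ A') : Prop :=
  T.map f ≫ a' = a ≫ f

/-- The morphism `f` of cyclic Σ-modules preserves the compositions. -/
def PreservesComp {W W' : CycMod.{u, v} k} (c : Comp.{u, v} k W.X) (c' : Comp.{u, v} k W'.X)
    (f : W ⟶ W') : Prop :=
  ∀ (m n l i : ℕ) (h : 1 ≤ i ∧ i ≤ m) (hl : l + 1 = m + n) (p : W.X m) (q : W.X n),
    f.app l (c m n l i h hl p q) = c' m n l i h hl (f.app m p) (f.app n q)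

/-- The morphism `f` of cyclic Σ-modules preserves the operadic units. -/
def PreservesUnit {W W' : CycMod.{u, v} k} (c : Comp.{u, v} k W.X) (c' : Comp.{u, v} k W'.X)
    (f : W ⟶ W') : Prop :=
  ∀ (e : W.X 1) (e' : W'.X 1), IsOperadicUnit W.res c e → IsOperadicUnit W'.res c' e' →
    f.app 1 e = e'

end Circ

end CycOp

open CycOp CategoryTheory

/-! An element of `W.X n` is an operation with n + 1 slots, none of them distinguished, and a
composition glues a slot of one operation to a slot of another. The proof compares such gluings with
trees.

From compositions to an algebra: a decorated tree is evaluated by contracting its edges one after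
the other, and the point is that neither the order nor the numberings chosen on the way matter. So
the slots are labeled by flags of the tree (`Lab`) and elements are taken up to renumbering. A
permutation of the slots of p that moves one non-zero slot to another either fixes 0 or is a product
of permutations fixing 0 and one cycle τ, so equivariance and the second cyclicity condition make p
∘_i q compatible with it (`compat`). The first cyclicity condition exchanges p and q
(`Lab.Join.swap`). Hence a composite depends only on the two labels that are glued
(`Lab.SymJoin.unique`), and the operad axioms say that gluing three elements in a chain is
associative (`Lab.SymJoin.assoc`). Every edge separates a tree; so two candidates for the last
contraction of a connected set of vertices are the same edge, or together they cut the set into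
three parts in a chain, and induction on the set shows that values are unique
(`IsFlagTree.val_unique`). Values are multilinear (`Val.update`), invariant under isomorphisms
(`CTree.Evals.iso`) and compatible with substitution (`CTree.Evals.subst`), which gives the axioms
of an algebra. In the unital case the exceptional tree gets the unit as its value.

From an algebra to compositions: by associativity of the structure morphism every iterated
composition is the value on the tree made of the edges used (`IsAlgebra.realized`), and that tree is
determined up to isomorphism by its vertices, the ambient edges and the flags left over
(`IsSubtree.dIso`). So two iterated compositions of the same pieces along the same edges that leave
the same flags in the same slots are equal (`IsAlgebra.val_unique`). The axioms of a non-unital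
cyclic operad are instances with two or three vertices. The unit is the value on the exceptional
tree, because substituting that tree for a vertex erases the vertex (`IsAlgebra.isOperadicUnit`).

Finally, an algebra takes on every tree the value computed from its own compositions and its unit
(`IsAlgebra.app_cls`). This gives injectivity of the correspondence and the description of the
morphisms. -/

namespace CycOp

/-! ### The labels of the slots of a composition -/

section joinLab
variable {F : Type} {m n l i : ℕ}

/-- The labels of the slots of `p ∘_i q`, when the slots of `p` and `q` are labeled. -/
def joinLab (h : 1 ≤ i ∧ i ≤ m) (hl : l + 1 = m + n) (φ : Fin (m + 1) → F) (ψ : Fin (n + 1) → F) :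
    Fin (l + 1) → F :=
  fun t => Sum.elim (fun j => φ j.1) (fun j => ψ j.1) (slots h hl t)

theorem joinLab_lt (h : 1 ≤ i ∧ i ≤ m) (hl : l + 1 = m + n) (φ : Fin (m + 1) → F)
    (ψ : Fin (n + 1) → F) (t : Fin (l + 1)) (ht : (t : ℕ) < i) :
    joinLab h hl φ ψ t = φ ⟨t, by omega⟩ := by
  simp [joinLab, slots, ht]

theorem joinLab_mid (h : 1 ≤ i ∧ i ≤ m) (hl : l + 1 = m + n) (φ : Fin (m + 1) → F)
    (ψ : Fin (n + 1) → F) (t : Fin (l + 1)) (ht : i ≤ (t : ℕ)) (ht' : (t : ℕ) < i + n) :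
    joinLab h hl φ ψ t = ψ ⟨t + 1 - i, by omega⟩ := by
  simp [joinLab, slots, ht', Nat.not_lt.2 ht]

theorem joinLab_ge (h : 1 ≤ i ∧ i ≤ m) (hl : l + 1 = m + n) (φ : Fin (m + 1) → F)
    (ψ : Fin (n + 1) → F) (t : Fin (l + 1)) (ht : i + n ≤ (t : ℕ)) :
    joinLab h hl φ ψ t = φ ⟨t + 1 - n, by omega⟩ := by
  simp [joinLab, slots, Nat.not_lt.2 ht, show ¬ (t : ℕ) < i by omega]

theorem joinLab_comp {G : Type} (g : F → G) (h : 1 ≤ i ∧ i ≤ m) (hl : l + 1 = m + n)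
    (φ : Fin (m + 1) → F) (ψ : Fin (n + 1) → F) :
    g ∘ joinLab h hl φ ψ = joinLab h hl (g ∘ φ) (g ∘ ψ) := by
  funext t
  simp only [joinLab, Function.comp]
  rcases slots h hl t with j | j <;> rfl

theorem mem_range_joinLab (h : 1 ≤ i ∧ i ≤ m) (hl : l + 1 = m + n) (φ : Fin (m + 1) → F)
    (ψ : Fin (n + 1) → F) (f : F) : (∃ t, joinLab h hl φ ψ t = f) ↔
      (∃ j : Fin (m + 1), (j : ℕ) ≠ i ∧ φ j = f) ∨ ∃ j : Fin (n + 1), (j : ℕ) ≠ 0 ∧ ψ j = f := by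
  rw [← (slots h hl).symm.exists_congr_right]
  simp [joinLab]

theorem joinLab_injective (h : 1 ≤ i ∧ i ≤ m) (hl : l + 1 = m + n) {φ : Fin (m + 1) → F}
    {ψ : Fin (n + 1) → F} (hφ : φ.Injective) (hψ : ψ.Injective) (hd : ∀ a b, φ a ≠ ψ b) :
    (joinLab h hl φ ψ).Injective := by
  intro s t hst
  apply (slots h hl).injective
  simp only [joinLab] at hst
  generalize slots h hl s = s at hst
  generalize slots h hl t = t at hst
  rcases s with a | a <;> rcases t with b | b
  · exact congrArg _ (Subtype.ext (hφ hst))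
  · exact absurd hst (hd _ _)
  · exact absurd hst.symm (hd _ _)
  · exact congrArg _ (Subtype.ext (hψ hst))

/-- This closed form reduces identities between labelings to case distinctions that `omega` can
settle. -/
theorem joinLab_apply (h : 1 ≤ i ∧ i ≤ m) (hl : l + 1 = m + n) (φ : Fin (m + 1) → F)
    (ψ : Fin (n + 1) → F) (t : Fin (l + 1)) : joinLab h hl φ ψ t =
      if h1 : (t : ℕ) < i then φ ⟨t, by omega⟩
      else if h2 : (t : ℕ) < i + n then ψ ⟨t + 1 - i, by omega⟩ else φ ⟨t + 1 - n, by omega⟩ := by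
  split_ifs with h1 h2
  · exact joinLab_lt h hl φ ψ t h1
  · exact joinLab_mid h hl φ ψ t (by omega) h2
  · exact joinLab_ge h hl φ ψ t (by omega)

/-! ### Labels of iterated compositions -/

section assoc
variable {a b c j i' j' s s' t : ℕ}

/-- An operad axiom equates elements; to equate labeled elements one also needs that both
bracketings list the remaining slots in the same order. The third associativity axiom needs no
separate version, being this one read from right to left. -/
theorem joinLab_assoc_before (hj : 1 ≤ j ∧ j ≤ a) (hs : s + 1 = a + b) (hi : 1 ≤ i ∧ i ≤ s)
    (ht : t + 1 = s + c) (hi' : 1 ≤ i ∧ i ≤ a) (hs' : s' + 1 = a + c) (hj' : 1 ≤ j' ∧ j' ≤ s')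
    (ht' : t + 1 = s' + b) (h1 : i < j) (h2 : j' + 1 = j + c) (f : Fin (a + 1) → F)
    (g : Fin (b + 1) → F) (h : Fin (c + 1) → F) :
    joinLab hi ht (joinLab hj hs f g) h = joinLab hj' ht' (joinLab hi' hs' f h) g := by
  funext x
  simp only [joinLab_apply]
  split_ifs
  all_goals first
    | (exfalso; omega)
    | exact congrArg _ (Fin.ext (by first | rfl | (simp only; omega)))

theorem joinLab_assoc_inside (hj : 1 ≤ j ∧ j ≤ a) (hs : s + 1 = a + b) (hi : 1 ≤ i ∧ i ≤ s)
    (ht : t + 1 = s + c) (hi' : 1 ≤ i' ∧ i' ≤ b) (hs' : s' + 1 = b + c) (ht' : t + 1 = a + s')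
    (h1 : j ≤ i) (h2 : i < b + j) (h3 : i' + j = i + 1) (f : Fin (a + 1) → F)
    (g : Fin (b + 1) → F) (h : Fin (c + 1) → F) :
    joinLab hi ht (joinLab hj hs f g) h = joinLab hj ht' f (joinLab hi' hs' g h) := by
  funext x
  simp only [joinLab_apply]
  split_ifs
  all_goals first
    | (exfalso; omega)
    | exact congrArg _ (Fin.ext (by first | rfl | (simp only; omega)))

end assoc

end joinLab

/-! ### The equivariance of the compositions under all permutations -/

section compat
variable {k : Type u} [CommRing k] {W : CycMod.{u, v} k} {c : Comp.{u, v} k W.X}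

/-- The permutations `σ` of the slots of `p` and `ρ` of the slots of `q`, where `σ` sends the slot
`i'` to the slot `i`, are compatible with the compositions. -/
def Compat (c : Comp.{u, v} k W.X) {m n l i i' : ℕ} (hi : 1 ≤ i ∧ i ≤ m) (hi' : 1 ≤ i' ∧ i' ≤ m)
    (hl : l + 1 = m + n) (σ : Equiv.Perm (Fin (m + 1))) (ρ : Equiv.Perm (Fin (n + 1))) : Prop :=
  ∃ θ : Equiv.Perm (Fin (l + 1)),
    (∀ x y, c m n l i' hi' hl (W.act m σ x) (W.act n ρ y) = W.act l θ (c m n l i hi hl x y)) ∧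
    ∀ (F : Type) (φ : Fin (m + 1) → F) (ψ : Fin (n + 1) → F),
      joinLab hi' hl (φ ∘ σ) (ψ ∘ ρ) = joinLab hi hl φ ψ ∘ θ

/-- Compatibility is preserved by products, so it is enough to know it for the factors into which a
permutation is decomposed. -/
theorem Compat.trans {m n l i i' i'' : ℕ} {hi : 1 ≤ i ∧ i ≤ m} {hi' : 1 ≤ i' ∧ i' ≤ m}
    {hi'' : 1 ≤ i'' ∧ i'' ≤ m} {hl : l + 1 = m + n} {σ σ' : Equiv.Perm (Fin (m + 1))}
    {ρ ρ' : Equiv.Perm (Fin (n + 1))} (h : Compat c hi hi' hl σ ρ) (h' : Compat c hi' hi'' hl σ' ρ') :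
    Compat c hi hi'' hl (σ * σ') (ρ * ρ') := by
  obtain ⟨θ, h1, h2⟩ := h
  obtain ⟨θ', h1', h2'⟩ := h'
  refine ⟨θ * θ', fun x y => ?_, fun F φ ψ => ?_⟩
  · rw [W.act_mul, W.act_mul, W.act_mul, h1', h1]
  · exact (h2' F (φ ∘ σ) (ψ ∘ ρ)).trans (congrArg (· ∘ θ') (h2 F φ ψ))

theorem joinLab_insertPerm {F : Type} {m n l i : ℕ} (hi : 1 ≤ i ∧ i ≤ m) (hl : l + 1 = m + n)
    (σ : Sig m) (ρ : Sig n) (φ : Fin (m + 1) → F) (ψ : Fin (n + 1) → F) :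
    joinLab hi hl (φ ∘ σ.1) (ψ ∘ ρ.1) = joinLab (Sig.pos σ hi) hl φ ψ ∘ (insertPerm hi hl σ ρ).1 := by
  funext t
  simp only [joinLab, insertPerm, Function.comp, Equiv.trans_apply, Equiv.apply_symm_apply]
  rcases slots hi hl t with j | j <;> rfl

theorem Compat.of_sig (hc : IsNonunitalOperad W.res c) {m n l i i' : ℕ} {hi : 1 ≤ i ∧ i ≤ m}
    {hi' : 1 ≤ i' ∧ i' ≤ m} (hl : l + 1 = m + n) {σ : Equiv.Perm (Fin (m + 1))}
    {ρ : Equiv.Perm (Fin (n + 1))} (hσ : σ 0 = 0) (hρ : ρ 0 = 0)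
    (h : σ ⟨i', Nat.lt_succ_of_le hi'.2⟩ = ⟨i, Nat.lt_succ_of_le hi.2⟩) :
    Compat c hi hi' hl σ ρ := by
  obtain rfl : i = (σ ⟨i', Nat.lt_succ_of_le hi'.2⟩ : Fin (m + 1)) := (congrArg Fin.val h).symm
  exact ⟨(insertPerm hi' hl ⟨σ, hσ⟩ ⟨ρ, hρ⟩).1,
    fun x y => hc.equivariance m n l i' hi' hl ⟨σ, hσ⟩ ⟨ρ, hρ⟩ x y,
    fun F φ ψ => joinLab_insertPerm hi' hl ⟨σ, hσ⟩ ⟨ρ, hρ⟩ φ ψ⟩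

theorem finRotate_val {n : ℕ} (t : Fin (n + 1)) :
    ((finRotate (n + 1) t : Fin (n + 1)) : ℕ) = if (t : ℕ) = n then (0 : ℕ) else (t : ℕ) + 1 := by
  rw [coe_finRotate]
  simp [Fin.ext_iff]

/-- The label side of the second cyclicity condition: after rotation the slot i - 1 of p carries the
label that the slot i had, so the block of q moves one place to the left. -/
theorem joinLab_finRotate_succ {F : Type} {m n l i i' : ℕ} (hi : 1 ≤ i ∧ i ≤ m)
    (hi' : 1 ≤ i' ∧ i' ≤ m) (hl : l + 1 = m + n) (h : i' + 1 = i)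
    (φ : Fin (m + 1) → F) (ψ : Fin (n + 1) → F) :
    joinLab hi' hl (φ ∘ finRotate (m + 1)) ψ = joinLab hi hl φ ψ ∘ finRotate (l + 1) := by
  funext t
  have hr := finRotate_val t
  rw [Function.comp]
  by_cases h1 : (t : ℕ) < i'
  · rw [joinLab_lt _ _ _ _ t h1, joinLab_lt]
    · refine congrArg φ (Fin.ext ?_)
      rw [hr, finRotate_val]
      simp only; split_ifs <;> omega
    · rw [hr]; split_ifs <;> omega
  by_cases h2 : (t : ℕ) < i' + n
  · rw [joinLab_mid _ _ _ _ t (by omega) h2, joinLab_mid]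
    · refine congrArg ψ (Fin.ext ?_)
      simp only; rw [hr]; split_ifs <;> omega
    · rw [hr]; split_ifs <;> omega
    · rw [hr]; split_ifs <;> omega
  · rw [joinLab_ge _ _ _ _ t (by omega)]
    by_cases h3 : (t : ℕ) = l
    · rw [joinLab_lt]
      · refine congrArg φ (Fin.ext ?_)
        rw [hr, finRotate_val]
        simp only; split_ifs <;> omega
      · rw [hr]; split_ifs <;> omega
    · rw [joinLab_ge]
      · refine congrArg φ (Fin.ext ?_)
        rw [finRotate_val]
        simp only [hr]; split_ifs <;> omega
      · rw [hr]; split_ifs <;> omega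

/-- The label side of the first cyclicity condition: after rotation the slot n of q carries the
label of its old slot 0, and the slot 0 of p that of its old slot 1. So the same two labels are
glued, now with q as the outer element. -/
theorem joinLab_finRotate_one {F : Type} {m n l : ℕ} (hm : 1 ≤ 1 ∧ 1 ≤ m) (hn : 1 ≤ n ∧ n ≤ n)
    (hl : l + 1 = m + n) (hl' : l + 1 = n + m) (φ : Fin (m + 1) → F) (ψ : Fin (n + 1) → F) :
    joinLab hn hl' (ψ ∘ finRotate (n + 1)) (φ ∘ finRotate (m + 1)) =
      joinLab hm hl φ ψ ∘ finRotate (l + 1) := by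
  funext t
  have hr := finRotate_val t
  rw [Function.comp]
  by_cases h1 : (t : ℕ) < n
  · rw [joinLab_lt _ _ _ _ t h1, joinLab_mid]
    · refine congrArg ψ (Fin.ext ?_)
      rw [finRotate_val]
      simp only [hr]; split_ifs <;> omega
    · rw [hr]; split_ifs <;> omega
    · rw [hr]; split_ifs <;> omega
  · rw [joinLab_mid _ _ _ _ t (by omega) (by omega)]
    by_cases h3 : (t : ℕ) = l
    · rw [joinLab_lt]
      · refine congrArg φ (Fin.ext ?_)
        rw [hr, finRotate_val]
        simp only; split_ifs <;> omega
      · rw [hr]; split_ifs <;> omega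
    · rw [joinLab_ge]
      · refine congrArg φ (Fin.ext ?_)
        rw [finRotate_val]
        simp only [hr]; split_ifs <;> omega
      · rw [hr]; split_ifs <;> omega

theorem Compat.of_rotate (hc : IsNonunitalCyclic W c) {m n l i i' : ℕ} (hi : 1 ≤ i ∧ i ≤ m)
    (hi' : 1 ≤ i' ∧ i' ≤ m) (hl : l + 1 = m + n) (h : i' + 1 = i) :
    Compat c hi hi' hl (finRotate (m + 1)) 1 :=
  ⟨finRotate (l + 1), fun x y => by rw [W.act_one, ← hc.rotate_succ m n l i i' hi hi' hl h],
    fun F φ ψ => joinLab_finRotate_succ hi hi' hl h φ ψ⟩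

/-- A permutation that fixes 0 is covered by the equivariance of the operad. Any other one is α τ β
with α and β fixing 0 and τ the cycle, and i' is moved to i through j and j + 1, all of which lie
between 1 and m, so that each factor is compatible. -/
theorem compat (hc : IsNonunitalCyclic W c) {m n l i i' : ℕ} (hi : 1 ≤ i ∧ i ≤ m)
    (hi' : 1 ≤ i' ∧ i' ≤ m) (hl : l + 1 = m + n) {σ : Equiv.Perm (Fin (m + 1))}
    {ρ : Equiv.Perm (Fin (n + 1))} (hρ : ρ 0 = 0)
    (h : σ ⟨i', Nat.lt_succ_of_le hi'.2⟩ = ⟨i, Nat.lt_succ_of_le hi.2⟩) :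
    Compat c hi hi' hl σ ρ := by
  by_cases h0 : σ 0 = 0
  · exact .of_sig hc.operad hl h0 hρ h
  have hm : 1 < m + 1 := by have := hi.1; have := hi.2; omega
  have hτ0 : finRotate (m + 1) 0 = ⟨1, hm⟩ := Fin.ext (by rw [finRotate_val]; simp; omega)
  -- As τ sends 0 to 1, the choice α 1 = σ 0 makes α τ agree with σ at 0; the remaining factor β
  -- then fixes 0.
  obtain ⟨α, hα0, hα1⟩ : ∃ α : Equiv.Perm (Fin (m + 1)), α 0 = 0 ∧ α ⟨1, hm⟩ = σ 0 :=
    ⟨Equiv.swap ⟨1, hm⟩ (σ 0), Equiv.swap_apply_of_ne_of_ne (by simp [Fin.ext_iff]) (Ne.symm h0),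
      Equiv.swap_apply_left _ _⟩
  obtain ⟨β, rfl⟩ : ∃ β, σ = α * (finRotate (m + 1) * β) :=
    ⟨(α * finRotate (m + 1))⁻¹ * σ, by group⟩
  have hβ0 : β 0 = 0 := by
    apply (finRotate (m + 1)).injective
    apply α.injective
    rw [hτ0, hα1]
    rfl
  obtain ⟨j, hj⟩ : ∃ j, j = β ⟨i', Nat.lt_succ_of_le hi'.2⟩ := ⟨_, rfl⟩
  rw [Equiv.Perm.mul_apply, Equiv.Perm.mul_apply, ← hj] at h
  -- The slot j is neither 0, since β fixes 0 and i' is not 0, nor m, since τ m = 0 would give i =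
  -- 0. So τ moves j to j + 1 without passing 0, as the second cyclicity condition requires.
  have hp : 1 ≤ (j : ℕ) := by
    rw [Nat.one_le_iff_ne_zero]
    intro h1
    have h2 : (0 : Fin (m + 1)) = ⟨i', Nat.lt_succ_of_le hi'.2⟩ :=
      β.injective (by rw [hβ0, ← hj]; exact (Fin.ext h1).symm)
    have := congrArg Fin.val h2
    simp at this
    omega
  have hpl : (j : ℕ) < m := by
    by_contra hlt
    have h2 : finRotate (m + 1) j = 0 := Fin.ext (by
      rw [finRotate_val, if_pos (by omega)]; rfl)
    rw [h2, hα0] at h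
    have := congrArg Fin.val h
    simp at this
    omega
  have hq : finRotate (m + 1) j = ⟨(j : ℕ) + 1, by omega⟩ := Fin.ext (by
    rw [finRotate_val, if_neg (by omega)])
  have hj1 : 1 ≤ (j : ℕ) + 1 ∧ (j : ℕ) + 1 ≤ m := ⟨by omega, hpl⟩
  have e1 : Compat c hi hj1 hl α ρ :=
    .of_sig hc.operad hl hα0 hρ (by rw [← h, ← hq])
  have e2 := Compat.of_rotate hc (n := n) (i := (j : ℕ) + 1) (i' := j)
    hj1 ⟨hp, hpl.le⟩ hl rfl
  have e3 : Compat c ⟨hp, hpl.le⟩ hi' hl β (1 : Equiv.Perm (Fin (n + 1))) :=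
    .of_sig hc.operad hl hβ0 rfl hj.symm
  have := e1.trans (e2.trans e3)
  rwa [mul_one, mul_one] at this

end compat

/-! ### Labeled elements and their compositions -/

/-- Elements of `W` whose slots are labeled by elements of `F`. -/
structure Lab {k : Type u} [CommRing k] (W : CycMod.{u, v} k) (F : Type) where
  n : ℕ
  lab : Fin (n + 1) → F
  val : W.X n

namespace Lab
variable {k : Type u} [CommRing k] {W : CycMod.{u, v} k} {F : Type}

/-- Renumbering of the slots. -/
def perm (P : Lab W F) {n' : ℕ} (σ : Fin (n' + 1) ≃ Fin (P.n + 1)) : Lab W F :=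
  ⟨n', P.lab ∘ σ, W.tr σ P.val⟩

theorem perm_refl (P : Lab W F) : P.perm (.refl _) = P := by
  simp only [perm, CycMod.tr_refl]; rfl

theorem perm_perm (P : Lab W F) {n' n'' : ℕ} (σ : Fin (n' + 1) ≃ Fin (P.n + 1))
    (τ : Fin (n'' + 1) ≃ Fin (n' + 1)) : (P.perm σ).perm τ = P.perm (τ.trans σ) := by
  simp only [perm, CycMod.tr_trans]; rfl

/-- The labeled elements agree up to the numbering of the slots. -/
def Equiv (P Q : Lab W F) : Prop := ∃ σ : Fin (Q.n + 1) ≃ Fin (P.n + 1), Q = P.perm σ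

theorem equiv_perm (P : Lab W F) {n' : ℕ} (σ : Fin (n' + 1) ≃ Fin (P.n + 1)) :
    P.Equiv (P.perm σ) := ⟨σ, rfl⟩

theorem Equiv.refl (P : Lab W F) : P.Equiv P := ⟨.refl _, P.perm_refl.symm⟩

theorem Equiv.exists_perm {P Q : Lab W F} (h : P.Equiv Q) :
    ∃ σ : Equiv.Perm (Fin (P.n + 1)), Q = P.perm σ := by
  obtain ⟨σ, h⟩ := h
  have hn : Q.n = P.n := Nat.succ_injective (Fin.equiv_iff_eq.1 ⟨σ⟩)
  obtain ⟨n, φ, x⟩ := Q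
  obtain rfl : n = P.n := hn
  exact ⟨σ, h⟩

theorem Equiv.symm {P Q : Lab W F} (h : P.Equiv Q) : Q.Equiv P := by
  obtain ⟨σ, rfl⟩ := h.exists_perm
  refine ⟨σ.symm, ?_⟩
  rw [perm_perm]
  simp [perm_refl]

theorem Equiv.trans {P Q R : Lab W F} (h : P.Equiv Q) (h' : Q.Equiv R) : P.Equiv R := by
  obtain ⟨σ, rfl⟩ := h.exists_perm
  obtain ⟨τ, rfl⟩ := h'.exists_perm
  exact ⟨_, perm_perm _ _ _⟩

theorem Equiv.n_eq {P Q : Lab W F} (h : P.Equiv Q) : P.n = Q.n := by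
  obtain ⟨σ, rfl⟩ := h.exists_perm
  rfl

/-- The label `f` occurs. -/
def Mem (f : F) (P : Lab W F) : Prop := ∃ j, P.lab j = f

theorem Equiv.mem_iff {P Q : Lab W F} (h : P.Equiv Q) (f : F) : Mem f P ↔ Mem f Q := by
  obtain ⟨σ, rfl⟩ := h.exists_perm
  exact ⟨fun ⟨j, hj⟩ => ⟨σ.symm j, by simp [perm, hj]⟩, fun ⟨j, hj⟩ => ⟨σ j, hj⟩⟩

theorem Equiv.injective {P Q : Lab W F} (h : P.Equiv Q) (hP : P.lab.Injective) :
    Q.lab.Injective := by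
  obtain ⟨σ, rfl⟩ := h.exists_perm
  exact hP.comp σ.injective

/-- When the labels are distinct, only the identity renumbering preserves them. This is how
equivalences are turned back into equations in `W`. -/
theorem Equiv.eq_of_lab_eq {n : ℕ} {φ : Fin (n + 1) → F} (hφ : φ.Injective) {x y : W.X n}
    (h : Equiv (⟨n, φ, x⟩ : Lab W F) ⟨n, φ, y⟩) : x = y := by
  obtain ⟨σ, h⟩ := h.exists_perm
  simp only [perm, mk.injEq, heq_eq_eq, true_and] at h
  obtain rfl : σ = 1 := _root_.Equiv.ext fun t => hφ (congrFun h.1 t).symm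
  exact (h.2.trans (W.act_one n x)).symm

variable {c : Comp.{u, v} k W.X}

/-- The composition at the slot `i` of `P` and the slot `0` of `Q`. -/
def join (c : Comp.{u, v} k W.X) (P Q : Lab W F) {l i : ℕ} (hi : 1 ≤ i ∧ i ≤ P.n)
    (hl : l + 1 = P.n + Q.n) : Lab W F :=
  ⟨l, joinLab hi hl P.lab Q.lab, c P.n Q.n l i hi hl P.val Q.val⟩

/-- `R` is a composition of `P` and `Q` at the slots with the labels `a` and `b`. -/
def Join (c : Comp.{u, v} k W.X) (P Q : Lab W F) (a b : F) (R : Lab W F) : Prop :=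
  ∃ (P' Q' : Lab W F) (l i : ℕ) (hi : 1 ≤ i ∧ i ≤ P'.n) (hl : l + 1 = P'.n + Q'.n),
    P.Equiv P' ∧ Q.Equiv Q' ∧ P'.lab ⟨i, Nat.lt_succ_of_le hi.2⟩ = a ∧ Q'.lab 0 = b ∧
      (join c P' Q' hi hl).Equiv R

theorem Join.congr {P Q R P' Q' R' : Lab W F} {a b : F} (h : Join c P Q a b R)
    (hP : P.Equiv P') (hQ : Q.Equiv Q') (hR : R.Equiv R') : Join c P' Q' a b R' := by
  obtain ⟨P₁, Q₁, l, i, hi, hl, h1, h2, h3, h4, h5⟩ := h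
  exact ⟨P₁, Q₁, l, i, hi, hl, hP.symm.trans h1, hQ.symm.trans h2, h3, h4, h5.trans hR⟩

theorem Join.n_add_one {P Q R : Lab W F} {a b : F} (h : Join c P Q a b R) :
    R.n + 1 = P.n + Q.n := by
  obtain ⟨P₁, Q₁, l, i, hi, hl, h1, h2, -, -, h5⟩ := h
  rw [h1.n_eq, h2.n_eq, ← h5.n_eq]
  exact hl

theorem Join.one_le {P Q R : Lab W F} {a b : F} (h : Join c P Q a b R) : 1 ≤ P.n := by
  obtain ⟨P₁, Q₁, l, i, hi, hl, h1, h2, -, -, h5⟩ := h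
  rw [h1.n_eq]
  exact hi.1.trans hi.2

/-- A numbering of the slots in which two given labels have given numbers. -/
theorem exists_equiv_lab (P : Lab W F) {a : F} (ha : Mem a P) (i : Fin (P.n + 1)) :
    ∃ P' : Lab W F, P.Equiv P' ∧ ∃ h : P'.n = P.n, P'.lab ⟨i, by omega⟩ = a := by
  obtain ⟨j, rfl⟩ := ha
  exact ⟨P.perm (Equiv.swap i j), equiv_perm _ _, rfl, by simp [perm]⟩

theorem exists_equiv_lab₂ (P : Lab W F) {a b : F} (ha : Mem a P) (hb : Mem b P) (hab : a ≠ b)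
    (i j : Fin (P.n + 1)) (hij : i ≠ j) :
    ∃ P' : Lab W F, P.Equiv P' ∧ ∃ h : P'.n = P.n,
      P'.lab ⟨i, by omega⟩ = a ∧ P'.lab ⟨j, by omega⟩ = b := by
  obtain ⟨P', h1, hn, h2⟩ := P.exists_equiv_lab ha i
  obtain ⟨n, φ, x⟩ := P'
  obtain rfl : n = P.n := hn
  obtain ⟨j', hj'⟩ := (h1.mem_iff b).1 hb
  have hj'' : φ j' = b := hj'
  refine ⟨perm ⟨P.n, φ, x⟩ (Equiv.swap j j'), h1.trans (equiv_perm _ _), rfl, ?_, ?_⟩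
  -- The second transposition must not disturb the label already placed at i.
  · have h3 : i ≠ j' := by
      rintro rfl
      exact hab (h2.symm.trans hj')
    simp only [perm, Function.comp]
    rw [Equiv.swap_apply_of_ne_of_ne hij h3]
    exact h2
  · simp [perm, hj'']

/-- The composition is determined by the labels at which it takes place. -/
theorem Join.unique (hc : IsNonunitalCyclic W c) {P Q R R' : Lab W F} {a b : F}
    (hP : P.lab.Injective) (hQ : Q.lab.Injective) (h : Join c P Q a b R)
    (h' : Join c P Q a b R') : R.Equiv R' := by
  obtain ⟨P₁, Q₁, l, i, hi, hl, h1, h2, h3, h4, h5⟩ := h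
  obtain ⟨P₂, Q₂, l', i', hi', hl', h1', h2', h3', h4', h5'⟩ := h'
  refine h5.symm.trans (Equiv.trans ?_ h5')
  replace hP := h1.injective hP
  replace hQ := h2.injective hQ
  obtain ⟨σ, rfl⟩ := (h1.symm.trans h1').exists_perm
  obtain ⟨ρ, rfl⟩ := (h2.symm.trans h2').exists_perm
  obtain rfl : l = l' := by
    have : l' + 1 = P₁.n + Q₁.n := hl'
    omega
  -- Distinct labels force the comparison permutations to match the glued slots, which is the
  -- hypothesis of `compat`.
  have hσ : σ ⟨i', Nat.lt_succ_of_le hi'.2⟩ = ⟨i, Nat.lt_succ_of_le hi.2⟩ := hP (h3'.trans h3.symm)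
  have hρ : ρ 0 = 0 := hQ (h4'.trans h4.symm)
  obtain ⟨θ, hθ, hθ'⟩ := compat hc hi hi' hl hρ hσ
  refine ⟨θ, ?_⟩
  simp only [join, perm, mk.injEq, heq_eq_eq, true_and]
  exact ⟨hθ' F _ _, hθ _ _⟩

/-- This is the first cyclicity condition. The label b moves to the last slot of Q, which must not
be its slot 0; hence the assumption on `Q.n`. -/
theorem Join.swap (hc : IsNonunitalCyclic W c) {P Q R : Lab W F} {a b : F}
    (hP : P.lab.Injective) (hQ : Q.lab.Injective) (h : Join c P Q a b R) (hn : 1 ≤ Q.n) :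
    Join c Q P b a R := by
  obtain ⟨P₁, Q₁, l, i, hi, hl, h1, h2, h3, h4, h5⟩ := id h
  have hm := h.one_le
  -- The condition speaks only of the slot 1, so the label a is moved there first; uniqueness then
  -- leads back to the given composite.
  obtain ⟨P₂, h6, hn2, h7⟩ := P.exists_equiv_lab (a := a) ((h1.mem_iff a).2 ⟨_, h3⟩) ⟨1, by omega⟩
  have hl2 : l + 1 = P₂.n + Q₁.n := by rw [hl, ← h1.n_eq, hn2]
  have hi2 : 1 ≤ 1 ∧ 1 ≤ P₂.n := by omega
  have hh : Join c P Q a b (join c P₂ Q₁ hi2 hl2) :=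
    ⟨P₂, Q₁, l, 1, hi2, hl2, h6, h2, h7, h4, .refl _⟩
  have hnQ := h2.n_eq
  refine ⟨Q₁.perm (finRotate _), P₂.perm (finRotate _), l, Q₁.n, ⟨by omega, le_rfl⟩,
    hl2.trans (Nat.add_comm _ _), h2.trans (equiv_perm _ _), h6.trans (equiv_perm _ _), ?_, ?_, ?_⟩
  · rw [← h4]
    refine congrArg Q₁.lab (Fin.ext ?_)
    exact (finRotate_val (n := Q₁.n) _).trans (if_pos rfl)
  · rw [← h7]
    refine congrArg P₂.lab (Fin.ext ?_)
    exact (finRotate_val (n := P₂.n) 0).trans (if_neg (by rw [Fin.val_zero]; omega))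
  · refine Equiv.trans ?_ (hh.unique hc hP hQ h)
    refine Equiv.symm ⟨finRotate (l + 1), ?_⟩
    simp only [join, perm, mk.injEq, heq_eq_eq, true_and]
    exact ⟨joinLab_finRotate_one _ _ _ _ _ _, (hc.rotate_one _ _ _ _ _ _ _ _ _).symm⟩

/-- The composition of `P` and `Q` in any order. -/
def SymJoin (c : Comp.{u, v} k W.X) (P Q : Lab W F) (a b : F) (R : Lab W F) : Prop :=
  Join c P Q a b R ∨ Join c Q P b a R

theorem SymJoin.symm {P Q R : Lab W F} {a b : F} (h : SymJoin c P Q a b R) :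
    SymJoin c Q P b a R := Or.symm h

theorem SymJoin.congr {P Q R P' Q' R' : Lab W F} {a b : F} (h : SymJoin c P Q a b R)
    (hP : P.Equiv P') (hQ : Q.Equiv Q') (hR : R.Equiv R') : SymJoin c P' Q' a b R' :=
  h.imp (fun h => h.congr hP hQ hR) (fun h => h.congr hQ hP hR)

theorem SymJoin.n_add_one {P Q R : Lab W F} {a b : F} (h : SymJoin c P Q a b R) :
    R.n + 1 = P.n + Q.n := by
  rcases h with h | h
  · exact h.n_add_one
  · rw [h.n_add_one, Nat.add_comm]

/-- The outer element of a composition needs a slot other than 0. As soon as P has one, both orders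
can be brought to the form with P outside. -/
theorem SymJoin.join (hc : IsNonunitalCyclic W c) {P Q R : Lab W F} {a b : F}
    (hP : P.lab.Injective) (hQ : Q.lab.Injective) (h : SymJoin c P Q a b R) (hn : 1 ≤ P.n) :
    Join c P Q a b R :=
  h.elim id fun h => h.swap hc hQ hP hn

theorem SymJoin.unique (hc : IsNonunitalCyclic W c) {P Q R R' : Lab W F} {a b : F}
    (hP : P.lab.Injective) (hQ : Q.lab.Injective) (h : SymJoin c P Q a b R)
    (h' : SymJoin c P Q a b R') : R.Equiv R' := by
  rcases h with h | h
  · exact h.unique hc hP hQ (h'.join hc hP hQ h.one_le)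
  · exact h.unique hc hQ hP (h'.symm.join hc hQ hP h.one_le)

theorem Join.exists {P Q : Lab W F} {a b : F} (ha : Mem a P) (hb : Mem b Q) (hn : 1 ≤ P.n) :
    ∃ R, Join c P Q a b R := by
  obtain ⟨P', h1, hn1, h2⟩ := P.exists_equiv_lab ha ⟨1, by omega⟩
  obtain ⟨Q', h3, hn3, h4⟩ := Q.exists_equiv_lab hb 0
  exact ⟨Lab.join c P' Q' (l := P'.n + Q'.n - 1) (i := 1) ⟨le_rfl, by omega⟩ (by omega),
    P', Q', _, 1, _, _, h1, h3, h2, h4, .refl _⟩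

theorem SymJoin.exists {P Q : Lab W F} {a b : F} (ha : Mem a P) (hb : Mem b Q)
    (hn : 1 ≤ P.n ∨ 1 ≤ Q.n) : ∃ R, SymJoin c P Q a b R := by
  rcases hn with hn | hn
  · obtain ⟨R, h⟩ := Join.exists (c := c) ha hb hn
    exact ⟨R, Or.inl h⟩
  · obtain ⟨R, h⟩ := Join.exists (c := c) hb ha hn
    exact ⟨R, Or.inr h⟩

theorem Join.mem_iff {P Q R : Lab W F} {a b : F} (hP : P.lab.Injective) (hQ : Q.lab.Injective)
    (h : Join c P Q a b R) (f : F) : Mem f R ↔ (Mem f P ∧ f ≠ a) ∨ (Mem f Q ∧ f ≠ b) := by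
  obtain ⟨P₁, Q₁, l, i, hi, hl, h1, h2, h3, h4, h5⟩ := h
  rw [← h5.mem_iff, h1.mem_iff, h2.mem_iff]
  refine (mem_range_joinLab hi hl P₁.lab Q₁.lab f).trans (or_congr ?_ ?_)
  · subst h3
    constructor
    · rintro ⟨j, hj, rfl⟩
      exact ⟨⟨j, rfl⟩, fun h => hj (congrArg Fin.val (h1.injective hP h))⟩
    · rintro ⟨⟨j, rfl⟩, hj⟩
      exact ⟨j, fun h => hj (congrArg P₁.lab (Fin.ext h)), rfl⟩
  · subst h4
    constructor
    · rintro ⟨j, hj, rfl⟩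
      exact ⟨⟨j, rfl⟩, fun h => hj (congrArg Fin.val (h2.injective hQ h))⟩
    · rintro ⟨⟨j, rfl⟩, hj⟩
      exact ⟨j, fun h => hj (congrArg Q₁.lab (Fin.ext h)), rfl⟩

theorem Join.injective {P Q R : Lab W F} {a b : F} (hP : P.lab.Injective) (hQ : Q.lab.Injective)
    (hPQ : ∀ f, Mem f P → ¬ Mem f Q) (h : Join c P Q a b R) : R.lab.Injective := by
  obtain ⟨P₁, Q₁, l, i, hi, hl, h1, h2, h3, h4, h5⟩ := h
  refine h5.injective (joinLab_injective hi hl (h1.injective hP) (h2.injective hQ) fun s t hst => ?_)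
  exact hPQ (P₁.lab s) ((h1.mem_iff _).2 ⟨s, rfl⟩) ((h2.mem_iff _).2 ⟨t, hst.symm⟩)

theorem Join.mem {P Q R : Lab W F} {a b : F} (h : Join c P Q a b R) : Mem a P ∧ Mem b Q := by
  obtain ⟨P₁, Q₁, l, i, hi, hl, h1, h2, h3, h4, h5⟩ := h
  exact ⟨(h1.mem_iff _).2 ⟨_, h3⟩, (h2.mem_iff _).2 ⟨_, h4⟩⟩

theorem SymJoin.mem {P Q R : Lab W F} {a b : F} (h : SymJoin c P Q a b R) :
    Mem a P ∧ Mem b Q :=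
  h.elim Join.mem fun h => h.mem.symm

theorem one_le_n {P : Lab W F} {a b : F} (ha : Mem a P) (hb : Mem b P) (hab : a ≠ b) :
    1 ≤ P.n := by
  obtain ⟨i, rfl⟩ := ha
  obtain ⟨j, rfl⟩ := hb
  have : i ≠ j := fun h => hab (congrArg _ h)
  have := Fin.val_ne_of_ne this
  omega

/-- Number the slots so that P is glued at 1, Q at 0 to P and at 1 to R, and R at 0. Then both
bracketings are nested and agree by the axiom (P ∘_1 Q) ∘_1 R = P ∘_1 (Q ∘_1 R); by uniqueness the
given composites have this form. -/
theorem SymJoin.assoc_of_one_le (hc : IsNonunitalCyclic W c) {P Q R S T U T' : Lab W F}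
    {a b c' d : F} (hP : P.lab.Injective) (hQ : Q.lab.Injective) (hR : R.lab.Injective)
    (hPQ : ∀ f, Mem f P → ¬ Mem f Q) (hQR : ∀ f, Mem f Q → ¬ Mem f R)
    (hbc : b ≠ c') (hS : SymJoin c P Q a b S) (hT : SymJoin c S R c' d T)
    (hU : SymJoin c Q R c' d U) (hT' : SymJoin c P U a b T') (hn : 1 ≤ P.n) : T.Equiv T' := by
  obtain ⟨ha, hb⟩ := hS.mem
  obtain ⟨hc', hd⟩ := hU.mem
  have hn' := one_le_n hb hc' hbc
  obtain ⟨P₁, hP1, hPn, hPa⟩ := P.exists_equiv_lab ha ⟨1, by omega⟩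
  obtain ⟨Q₁, hQ1, hQn, hQb, hQc⟩ := Q.exists_equiv_lab₂ hb hc' hbc 0 ⟨1, by omega⟩
    (by simp [Fin.ext_iff])
  obtain ⟨R₁, hR1, hRn, hRd⟩ := R.exists_equiv_lab hd 0
  obtain ⟨s, hs⟩ : ∃ s, s + 1 = P₁.n + Q₁.n := ⟨P₁.n + Q₁.n - 1, by omega⟩
  obtain ⟨s', hs'⟩ : ∃ s, s + 1 = Q₁.n + R₁.n := ⟨Q₁.n + R₁.n - 1, by omega⟩
  obtain ⟨t, ht⟩ : ∃ t, t + 1 = s + R₁.n := ⟨s + R₁.n - 1, by omega⟩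
  have hi : 1 ≤ 1 ∧ 1 ≤ P₁.n := by omega
  have hi' : 1 ≤ 1 ∧ 1 ≤ Q₁.n := by omega
  have his : 1 ≤ 1 ∧ 1 ≤ s := by omega
  have ht' : t + 1 = P₁.n + s' := by omega
  have jS : Join c P Q a b (Lab.join c P₁ Q₁ hi hs) :=
    ⟨P₁, Q₁, s, 1, hi, hs, hP1, hQ1, hPa, hQb, .refl _⟩
  have jU : Join c Q R c' d (Lab.join c Q₁ R₁ hi' hs') :=
    ⟨Q₁, R₁, s', 1, hi', hs', hQ1, hR1, hQc, hRd, .refl _⟩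
  have jT : Join c (Lab.join c P₁ Q₁ hi hs) R c' d
      (Lab.join c (Lab.join c P₁ Q₁ hi hs) R₁ (l := t) (i := 1) his ht) :=
    ⟨_, R₁, t, 1, his, ht, .refl _, hR1, by
      refine (joinLab_mid hi hs _ _ _ le_rfl ?_).trans hQc
      simp only
      omega, hRd, .refl _⟩
  have jT' : Join c P (Lab.join c Q₁ R₁ hi' hs') a b
      (Lab.join c P₁ (Lab.join c Q₁ R₁ hi' hs') (l := t) (i := 1) hi ht') :=
    ⟨P₁, _, t, 1, hi, ht', hP1, .refl _, hPa,
      (joinLab_lt hi' hs' _ R₁.lab 0 (by simp)).trans hQb, .refl _⟩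
  have e : Lab.join c (Lab.join c P₁ Q₁ hi hs) R₁ (l := t) (i := 1) his ht =
      Lab.join c P₁ (Lab.join c Q₁ R₁ hi' hs') (l := t) (i := 1) hi ht' := by
    simp only [Lab.join, mk.injEq, heq_eq_eq, true_and]
    exact ⟨joinLab_assoc_inside _ _ _ _ _ _ _ le_rfl (by omega) rfl _ _ _,
      hc.operad.assoc_inside _ _ _ _ _ _ _ _ _ _ _ _ _ _ _ _ le_rfl (by omega) rfl _ _ _⟩
  have iS := jS.injective hP hQ hPQ
  have iU := jU.injective hQ hR hQR
  have eS := hS.unique hc hP hQ (Or.inl jS)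
  have eU := hU.unique hc hQ hR (Or.inl jU)
  have eT := (hT.congr eS (.refl _) (.refl _)).unique hc iS hR (Or.inl jT)
  have eT' := (hT'.congr (.refl _) eU (.refl _)).unique hc hP iU (Or.inl jT')
  rw [e] at eT
  exact eT.trans eT'.symm

/-- The elements form a chain P, Q, R. If P or, reading the chain backwards, R has a second slot,
the nested axiom applies. Otherwise both have the slot 0 only, Q must be outside in all
compositions, and the axiom for two separate insertions is needed. -/
theorem SymJoin.assoc (hc : IsNonunitalCyclic W c) {P Q R S T U T' : Lab W F}
    {a b c' d : F} (hP : P.lab.Injective) (hQ : Q.lab.Injective) (hR : R.lab.Injective)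
    (hPQ : ∀ f, Mem f P → ¬ Mem f Q) (hQR : ∀ f, Mem f Q → ¬ Mem f R)
    (hbc : b ≠ c') (hS : SymJoin c P Q a b S) (hT : SymJoin c S R c' d T)
    (hU : SymJoin c Q R c' d U) (hT' : SymJoin c P U a b T') : T.Equiv T' := by
  by_cases hPn : 1 ≤ P.n
  · exact hS.assoc_of_one_le hc hP hQ hR hPQ hQR hbc hT hU hT' hPn
  by_cases hRn : 1 ≤ R.n
  · exact (hU.symm.assoc_of_one_le hc hR hQ hP (fun f h h' => hQR f h' h)
      (fun f h h' => hPQ f h' h) hbc.symm hT'.symm hS.symm hT.symm hRn).symm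
  obtain ⟨ha, hb⟩ := hS.mem
  obtain ⟨hc', hd⟩ := hU.mem
  -- The count of slots gives `Q.n = T.n + 2`, so Q has the slots 1 and 2, at which P and R can be
  -- inserted.
  have hSn := hS.n_add_one
  have hTn := hT.n_add_one
  obtain ⟨Q₁, hQ1, hQn, hQb, hQc⟩ := Q.exists_equiv_lab₂ hb hc' hbc ⟨1, by omega⟩ ⟨2, by omega⟩
    (by simp [Fin.ext_iff])
  obtain ⟨P₁, hP1, hP1n, hPa⟩ := P.exists_equiv_lab ha 0
  obtain ⟨R₁, hR1, hR1n, hRd⟩ := R.exists_equiv_lab hd 0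
  obtain ⟨s, hs⟩ : ∃ s, s + 1 = Q₁.n + P₁.n := ⟨Q₁.n + P₁.n - 1, by omega⟩
  have hs' : s + 1 = Q₁.n + R₁.n := by omega
  obtain ⟨t, ht⟩ : ∃ t, t + 1 = s + R₁.n := ⟨s + R₁.n - 1, by omega⟩
  have ht' : t + 1 = s + P₁.n := by omega
  have h1 : 1 ≤ 1 ∧ 1 ≤ Q₁.n := by omega
  have h2 : 1 ≤ 2 ∧ 2 ≤ Q₁.n := by omega
  have h1s : 1 ≤ 1 ∧ 1 ≤ s := by omega
  have jS : Join c Q P b a (Lab.join c Q₁ P₁ h1 hs) :=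
    ⟨Q₁, P₁, s, 1, h1, hs, hQ1, hP1, hQb, hPa, .refl _⟩
  have jU : Join c Q R c' d (Lab.join c Q₁ R₁ h2 hs') :=
    ⟨Q₁, R₁, s, 2, h2, hs', hQ1, hR1, hQc, hRd, .refl _⟩
  have jT : Join c (Lab.join c Q₁ P₁ h1 hs) R c' d
      (Lab.join c (Lab.join c Q₁ P₁ h1 hs) R₁ (l := t) (i := 1) h1s ht) :=
    ⟨_, R₁, t, 1, h1s, ht, .refl _, hR1, by
      refine (joinLab_ge h1 hs _ _ _ ?_).trans ((congrArg Q₁.lab (Fin.ext ?_)).trans hQc)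
      · simp only
        omega
      · simp only
        omega, hRd, .refl _⟩
  have jT' : Join c (Lab.join c Q₁ R₁ h2 hs') P b a
      (Lab.join c (Lab.join c Q₁ R₁ h2 hs') P₁ (l := t) (i := 1) h1s ht') :=
    ⟨_, P₁, t, 1, h1s, ht', .refl _, hP1, (joinLab_lt h2 hs' _ R₁.lab ⟨1, by omega⟩ (by simp)).trans hQb, hPa,
      .refl _⟩
  -- Inserting P, which has no inputs, at the slot 1 of Q turns the slot 2 into the slot 1.
  have e : Lab.join c (Lab.join c Q₁ R₁ h2 hs') P₁ (l := t) (i := 1) h1s ht' =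
      Lab.join c (Lab.join c Q₁ P₁ h1 hs) R₁ (l := t) (i := 1) h1s ht := by
    simp only [Lab.join, mk.injEq, heq_eq_eq, true_and]
    exact ⟨joinLab_assoc_before _ _ _ _ _ _ _ _ (by omega) (by omega) _ _ _,
      hc.operad.assoc_before _ _ _ _ _ _ _ _ _ _ _ _ _ _ _ _ _ (by omega) (by omega) _ _ _⟩
  have hQP : ∀ f, Mem f Q → ¬ Mem f P := fun f h h' => hPQ f h' h
  have iS := jS.injective hQ hP hQP
  have iU := jU.injective hQ hR hQR
  have eS := hS.symm.unique hc hQ hP (Or.inl jS)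
  have eU := hU.unique hc hQ hR (Or.inl jU)
  have eT := (hT.congr eS (.refl _) (.refl _)).unique hc iS hR (Or.inl jT)
  have eT' := (hT'.symm.congr eU (.refl _) (.refl _)).unique hc iU hP (Or.inl jT')
  rw [e] at eT'
  exact eT.trans eT'.symm

end Lab

/-! ### Values of connected sets of vertices -/

/-- The flags at the vertices. -/
abbrev Flag {V : Type} (r : V → ℕ) : Type := Σ v : V, Fin (r v + 1)

/-! ### Graphs on flags and their boundaries -/

section bdry
variable {V : Type} {r : V → ℕ}

/-- The flags at the vertices of `A` that are not joined to a flag at a vertex of `A`. -/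
def bdry (E : Flag r → Flag r → Prop) (A : Set V) : Set (Flag r) :=
  {f | f.1 ∈ A ∧ ∀ g, E f g → g.1 ∉ A}

/-- The relation `E` joins the flags to a tree with at least one leg. Every edge separates the
vertices into two sets that are not joined by any other edge. -/
structure IsFlagTree (E : Flag r → Flag r → Prop) : Prop where
  symm : ∀ f g, E f g → E g f
  functional : ∀ f g g', E f g → E f g' → g = g'
  bridge : ∀ f g, E f g → ∃ K : Set V, f.1 ∈ K ∧ g.1 ∉ K ∧
    ∀ f' g', E f' g' → (f' = f ∧ g' = g) ∨ (f' = g ∧ g' = f) ∨ (f'.1 ∈ K ↔ g'.1 ∈ K)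
  boundary : ∀ A : Set V, A.Nonempty → (bdry E A).Nonempty
  connected : ∀ A : Set V, A.Nonempty → (∀ f g, E f g → f.1 ∈ A → g.1 ∈ A) → A = Set.univ

end bdry

section Val
variable {k : Type u} [CommRing k] {W : CycMod.{u, v} k} {V : Type} {r : V → ℕ}

open CycOp.Lab (Mem Join SymJoin)

/-- The composition of the decorations of the vertices in `A` along edges has the value `P`, where
the slots are labeled by the flags that remain. -/
inductive Val (c : Comp.{u, v} k W.X) (E : Flag r → Flag r → Prop) (w : ∀ v, W.X (r v)) :
    Set V → Lab W (Flag r) → Prop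
  | single (v : V) : Val c E w {v} ⟨r v, fun j => ⟨v, j⟩, w v⟩
  | perm {A : Set V} (P : Lab W (Flag r)) {n' : ℕ} (σ : Fin (n' + 1) ≃ Fin (P.n + 1))
      (h : Val c E w A P) : Val c E w A (P.perm σ)
  | join {A B : Set V} (P Q : Lab W (Flag r)) {l i : ℕ} (hi : 1 ≤ i ∧ i ≤ P.n)
      (hl : l + 1 = P.n + Q.n) (hP : Val c E w A P) (hQ : Val c E w B Q) (hd : Disjoint A B)
      (he : E (P.lab ⟨i, Nat.lt_succ_of_le hi.2⟩) (Q.lab 0)) :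
      Val c E w (A ∪ B) (Lab.join c P Q hi hl)

namespace Val
variable {c : Comp.{u, v} k W.X} {E : Flag r → Flag r → Prop} {w : ∀ v, W.X (r v)}

theorem equiv {A : Set V} {P Q : Lab W (Flag r)} (h : Val c E w A P) (hPQ : P.Equiv Q) :
    Val c E w A Q := by
  obtain ⟨σ, hσ⟩ := hPQ
  rw [hσ]
  exact h.perm _ σ

theorem of_join {A B : Set V} {P Q R : Lab W (Flag r)} {a b : Flag r} (hP : Val c E w A P)
    (hQ : Val c E w B Q) (hd : Disjoint A B) (he : E a b) (h : Join c P Q a b R) :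
    Val c E w (A ∪ B) R := by
  obtain ⟨P₁, Q₁, l, i, hi, hl, h1, h2, rfl, rfl, h5⟩ := h
  exact ((hP.equiv h1).join _ _ hi hl (hQ.equiv h2) hd he).equiv h5

theorem nonempty {A : Set V} {P : Lab W (Flag r)} (h : Val c E w A P) : A.Nonempty := by
  induction h with
  | single v => exact ⟨v, rfl⟩
  | perm _ _ _ ih => exact ih
  | join _ _ _ _ _ _ _ _ ih _ => exact ih.mono Set.subset_union_left

theorem mem_set {A : Set V} {P : Lab W (Flag r)} (h : Val c E w A P) (j : Fin (P.n + 1)) :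
    (P.lab j).1 ∈ A := by
  induction h with
  | single v => rfl
  | perm _ σ _ ih => exact ih _
  | join P Q hi hl _ _ _ _ ih ih' =>
    simp only [Lab.join, joinLab]
    rcases slots hi hl j with j | j
    · exact Or.inl (ih _)
    · exact Or.inr (ih' _)

/-- All compositions are along edges inside A, so these edges connect A, and a set K that no such
edge crosses cannot cut A. -/
theorem constant {A K : Set V} {P : Lab W (Flag r)} (h : Val c E w A P)
    (hK : ∀ f g, E f g → f.1 ∈ A → g.1 ∈ A → (f.1 ∈ K ↔ g.1 ∈ K)) {u v : V} (hu : u ∈ A)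
    (hv : v ∈ A) : u ∈ K ↔ v ∈ K := by
  induction h generalizing u v with
  | single x => rw [Set.mem_singleton_iff.1 hu, Set.mem_singleton_iff.1 hv]
  | perm _ _ _ ih => exact ih hK hu hv
  | @join A B P Q l i hi hl hP hQ _ he ih ih' =>
    have h1 : ∀ {u v}, u ∈ A → v ∈ A → (u ∈ K ↔ v ∈ K) := fun hu hv =>
      ih (fun f g h h' h'' => hK f g h (Or.inl h') (Or.inl h'')) hu hv
    have h2 : ∀ {u v}, u ∈ B → v ∈ B → (u ∈ K ↔ v ∈ K) := fun hu hv =>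
      ih' (fun f g h h' h'' => hK f g h (Or.inr h') (Or.inr h'')) hu hv
    have ha := hP.mem_set ⟨i, Nat.lt_succ_of_le hi.2⟩
    have hb := hQ.mem_set 0
    have h3 := hK _ _ he (Or.inl ha) (Or.inr hb)
    rcases hu with hu | hu <;> rcases hv with hv | hv
    · exact h1 hu hv
    · exact (h1 hu ha).trans (h3.trans (h2 hb hv))
    · exact (h2 hu hb).trans (h3.symm.trans (h1 ha hv))
    · exact h2 hu hv

end Val

/-! ### Boundaries, existence and splitting of values -/

namespace IsFlagTree
variable {E : Flag r → Flag r → Prop} (hE : IsFlagTree E) {c : Comp.{u, v} k W.X}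
  {w : ∀ v, W.X (r v)}
include hE

/-- The edge is a bridge: one side of it can be cut by a connected set only if that set contains
both ends. This decides membership of vertices in the arguments on partitions below. -/
theorem exists_side (c : Comp.{u, v} k W.X) (w : ∀ v, W.X (r v)) {f g : Flag r} (h : E f g) :
    ∃ K : Set V, f.1 ∈ K ∧ g.1 ∉ K ∧ ∀ (A : Set V) (P : Lab W (Flag r)), Val c E w A P →
      f.1 ∉ A ∨ g.1 ∉ A → ∀ u ∈ A, ∀ v ∈ A, (u ∈ K ↔ v ∈ K) := by
  obtain ⟨K, h1, h2, h3⟩ := hE.bridge f g h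
  refine ⟨K, h1, h2, fun A P hP hA u hu v hv => hP.constant (fun f' g' h' hf' hg' => ?_) hu hv⟩
  rcases h3 f' g' h' with ⟨rfl, rfl⟩ | ⟨rfl, rfl⟩ | h'
  · exact (hA.elim (· hf') (· hg')).elim
  · exact (hA.elim (· hg') (· hf')).elim
  · exact h'

/-- By disjointness neither A nor B contains both ends of the first edge, so each lies on one side
of this bridge. Any other edge between them would join the two sides. -/
theorem cross_unique {A B : Set V} {P Q : Lab W (Flag r)} (hP : Val c E w A P)
    (hQ : Val c E w B Q) (hd : Disjoint A B) {a b a' b' : Flag r} (h : E a b) (h' : E a' b')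
    (ha : a.1 ∈ A) (hb : b.1 ∈ B) (ha' : a'.1 ∈ A) (hb' : b'.1 ∈ B) : a' = a ∧ b' = b := by
  have hd' := Set.disjoint_left.1 hd
  obtain ⟨K, h1, h2, h3⟩ := hE.bridge a b h
  rcases h3 a' b' h' with h4 | ⟨rfl, rfl⟩ | h4
  · exact h4
  · exact absurd hb (hd' ha')
  · exfalso
    have hA : a.1 ∈ K ↔ a'.1 ∈ K := hP.constant (fun f g h hf hg => by
      rcases h3 f g h with ⟨rfl, rfl⟩ | ⟨rfl, rfl⟩ | h
      · exact absurd hb (hd' hg)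
      · exact absurd hb (hd' hf)
      · exact h) ha ha'
    have hB : b.1 ∈ K ↔ b'.1 ∈ K := hQ.constant (fun f g h hf hg => by
      rcases h3 f g h with ⟨rfl, rfl⟩ | ⟨rfl, rfl⟩ | h
      · exact absurd hf (hd' ha)
      · exact absurd hg (hd' ha)
      · exact h) hb hb'
    exact h2 (hB.2 (h4.1 (hA.1 h1)))

theorem fst_ne {f g : Flag r} (h : E f g) : f.1 ≠ g.1 := by
  obtain ⟨K, h1, h2, -⟩ := hE.bridge f g h
  exact fun h => h2 (h ▸ h1)

/-- A composition uses up two flags, and since no other edge runs between the parts, every other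
flag of the boundary stays in the boundary. -/
theorem lab_injective_and_mem_iff {A : Set V} {P : Lab W (Flag r)} (h : Val c E w A P) :
    P.lab.Injective ∧ ∀ f, Mem f P ↔ f ∈ bdry E A := by
  induction h with
  | single v =>
    refine ⟨fun i j h => by simpa using h, fun f => ⟨?_, ?_⟩⟩
    · rintro ⟨j, rfl⟩
      exact ⟨rfl, fun g hg hv => hE.fst_ne hg hv.symm⟩
    · rintro ⟨hf, -⟩
      obtain ⟨u, j⟩ := f
      obtain rfl : u = v := hf
      exact ⟨j, rfl⟩
  | perm P σ _ ih =>
    exact ⟨(P.equiv_perm σ).injective ih.1, fun f => by rw [← ih.2, (P.equiv_perm σ).mem_iff]⟩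
  | @join A B P Q l i hi hl hP hQ hd he ih ih' =>
    have hd' := Set.disjoint_left.1 hd
    have hj : Join c P Q _ _ (Lab.join c P Q hi hl) :=
      ⟨P, Q, l, i, hi, hl, .refl _, .refl _, rfl, rfl, .refl _⟩
    refine ⟨hj.injective ih.1 ih'.1 fun f hf hf' => ?_, fun f => ?_⟩
    · exact hd' ((ih.2 f).1 hf).1 ((ih'.2 f).1 hf').1
    · have ha := hP.mem_set ⟨i, Nat.lt_succ_of_le hi.2⟩
      have hb := hQ.mem_set 0
      rw [hj.mem_iff ih.1 ih'.1, ih.2, ih'.2]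
      constructor
      · rintro (⟨⟨h1, h2⟩, h3⟩ | ⟨⟨h1, h2⟩, h3⟩)
        · refine ⟨Or.inl h1, fun g hg => ?_⟩
          rintro (h4 | h4)
          · exact h2 g hg h4
          · exact h3 (hE.cross_unique hP hQ hd he hg ha hb h1 h4).1
        · refine ⟨Or.inr h1, fun g hg => ?_⟩
          rintro (h4 | h4)
          · exact h3 (hE.cross_unique hP hQ hd he (hE.symm _ _ hg) ha hb h4 h1).2
          · exact h2 g hg h4
      · rintro ⟨h1 | h1, h2⟩
        · refine Or.inl ⟨⟨h1, fun g hg h => h2 g hg (Or.inl h)⟩, ?_⟩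
          rintro rfl
          exact h2 _ he (Or.inr hb)
        · refine Or.inr ⟨⟨h1, fun g hg h => h2 g hg (Or.inr h)⟩, ?_⟩
          rintro rfl
          exact h2 _ (hE.symm _ _ he) (Or.inl ha)

theorem lab_injective {A : Set V} {P : Lab W (Flag r)} (h : Val c E w A P) : P.lab.Injective :=
  (hE.lab_injective_and_mem_iff h).1

theorem mem_iff {A : Set V} {P : Lab W (Flag r)} (h : Val c E w A P) (f : Flag r) :
    Mem f P ↔ f ∈ bdry E A := (hE.lab_injective_and_mem_iff h).2 f

theorem not_mem_of_disjoint {A B : Set V} {P Q : Lab W (Flag r)} (hP : Val c E w A P)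
    (hQ : Val c E w B Q) (hd : Disjoint A B) (f : Flag r) (hf : Mem f P) : ¬ Mem f Q := fun hf' =>
  Set.disjoint_left.1 hd ((hE.mem_iff hP f).1 hf).1 ((hE.mem_iff hQ f).1 hf').1

theorem mem_of_edge {A B : Set V} {P : Lab W (Flag r)} (hP : Val c E w A P)
    (hd : Disjoint A B) {a b : Flag r} (he : E a b) (ha : a.1 ∈ A) (hb : b.1 ∈ B) : Mem a P := by
  rw [hE.mem_iff hP]
  refine ⟨ha, fun g hg => ?_⟩
  rw [hE.functional _ _ _ hg he]
  exact fun h => Set.disjoint_left.1 hd h hb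

theorem val_of_symJoin {A B : Set V} {P Q R : Lab W (Flag r)} {a b : Flag r}
    (hP : Val c E w A P) (hQ : Val c E w B Q) (hd : Disjoint A B) (he : E a b)
    (h : SymJoin c P Q a b R) : Val c E w (A ∪ B) R := by
  rcases h with h | h
  · exact hP.of_join hQ hd he h
  · rw [Set.union_comm]
    exact hQ.of_join hP hd.symm (hE.symm _ _ he) h

/-- The only obstruction to a composition is that both elements have a single slot. Then the union
would have no flag left over, contrary to the existence of legs. -/
theorem exists_join {A B : Set V} {P Q : Lab W (Flag r)} (hP : Val c E w A P)
    (hQ : Val c E w B Q) (hd : Disjoint A B) {a b : Flag r} (he : E a b) (ha : a.1 ∈ A)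
    (hb : b.1 ∈ B) : ∃ R, SymJoin c P Q a b R ∧ Val c E w (A ∪ B) R := by
  have ha' := hE.mem_of_edge hP hd he ha hb
  have hb' := hE.mem_of_edge hQ hd.symm (hE.symm _ _ he) hb ha
  -- A boundary flag f of the union belongs to one part and differs from the flag glued there, so
  -- that part has two slots.
  have hn : 1 ≤ P.n ∨ 1 ≤ Q.n := by
    obtain ⟨f, hf, hf'⟩ := hE.boundary (A ∪ B) ⟨a.1, Or.inl ha⟩
    rcases hf with hf | hf
    · refine Or.inl (Lab.one_le_n (a := f) (b := a) ?_ ha' ?_)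
      · exact (hE.mem_iff hP f).2 ⟨hf, fun g hg h => hf' g hg (Or.inl h)⟩
      · rintro rfl
        exact hf' _ he (Or.inr hb)
    · refine Or.inr (Lab.one_le_n (a := f) (b := b) ?_ hb' ?_)
      · exact (hE.mem_iff hQ f).2 ⟨hf, fun g hg h => hf' g hg (Or.inr h)⟩
      · rintro rfl
        exact hf' _ (hE.symm _ _ he) (Or.inl ha)
  obtain ⟨R, hR⟩ := SymJoin.exists (c := c) ha' hb' hn
  exact ⟨R, hR, hE.val_of_symJoin hP hQ hd he hR⟩

/-- By connectedness a proper subset with a value has an edge leading out of it, and the vertex at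
the other end can be composed with it. -/
theorem exists_val [Finite V] [Nonempty V] (c : Comp.{u, v} k W.X) (w : ∀ v, W.X (r v)) :
    ∃ P, Val c E w Set.univ P := by
  have key : ∀ A : Set V, (∃ P, Val c E w A P) → ∃ P, Val c E w Set.univ P := by
    intro A
    induction A using WellFoundedGT.induction with
    | ind A ih =>
      rintro ⟨P, hP⟩
      by_cases hA : A = Set.univ
      · exact ⟨P, hA ▸ hP⟩
      have h1 : ¬ ∀ f g, E f g → f.1 ∈ A → g.1 ∈ A := fun h => hA (hE.connected A hP.nonempty h)
      push Not at h1
      obtain ⟨f, g, hfg, hf, hg⟩ := h1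
      obtain ⟨R, -, hR⟩ := hE.exists_join hP (.single g.1)
        (Set.disjoint_singleton_right.2 hg) hfg hf rfl
      have hlt : A ⊂ A ∪ {g.1} := Set.ssubset_iff_subset_ne.2 ⟨Set.subset_union_left,
        fun h => hg (h ▸ Or.inr rfl)⟩
      exact ih _ hlt ⟨R, hR⟩
  exact key _ ⟨_, .single (Classical.arbitrary V)⟩

/-- Any edge inside a connected set can be made the last one to be contracted, up to the choice of
values of the two parts. This prepares the comparison of two orders of contraction. -/
theorem exists_split {A : Set V} {P : Lab W (Flag r)} (h : Val c E w A P) {f g : Flag r}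
    (he : E f g) (hf : f.1 ∈ A) (hg : g.1 ∈ A) :
    ∃ (A₁ A₂ : Set V) (P₁ P₂ : Lab W (Flag r)), Val c E w A₁ P₁ ∧ Val c E w A₂ P₂ ∧
      Disjoint A₁ A₂ ∧ A = A₁ ∪ A₂ ∧ f.1 ∈ A₁ ∧ g.1 ∈ A₂ := by
  -- If A has been split along the edge, the set B is attached to that part of A which contains the
  -- end a of the connecting edge.
  have key : ∀ (A B : Set V) (P Q : Lab W (Flag r)) (a b : Flag r), Val c E w A P →
      Val c E w B Q → Disjoint A B → E a b → a.1 ∈ A → b.1 ∈ B →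
      (∃ (A₁ A₂ : Set V) (P₁ P₂ : Lab W (Flag r)), Val c E w A₁ P₁ ∧ Val c E w A₂ P₂ ∧
        Disjoint A₁ A₂ ∧ A = A₁ ∪ A₂ ∧ f.1 ∈ A₁ ∧ g.1 ∈ A₂) →
      ∃ (A₁ A₂ : Set V) (P₁ P₂ : Lab W (Flag r)), Val c E w A₁ P₁ ∧ Val c E w A₂ P₂ ∧
        Disjoint A₁ A₂ ∧ A ∪ B = A₁ ∪ A₂ ∧ f.1 ∈ A₁ ∧ g.1 ∈ A₂ := by
    rintro _ B P Q a b hP hQ hd hab ha hb ⟨A₁, A₂, P₁, P₂, h1, h2, h3, rfl, h4, h5⟩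
    rw [Set.disjoint_union_left] at hd
    rcases ha with ha | ha
    · obtain ⟨R, -, hR⟩ := hE.exists_join h1 hQ hd.1 hab ha hb
      exact ⟨_, _, _, _, hR, h2, Set.disjoint_union_left.2 ⟨h3, hd.2.symm⟩,
        Set.union_right_comm _ _ _, Or.inl h4, h5⟩
    · obtain ⟨R, -, hR⟩ := hE.exists_join h2 hQ hd.2 hab ha hb
      exact ⟨_, _, _, _, h1, hR, Set.disjoint_union_right.2 ⟨h3, hd.1⟩,
        Set.union_assoc _ _ _, h4, Or.inl h5⟩
  induction h with
  | single v => exact absurd (hf.trans hg.symm) (hE.fst_ne he)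
  | perm _ _ _ ih => exact ih hf hg
  | @join A B P Q l i hi hl hP hQ hd hab ih ih' =>
    have ha := hP.mem_set ⟨i, Nat.lt_succ_of_le hi.2⟩
    have hb := hQ.mem_set 0
    rcases hf with hf | hf <;> rcases hg with hg | hg
    · exact key A B P Q _ _ hP hQ hd hab ha hb (ih hf hg)
    · exact ⟨A, B, P, Q, hP, hQ, hd, rfl, hf, hg⟩
    · exact ⟨B, A, Q, P, hQ, hP, hd.symm, Set.union_comm _ _, hf, hg⟩
    · rw [Set.union_comm]
      exact key B A Q P _ _ hQ hP hd.symm (hE.symm _ _ hab) hb ha (ih' hf hg)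

end IsFlagTree

/-- The value `P` of `A ∪ B` arises by composition along the edge between `a` and `b`. -/
def Split (c : Comp.{u, v} k W.X) (E : Flag r → Flag r → Prop) (w : ∀ v, W.X (r v)) (A B : Set V)
    (a b : Flag r) (P : Lab W (Flag r)) : Prop :=
  ∃ P₁ P₂, Val c E w A P₁ ∧ Val c E w B P₂ ∧ Disjoint A B ∧ E a b ∧ a.1 ∈ A ∧ b.1 ∈ B ∧
    SymJoin c P₁ P₂ a b P

/-- Renumberings after the last composition are absorbed, so only the last composition, if there is
one, has to be compared. -/
theorem Val.single_or_split {c : Comp.{u, v} k W.X} {E : Flag r → Flag r → Prop}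
    {w : ∀ v, W.X (r v)} {A : Set V} {P : Lab W (Flag r)} (h : Val c E w A P) :
    (∃ v, A = {v} ∧ Lab.Equiv ⟨r v, fun j => ⟨v, j⟩, w v⟩ P) ∨
      ∃ A₁ A₂ a b, A = A₁ ∪ A₂ ∧ Split c E w A₁ A₂ a b P := by
  induction h with
  | single v => exact Or.inl ⟨v, rfl, .refl _⟩
  | perm P σ _ ih =>
    refine ih.imp (fun ⟨v, h1, h2⟩ => ⟨v, h1, h2.trans (P.equiv_perm σ)⟩) ?_
    rintro ⟨A₁, A₂, a, b, h, P₁, P₂, h1, h2, h3, h4, h5, h6, h7⟩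
    exact ⟨A₁, A₂, a, b, h, P₁, P₂, h1, h2, h3, h4, h5, h6,
      h7.congr (.refl _) (.refl _) (P.equiv_perm σ)⟩
  | @join A B P Q l i hi hl hP hQ hd he _ _ =>
    exact Or.inr ⟨A, B, _, _, rfl, P, Q, hP, hQ, hd, he, hP.mem_set _, hQ.mem_set _,
      Or.inl ⟨P, Q, l, i, hi, hl, .refl _, .refl _, rfl, rfl, .refl _⟩⟩

/-! ### Independence of the order of the compositions -/

namespace IsFlagTree
variable {E : Flag r → Flag r → Prop} (hE : IsFlagTree E) {c : Comp.{u, v} k W.X}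
  {w : ∀ v, W.X (r v)}
include hE

theorem split_symm {A B : Set V} {a b : Flag r} {P : Lab W (Flag r)}
    (h : Split c E w A B a b P) : Split c E w B A b a P := by
  obtain ⟨P₁, P₂, h1, h2, h3, h4, h5, h6, h7⟩ := h
  exact ⟨P₂, P₁, h2, h1, h3.symm, hE.symm _ _ h4, h6, h5, h7.symm⟩

/-- The compositions along two edges agree, where the parts are known to have unique values. -/
theorem split_unique_of_nested (hc : IsNonunitalCyclic W c) {A₁ B₁ A₂ B₂ : Set V}
    {a b a' b' : Flag r} {P P' : Lab W (Flag r)} (h : Split c E w A₁ B₁ a b P)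
    (h' : Split c E w A₂ B₂ a' b' P') (hA : A₁ ∪ B₁ = A₂ ∪ B₂)
    (ih : ∀ B, B ⊂ A₁ ∪ B₁ → ∀ Q Q', Val c E w B Q → Val c E w B Q' → Q.Equiv Q')
    (h1 : a'.1 ∈ B₁) (h2 : b'.1 ∈ B₁) (h3 : a.1 ∈ A₂) (h4 : b.1 ∈ A₂) : P.Equiv P' := by
  obtain ⟨P₁, Q₁, hP1, hQ1, hd1, he1, ha, hb, hj⟩ := h
  obtain ⟨P₂, Q₂, hP2, hQ2, hd2, he2, ha', hb', hj'⟩ := h'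
  have hd1' := Set.disjoint_left.1 hd1
  have hd2' := Set.disjoint_left.1 hd2
  -- Splitting B₁ along the second edge cuts the whole set into a chain A₁, Y, Z. The side K of the
  -- second edge then shows that Z = B₂ and A₁ ∪ Y = A₂.
  obtain ⟨Y, Z, R, Q₂', hY, hZ, hYZ, rfl, haY, hbZ⟩ := hE.exists_split hQ1 he2 h1 h2
  have hYZ' := Set.disjoint_left.1 hYZ
  obtain ⟨K, ha'K, hb'K, hK⟩ := hE.exists_side c w he2
  have kA2 : ∀ v ∈ A₂, v ∈ K := fun v hv =>
    (hK A₂ P₂ hP2 (Or.inr fun h => hd2' h hb') v hv _ ha').2 ha'K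
  have kB2 : ∀ v ∈ B₂, v ∉ K := fun v hv h =>
    hb'K ((hK B₂ Q₂ hQ2 (Or.inl (hd2' ha')) v hv _ hb').1 h)
  have kY : ∀ v ∈ Y, v ∈ K := fun v hv =>
    (hK Y R hY (Or.inr fun h => hYZ' h hbZ) v hv _ haY).2 ha'K
  have kZ : ∀ v ∈ Z, v ∉ K := fun v hv h =>
    hb'K ((hK Z Q₂' hZ (Or.inl (hYZ' haY)) v hv _ hbZ).1 h)
  -- A₁ does not contain the second edge, so it lies on one side, and its vertex a.1 lies in A₂.
  have kA1 : ∀ v ∈ A₁, v ∈ K := fun v hv =>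
    (hK A₁ P₁ hP1 (Or.inl fun h => hd1' h (Or.inl haY)) v hv _ ha).2 (kA2 _ h3)
  have hm : ∀ v, (v ∈ A₁ ∨ v ∈ Y ∨ v ∈ Z) ↔ (v ∈ A₂ ∨ v ∈ B₂) := fun v => Set.ext_iff.1 hA v
  obtain rfl : Z = B₂ := by
    ext v
    refine ⟨fun hv => ?_, fun hv => ?_⟩
    · exact ((hm v).1 (Or.inr (Or.inr hv))).resolve_left fun h => kZ v hv (kA2 v h)
    · exact (((hm v).2 (Or.inr hv)).resolve_left fun h => kB2 v hv (kA1 v h)).resolve_left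
        fun h => kB2 v hv (kY v h)
  obtain rfl : A₁ ∪ Y = A₂ := by
    ext v
    refine ⟨?_, fun hv => ?_⟩
    · rintro (hv | hv)
      · exact ((hm v).1 (Or.inl hv)).resolve_right fun h => kB2 v h (kA1 v hv)
      · exact ((hm v).1 (Or.inr (Or.inl hv))).resolve_right fun h => kB2 v h (kY v hv)
    · rcases (hm v).2 (Or.inl hv) with h | h | h
      · exact Or.inl h
      · exact Or.inr h
      · exact absurd (kA2 v hv) (kZ v h)
  have hbY : b.1 ∈ Y := hb.resolve_right fun h => kZ _ h (kA2 _ h4)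
  have hdY : Disjoint A₁ Y := hd1.mono_right Set.subset_union_left
  obtain ⟨U, hU, hU'⟩ := hE.exists_join hY hZ hYZ he2 haY hbZ
  obtain ⟨S, hS, hS'⟩ := hE.exists_join hP1 hY hdY he1 ha hbY
  have e1 : Q₁.Equiv U := ih _ (Set.ssubset_iff_subset_ne.2 ⟨Set.subset_union_right,
    fun h => hd1' ha (by rw [h]; exact Or.inl ha)⟩) _ _ hQ1 hU'
  have e2 : P₂.Equiv S := ih _ (Set.ssubset_iff_subset_ne.2 ⟨hA ▸ Set.subset_union_left,
    fun h => hd2' (h ▸ hA ▸ Or.inr hb') hb'⟩) _ _ hP2 hS'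
  have e3 : Q₂.Equiv Q₂' := ih _ (Set.ssubset_iff_subset_ne.2 ⟨hA ▸ Set.subset_union_right,
    fun h => hd2' ha' (by rw [h, hA]; exact Or.inl ha')⟩) _ _ hQ2 hZ
  -- P composes A₁ with the composite of Y and Z, and P' composes the composite of A₁ and Y with Z.
  -- The induction hypothesis identifies the inner values, and associativity does the rest.
  refine (hS.assoc hc (hE.lab_injective hP1) (hE.lab_injective hY) (hE.lab_injective hZ)
    (hE.not_mem_of_disjoint hP1 hY hdY) (hE.not_mem_of_disjoint hY hZ hYZ) ?_
    (hj'.congr e2 e3 (.refl _)) hU (hj.congr (.refl _) e1 (.refl _))).symm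
  -- The two flags at which Y is glued are different: if they agreed, the two edges would too, and
  -- a.1 would lie both in A₂ and in B₂.
  rintro rfl
  rw [hE.functional _ _ _ he2 (hE.symm _ _ he1)] at hb'
  exact hd2' h3 hb'

/-- Both partitions consist of the two sides of the same bridge, so they coincide, and the parts are
smaller sets. -/
theorem split_unique_of_edge_eq (hc : IsNonunitalCyclic W c) {A₁ B₁ A₂ B₂ : Set V}
    {a b : Flag r} {P P' : Lab W (Flag r)} (h : Split c E w A₁ B₁ a b P)
    (h' : Split c E w A₂ B₂ a b P') (hA : A₁ ∪ B₁ = A₂ ∪ B₂)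
    (ih : ∀ B, B ⊂ A₁ ∪ B₁ → ∀ Q Q', Val c E w B Q → Val c E w B Q' → Q.Equiv Q') :
    P.Equiv P' := by
  obtain ⟨P₁, Q₁, hP1, hQ1, hd1, he, ha, hb, hj⟩ := h
  obtain ⟨P₂, Q₂, hP2, hQ2, hd2, -, ha', hb', hj'⟩ := h'
  have hd1' := Set.disjoint_left.1 hd1
  have hd2' := Set.disjoint_left.1 hd2
  obtain ⟨K, haK, hbK, hK⟩ := hE.exists_side c w he
  have kA1 : ∀ v ∈ A₁, v ∈ K := fun v hv =>
    (hK A₁ P₁ hP1 (Or.inr fun h => hd1' h hb) v hv _ ha).2 haK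
  have kB1 : ∀ v ∈ B₁, v ∉ K := fun v hv h =>
    hbK ((hK B₁ Q₁ hQ1 (Or.inl (hd1' ha)) v hv _ hb).1 h)
  have kA2 : ∀ v ∈ A₂, v ∈ K := fun v hv =>
    (hK A₂ P₂ hP2 (Or.inr fun h => hd2' h hb') v hv _ ha').2 haK
  have kB2 : ∀ v ∈ B₂, v ∉ K := fun v hv h =>
    hbK ((hK B₂ Q₂ hQ2 (Or.inl (hd2' ha')) v hv _ hb').1 h)
  have hm : ∀ v, (v ∈ A₁ ∨ v ∈ B₁) ↔ (v ∈ A₂ ∨ v ∈ B₂) := fun v => Set.ext_iff.1 hA v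
  obtain rfl : A₁ = A₂ := by
    ext v
    exact ⟨fun hv => ((hm v).1 (Or.inl hv)).resolve_right fun h => kB2 v h (kA1 v hv),
      fun hv => ((hm v).2 (Or.inl hv)).resolve_right fun h => kB1 v h (kA2 v hv)⟩
  obtain rfl : B₁ = B₂ := by
    ext v
    exact ⟨fun hv => ((hm v).1 (Or.inr hv)).resolve_left fun h => kB1 v hv (kA2 v h),
      fun hv => ((hm v).2 (Or.inr hv)).resolve_left fun h => kB2 v hv (kA1 v h)⟩
  have e1 : P₁.Equiv P₂ := ih _ (Set.ssubset_iff_subset_ne.2 ⟨Set.subset_union_left,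
    fun h => hd1' (h ▸ Or.inr hb) hb⟩) _ _ hP1 hP2
  have e2 : Q₁.Equiv Q₂ := ih _ (Set.ssubset_iff_subset_ne.2 ⟨Set.subset_union_right,
    fun h => hd1' ha (h ▸ Or.inl ha)⟩) _ _ hQ1 hQ2
  exact (hj.congr e1 e2 (.refl _)).unique hc (hE.lab_injective hP2) (hE.lab_injective hQ2) hj'

/-- The value of a connected set of vertices does not depend on the order of the compositions. -/
theorem val_unique [Finite V] (hc : IsNonunitalCyclic W c) (A : Set V) :
    ∀ P P' : Lab W (Flag r), Val c E w A P → Val c E w A P' → P.Equiv P' := by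
  induction A using WellFoundedLT.induction with
  | ind A ih =>
    intro P P' hP hP'
    -- A split needs two disjoint non-empty parts.
    have hsingle : ∀ v A₁ A₂ a b P, A = {v} → A = A₁ ∪ A₂ → ¬ Split c E w A₁ A₂ a b P := by
      rintro v A₁ A₂ a b P rfl h ⟨P₁, P₂, -, -, h3, -, h5, h6, -⟩
      have h7 : a.1 ∈ ({v} : Set V) := h ▸ Or.inl h5
      have h8 : b.1 ∈ ({v} : Set V) := h ▸ Or.inr h6
      rw [Set.mem_singleton_iff] at h7 h8
      exact Set.disjoint_left.1 h3 h5 (h7.trans h8.symm ▸ h6)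
    rcases hP.single_or_split with ⟨v, hv, h1⟩ | ⟨A₁, B₁, a, b, hA, hs⟩
    · rcases hP'.single_or_split with ⟨v', hv', h1'⟩ | ⟨A₂, B₂, a', b', hA', hs'⟩
      · obtain rfl : v = v' := Set.singleton_injective (hv.symm.trans hv')
        exact h1.symm.trans h1'
      · exact absurd hs' (hsingle _ _ _ _ _ _ hv hA')
    · rcases hP'.single_or_split with ⟨v', hv', h1'⟩ | ⟨A₂, B₂, a', b', hA', hs'⟩
      · exact absurd hs (hsingle _ _ _ _ _ _ hv' hA)
      subst hA
      -- the ends of the second edge lie in `B₁`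
      have key : ∀ A₁' B₁' a b, Split c E w A₁' B₁' a b P → A₁ ∪ B₁ = A₁' ∪ B₁' → a'.1 ∈ B₁' →
          b'.1 ∈ B₁' → P.Equiv P' := by
        intro A₁' B₁' a b hs hAA h1 h2
        have ih' := ih
        rw [hAA] at ih' hA'
        have hs2 := hs
        have hs2' := hs'
        obtain ⟨P₁, Q₁, hP1, hQ1, hd1, he1, ha, hb, -⟩ := hs2
        obtain ⟨P₂, Q₂, hP2, hQ2, hd2, he2, ha', hb', -⟩ := hs2'
        have h3 : a.1 ∈ A₂ ∪ B₂ := hA' ▸ Or.inl ha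
        have h4 : b.1 ∈ A₂ ∪ B₂ := hA' ▸ Or.inr hb
        -- The first edge cannot cross from A₂ to B₂: it would be the second edge, whose ends both
        -- lie in B₁', whereas a.1 lies in A₁'. So it lies in one part, as the nested case requires.
        rcases h3 with h3 | h3 <;> rcases h4 with h4 | h4
        · exact hE.split_unique_of_nested hc hs hs' hA' ih' h1 h2 h3 h4
        · obtain ⟨rfl, rfl⟩ := hE.cross_unique hP2 hQ2 hd2 he2 he1 ha' hb' h3 h4
          exact absurd h1 (Set.disjoint_left.1 hd1 ha)
        · obtain ⟨rfl, rfl⟩ := hE.cross_unique hP2 hQ2 hd2 he2 (hE.symm _ _ he1) ha' hb' h4 h3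
          exact absurd h2 (Set.disjoint_left.1 hd1 ha)
        · exact hE.split_unique_of_nested hc hs (hE.split_symm hs')
            (hA'.trans (Set.union_comm _ _)) ih' h2 h1 h3 h4
      have hs2 := hs
      have hs2' := hs'
      obtain ⟨P₁, Q₁, hP1, hQ1, hd1, he1, ha, hb, -⟩ := hs2
      obtain ⟨P₂, Q₂, hP2, hQ2, hd2, he2, ha', hb', -⟩ := hs2'
      have h3 : a'.1 ∈ A₁ ∪ B₁ := hA' ▸ Or.inl ha'
      have h4 : b'.1 ∈ A₁ ∪ B₁ := hA' ▸ Or.inr hb'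
      -- The second edge either lies in one of the parts A₁, B₁ or crosses between them, and then it
      -- is the first edge, possibly with its ends exchanged.
      rcases h3 with h3 | h3 <;> rcases h4 with h4 | h4
      · exact key _ _ _ _ (hE.split_symm hs) (Set.union_comm _ _) h3 h4
      · obtain ⟨rfl, rfl⟩ := hE.cross_unique hP1 hQ1 hd1 he1 he2 ha hb h3 h4
        exact hE.split_unique_of_edge_eq hc hs hs' hA' ih
      · obtain ⟨rfl, rfl⟩ := hE.cross_unique hP1 hQ1 hd1 he1 (hE.symm _ _ he2) ha hb h4 h3
        exact hE.split_unique_of_edge_eq hc hs (hE.split_symm hs')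
          (hA'.trans (Set.union_comm _ _)) ih
      · exact key _ _ _ _ hs rfl h3 h4

end IsFlagTree
end Val

/-! ### The edges of a tree between its vertices -/

namespace CTree
variable {V : Type} [Fintype V] {r : V → ℕ} {n : ℕ}

theorem edge_unique (T : CTree V r n) {x y z : Ends V r n} (h : T.edge x y) (h' : T.edge x z) :
    y = z := (T.existsUnique x).unique h h'

/-- A numbering of the ends selects from every edge the end with the smaller number, and `opp`
exchanges the selected ends with the others. -/
theorem two_mul_card_half (T : CTree V r n) :
    ∃ p : Ends V r n → Prop, (∀ x, p (T.opp x) ↔ ¬ p x) ∧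
      2 * Nat.card {x // p x} = Fintype.card (Ends V r n) := by
  classical
  let ι := Fintype.equivFin (Ends V r n)
  let p : Ends V r n → Prop := fun x => ι x < ι (T.opp x)
  have hp : ∀ x, p (T.opp x) ↔ ¬ p x := by
    intro x
    have h : ι (T.opp x) ≠ ι x := fun h => T.opp_ne x (ι.injective h)
    simp only [p, opp_opp]
    omega
  refine ⟨p, hp, ?_⟩
  have e : {x // p x} ≃ {x // ¬ p x} :=
    { toFun := fun x => ⟨T.opp x, fun h => (hp _).1 h x.2⟩
      invFun := fun x => ⟨T.opp x, (hp _).2 x.2⟩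
      left_inv := fun x => Subtype.ext (T.opp_opp _)
      right_inv := fun x => Subtype.ext (T.opp_opp _) }
  have h1 := Fintype.card_subtype_compl p
  rw [← Fintype.card_congr e] at h1
  have h2 := Fintype.card_subtype_le p
  rw [Nat.card_eq_fintype_card]
  omega

/-- Linear algebra replaces the removal of an edge. A tree has one edge fewer than points, so some
non-zero function on the points vanishes at one end of the given edge and is constant along all
other edges. Its zero set is one side. -/
theorem exists_bridge (T : CTree V r n) {x y : Ends V r n} (h : T.edge x y) :
    ∃ K : Set (V ⊕ Fin (n + 1)), x.node ∈ K ∧ y.node ∉ K ∧ ∀ x' y', T.edge x' y' →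
      (x' = x ∧ y' = y) ∨ (x' = y ∧ y' = x) ∨ (x'.node ∈ K ↔ y'.node ∈ K) := by
  classical
  obtain ⟨p, hp, hcard⟩ := T.two_mul_card_half
  -- There is one equation for each edge, indexed by its selected end: equal values at its two
  -- points, except that the edge from x to y imposes vanishing at the point of x.
  let L : (V ⊕ Fin (n + 1) → ℚ) →ₗ[ℚ] ({z // p z} → ℚ) :=
    LinearMap.pi fun z => if z.1 = x ∨ z.1 = y then .proj x.node
      else .proj z.1.node - .proj (T.opp z.1).node
  -- The condition `card` says exactly that there is one equation fewer than there are unknowns.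
  have hL : LinearMap.ker L ≠ ⊥ := by
    apply LinearMap.ker_ne_bot_of_finrank_lt
    rw [Module.finrank_fintype_fun_eq_card, Module.finrank_fintype_fun_eq_card,
      ← Nat.card_eq_fintype_card]
    have := T.card
    omega
  obtain ⟨f, hf, hf0⟩ := Submodule.exists_mem_ne_zero_of_ne_bot hL
  have hf' : ∀ z : {z // p z}, L f z = 0 := fun z => congrFun hf z
  have hopp : T.opp x = y := (T.edge_iff _ _).1 h
  have hopp' : T.opp y = x := by rw [← hopp, opp_opp]
  have hx : f x.node = 0 := by
    by_cases hpx : p x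
    · simpa [L] using hf' ⟨x, hpx⟩
    · rw [← hp, hopp] at hpx
      simpa [L] using hf' ⟨y, hpx⟩
  have hne : ∀ z, z ≠ x → z ≠ y → f z.node = f (T.opp z).node := by
    intro z h1 h2
    by_cases hpz : p z
    · have := hf' ⟨z, hpz⟩
      simp only [L, LinearMap.pi_apply, h1, h2, or_self, if_false, LinearMap.sub_apply,
        LinearMap.proj_apply] at this
      exact sub_eq_zero.1 this
    · rw [← hp] at hpz
      have h3 : T.opp z ≠ x := fun h => h2 (by rw [← T.opp_opp z, h, hopp])
      have h4 : T.opp z ≠ y := fun h => h1 (by rw [← T.opp_opp z, h, hopp'])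
      have := hf' ⟨_, hpz⟩
      simp only [L, LinearMap.pi_apply, h3, h4, or_self, if_false, LinearMap.sub_apply,
        LinearMap.proj_apply, opp_opp] at this
      exact (sub_eq_zero.1 this).symm
  -- If f vanished at the point of y too, its zero set would be closed under all edges, and
  -- connectedness would give f = 0.
  refine ⟨{a | f a = 0}, hx, fun hy => hf0 ?_, fun x' y' h' => ?_⟩
  · have hy : f y.node = 0 := hy
    funext a
    refine T.connected (fun a => f a = 0) (fun x' y' h' hx' => ?_) x.node a hx
    have e := (T.edge_iff _ _).1 h'
    by_cases h1 : x' = x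
    · rw [← e, h1, hopp]; exact hy
    by_cases h2 : x' = y
    · rw [← e, h2, hopp']; exact hx
    rw [← e, ← hne x' h1 h2]
    exact hx'
  · have e := (T.edge_iff _ _).1 h'
    by_cases h1 : x' = x
    · exact Or.inl ⟨h1, by rw [← e, h1, hopp]⟩
    by_cases h2 : x' = y
    · exact Or.inr (Or.inl ⟨h2, by rw [← e, h2, hopp']⟩)
    · refine Or.inr (Or.inr ?_)
      rw [← e, Set.mem_ofPred_eq, Set.mem_ofPred_eq, hne x' h1 h2]

/-- The edges between the vertices. -/
def flagEdge (T : CTree V r n) (f g : Flag r) : Prop := T.edge (.inl f) (.inl g)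

/-- Were a leg joined to another leg, their two free ends would be closed under the edges, and no
vertex could be reached from them. -/
theorem exists_flag [Nonempty V] (T : CTree V r n) (j : Fin (n + 1)) :
    ∃ f, T.edge (.inr j) (.inl f) := by
  have h := T.edge_opp (.inr j)
  rcases hx : T.opp (.inr j) with f | j'
  · exact ⟨f, hx ▸ h⟩
  rw [hx] at h
  have := T.connected (fun a => a = .inr j ∨ a = .inr j') (fun x y hxy hx' => ?_) (.inr j)
    (.inl (Classical.arbitrary V)) (Or.inl rfl)
  · simp at this
  · rcases x with f | i
    · rcases hx' with h1 | h1 <;> exact absurd h1 (by simp [Ends.node])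
    · rcases hx' with h1 | h1
      · obtain rfl : i = j := by simpa [Ends.node] using h1
        rw [← T.edge_unique h hxy]
        exact Or.inr rfl
      · obtain rfl : i = j' := by simpa [Ends.node] using h1
        rw [← T.edge_unique (T.symm _ _ h) hxy]
        exact Or.inl rfl

theorem isFlagTree (T : CTree V r n) [Nonempty V] : IsFlagTree T.flagEdge where
  symm _ _ h := T.symm _ _ h
  functional _ _ _ h h' := Sum.inl_injective (T.edge_unique h h')
  bridge f g h := by
    obtain ⟨K, h1, h2, h3⟩ := T.exists_bridge h
    refine ⟨{v : V | (Sum.inl v : V ⊕ Fin (n + 1)) ∈ K}, h1, h2, fun f' g' h' => ?_⟩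
    rcases h3 _ _ h' with ⟨h4, h5⟩ | ⟨h4, h5⟩ | h4
    · exact Or.inl ⟨Sum.inl_injective h4, Sum.inl_injective h5⟩
    · exact Or.inr (Or.inl ⟨Sum.inl_injective h4, Sum.inl_injective h5⟩)
    · exact Or.inr (Or.inr h4)
  -- If all flags at A were joined inside A, then A would be closed under all edges, and the free
  -- end of the leg 0, which always exists, would not be reached.
  boundary A hA := by
    obtain ⟨v, hv⟩ := hA
    by_contra hne
    have hne' : ∀ f : Flag r, f.1 ∈ A → ∃ g, T.flagEdge f g ∧ g.1 ∈ A := by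
      intro f hf
      by_contra h
      push Not at h
      exact hne ⟨f, hf, h⟩
    have := T.connected (fun a => ∃ v ∈ A, a = .inl v) (fun x y hxy => ?_) (.inl v)
      (.inr 0) ⟨v, hv, rfl⟩
    · simp at this
    · rintro ⟨u, hu, hxu⟩
      rcases x with f | j
      · obtain rfl : f.1 = u := by simpa [Ends.node] using hxu
        obtain ⟨g, hg, hg'⟩ := hne' f hu
        rw [T.edge_unique hxy hg]
        exact ⟨g.1, hg', rfl⟩
      · simp [Ends.node] at hxu
  connected A hA hcl := by
    obtain ⟨v, hv⟩ := hA
    -- Connectedness of the tree also concerns the free ends of the legs, so each of them is counted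
    -- with the vertex to which its leg is attached.
    let P : V ⊕ Fin (n + 1) → Prop :=
      Sum.elim (fun v => v ∈ A) (fun j => ∃ f, T.edge (.inr j) (.inl f) ∧ f.1 ∈ A)
    refine Set.eq_univ_of_forall fun u => T.connected P (fun x y hxy hx => ?_) (.inl v) (.inl u) hv
    rcases x with f | j <;> rcases y with g | i
    · exact hcl f g hxy hx
    · exact ⟨f, T.symm _ _ hxy, hx⟩
    · obtain ⟨f, hf, hf'⟩ := hx
      obtain rfl : g = f := Sum.inl_injective (T.edge_unique hxy hf)
      exact hf'
    · obtain ⟨f, hf, hf'⟩ := hx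
      have := T.edge_unique hxy hf
      simp at this

/-- The labels of the slots of the value of the tree: the flags to which the legs belong. -/
def IsLegs (T : CTree V r n) (φ : Fin (n + 1) → Flag r) : Prop :=
  ∀ j, T.edge (.inr j) (.inl (φ j))

theorem IsLegs.unique {T : CTree V r n} {φ ψ : Fin (n + 1) → Flag r} (h : T.IsLegs φ)
    (h' : T.IsLegs ψ) : φ = ψ :=
  funext fun j => Sum.inl_injective (T.edge_unique (h j) (h' j))

theorem exists_isLegs [Nonempty V] (T : CTree V r n) : ∃ φ, T.IsLegs φ :=
  Classical.skolem.1 T.exists_flag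

theorem IsLegs.injective {T : CTree V r n} {φ : Fin (n + 1) → Flag r} (h : T.IsLegs φ) :
    φ.Injective := by
  intro i j hij
  have h1 := T.symm _ _ (h i)
  have h2 := T.symm _ _ (h j)
  rw [hij] at h1
  exact Sum.inr_injective (T.edge_unique h1 h2)

theorem IsLegs.mem_bdry_iff {T : CTree V r n} {φ : Fin (n + 1) → Flag r} (h : T.IsLegs φ)
    (f : Flag r) : f ∈ bdry T.flagEdge Set.univ ↔ ∃ j, φ j = f := by
  constructor
  · rintro ⟨-, hf⟩
    have h1 := T.edge_opp (.inl f)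
    rcases hx : T.opp (.inl f) with g | j
    · rw [hx] at h1
      exact absurd trivial (hf g h1)
    · rw [hx] at h1
      exact ⟨j, Sum.inl_injective (T.edge_unique (h j) (T.symm _ _ h1))⟩
  · rintro ⟨j, rfl⟩
    refine ⟨trivial, fun g hg => ?_⟩
    have := T.edge_unique (T.symm _ _ (h j)) hg
    simp at this

theorem eq_one_of_isEmpty [IsEmpty V] (T : CTree V r n) : n = 1 := by
  have := T.card
  simp at this
  omega

end CTree

/-! ### The value of a decorated tree -/

section eval
variable {k : Type u} [CommRing k] {W : CycMod.{u, v} k} {V : Type} [Fintype V] {r : V → ℕ}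
  {n : ℕ} {c : Comp.{u, v} k W.X}

/-- The labels of a value of the whole tree are the boundary flags, and these are the flags of the
legs, so the slots can be renumbered as the legs are. -/
theorem CTree.exists_val [Nonempty V] (T : CTree V r n) (c : Comp.{u, v} k W.X)
    (w : ∀ v, W.X (r v)) {φ : Fin (n + 1) → Flag r} (hφ : T.IsLegs φ) :
    ∃ x, Val c T.flagEdge w Set.univ ⟨n, φ, x⟩ := by
  obtain ⟨P, hP⟩ := T.isFlagTree.exists_val c w
  obtain ⟨hinj, hmem⟩ := T.isFlagTree.lab_injective_and_mem_iff hP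
  have h1 : ∀ f, f ∈ Set.range φ ↔ f ∈ Set.range P.lab := fun f =>
    (hφ.mem_bdry_iff f).symm.trans (hmem f).symm
  let σ : Fin (n + 1) ≃ Fin (P.n + 1) := (Equiv.ofInjective φ hφ.injective).trans
    ((Equiv.setCongr (Set.ext h1)).trans (Equiv.ofInjective P.lab hinj).symm)
  have hσ : P.lab ∘ σ = φ := by
    funext j
    exact Equiv.apply_ofInjective_symm hinj (Equiv.setCongr (Set.ext h1) ⟨φ j, j, rfl⟩)
  refine ⟨W.tr σ P.val, ?_⟩
  have := hP.perm P σ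
  rwa [Lab.perm, hσ] at this

theorem CTree.val_unique (T : CTree V r n) (hc : IsNonunitalCyclic W c) {w : ∀ v, W.X (r v)}
    {φ : Fin (n + 1) → Flag r} (hφ : T.IsLegs φ) {x y : W.X n}
    (hx : Val c T.flagEdge w Set.univ ⟨n, φ, x⟩) (hy : Val c T.flagEdge w Set.univ ⟨n, φ, y⟩) :
    x = y := by
  have : Nonempty V := ⟨(φ 0).1⟩
  exact (T.isFlagTree.val_unique hc _ _ _ hx hy).eq_of_lab_eq hφ.injective

/-- The element `x` is the value of the decorated tree. The value of the exceptional tree is `e`. -/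
def CTree.Evals (c : Comp.{u, v} k W.X) (e : W.X 1) (T : CTree V r n) (w : ∀ v, W.X (r v))
    (x : W.X n) : Prop :=
  (∃ φ, T.IsLegs φ ∧ Val c T.flagEdge w Set.univ ⟨n, φ, x⟩) ∨
    IsEmpty V ∧ ∃ σ : Fin (n + 1) ≃ Fin 2, x = W.tr σ e

/-- The compositions `c` are those of a cyclic operad, with the unit `e` if `ext` holds. -/
structure IsCyclicOperad (ext : Prop) (W : CycMod.{u, v} k) (c : Comp.{u, v} k W.X) (e : W.X 1) :
    Prop where
  cyclic : IsNonunitalCyclic W c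
  unit : ext → IsOperadicUnit W.res c e
  invariant : ext → ∀ σ, W.act 1 σ e = e

theorem tr_unit {e : W.X 1} (he : ∀ σ, W.act 1 σ e = e) (σ τ : Fin (n + 1) ≃ Fin 2) :
    W.tr σ e = W.tr τ e := by
  obtain rfl : n = 1 := Nat.succ_injective (Fin.equiv_iff_eq.1 ⟨σ⟩)
  exact (he σ).trans (he τ).symm

theorem CTree.exists_evals (c : Comp.{u, v} k W.X) (e : W.X 1) (T : CTree V r n)
    (w : ∀ v, W.X (r v)) : ∃ x, T.Evals c e w x := by
  rcases isEmpty_or_nonempty V with hV | hV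
  · obtain rfl := T.eq_one_of_isEmpty
    exact ⟨_, Or.inr ⟨hV, .refl _, rfl⟩⟩
  · obtain ⟨φ, hφ⟩ := T.exists_isLegs
    obtain ⟨x, hx⟩ := T.exists_val c w hφ
    exact ⟨x, Or.inl ⟨φ, hφ, hx⟩⟩

theorem CTree.Evals.unique {ext : Prop} {e : W.X 1} (hc : IsCyclicOperad ext W c e)
    (hV : ext ∨ Nonempty V) {T : CTree V r n} {w : ∀ v, W.X (r v)} {x y : W.X n}
    (hx : T.Evals c e w x) (hy : T.Evals c e w y) : x = y := by
  rcases hx with ⟨φ, hφ, hx⟩ | ⟨hE, σ, rfl⟩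
  · rcases hy with ⟨ψ, hψ, hy⟩ | ⟨hE, -⟩
    · obtain rfl := hφ.unique hψ
      exact T.val_unique hc.cyclic hφ hx hy
    · exact hE.elim (φ 0).1
  · rcases hy with ⟨ψ, hψ, hy⟩ | ⟨-, τ, rfl⟩
    · exact hE.elim (ψ 0).1
    · exact tr_unit (hc.invariant (hV.resolve_right fun ⟨v⟩ => hE.elim v)) σ τ

end eval

/-! ### Transport of values -/

section transport
variable {k : Type u} [CommRing k] {W : CycMod.{u, v} k} {V V' : Type} {r : V → ℕ} {r' : V' → ℕ}
  {c : Comp.{u, v} k W.X} {e : W.X 1} {E : Flag r → Flag r → Prop} {w : ∀ v, W.X (r v)}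
  {E' : Flag r' → Flag r' → Prop} {w' : ∀ v, W.X (r' v)} {K : Type}

/-- The label side of the unit law: a two-slot element both of whose slots have the label of the
slot it is glued to leaves the labels unchanged. -/
theorem joinLab_const_right {m l i : ℕ} (hi : 1 ≤ i ∧ i ≤ m) (hl : l + 1 = m + 1)
    (φ : Fin (m + 1) → K) (χ : Fin 2 → K) (hχ : ∀ i j, χ i = χ j)
    (h : φ ⟨i, Nat.lt_succ_of_le hi.2⟩ = χ 0) (t : Fin (l + 1)) :
    joinLab hi hl φ χ t = φ ⟨t, by omega⟩ := by
  rw [joinLab_apply]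
  split_ifs with h1 h2
  · rfl
  · rw [hχ _ 0, ← h]
    exact congrArg φ (Fin.ext (by simp only; omega))
  · rfl

theorem joinLab_const_left {n l : ℕ} (hi : 1 ≤ 1 ∧ 1 ≤ 1) (hl : l + 1 = 1 + n)
    (χ : Fin 2 → K) (φ : Fin (n + 1) → K) (hχ : ∀ i j, χ i = χ j) (h : χ 1 = φ 0)
    (t : Fin (l + 1)) : joinLab hi hl χ φ t = φ ⟨t, by omega⟩ := by
  rw [joinLab_apply]
  split_ifs with h1 h2
  · rw [hχ _ 1, h]
    exact congrArg φ (Fin.ext (by simp only [Fin.val_zero]; omega))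
  · rfl
  · omega

/-- The element `P`, with labels in `K`, is the value of the set `A` of vertices, if this set is
not empty, or else the unit. -/
def Carried (c : Comp.{u, v} k W.X) (e : W.X 1) (E' : Flag r' → Flag r' → Prop)
    (w' : ∀ v, W.X (r' v)) (κ : Flag r' → K) (A : Set V') (P : Lab W K) : Prop :=
  (∃ ψ, Val c E' w' A ⟨P.n, ψ, P.val⟩ ∧ κ ∘ ψ = P.lab) ∨
    (A = ∅ ∧ (IsOperadicUnit W.res c e ∧ ∀ σ, W.act 1 σ e = e) ∧
      (∃ σ : Fin (P.n + 1) ≃ Fin 2, P.val = W.tr σ e) ∧ ∀ i j, P.lab i = P.lab j)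

theorem Carried.perm {κ : Flag r' → K} {A : Set V'} {P : Lab W K}
    (h : Carried c e E' w' κ A P) {n' : ℕ} (σ : Fin (n' + 1) ≃ Fin (P.n + 1)) :
    Carried c e E' w' κ A (P.perm σ) := by
  rcases h with ⟨ψ, h1, h2⟩ | ⟨h1, h2, ⟨τ, h3⟩, h4⟩
  · exact Or.inl ⟨ψ ∘ σ, h1.perm ⟨P.n, ψ, P.val⟩ σ, congrArg (· ∘ σ) h2⟩
  · refine Or.inr ⟨h1, h2, ⟨σ.trans τ, ?_⟩, fun i j => h4 _ _⟩
    exact (congrArg (W.tr σ) h3).trans (W.tr_trans σ τ e).symm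

/-- If both elements are values of vertices, equal labels of different flags mean an edge, and this
is a composition of values. If one of them is the unit, the unit laws return the other element, with
the same labels. -/
theorem Carried.join {κ : Flag r' → K} {A B : Set V'} {P Q : Lab W K}
    (hE' : ∀ f g, f ≠ g → κ f = κ g → E' f g)
    (hP : Carried c e E' w' κ A P) (hQ : Carried c e E' w' κ B Q) (hd : Disjoint A B) {l i : ℕ}
    (hi : 1 ≤ i ∧ i ≤ P.n) (hl : l + 1 = P.n + Q.n)
    (h : P.lab ⟨i, Nat.lt_succ_of_le hi.2⟩ = Q.lab 0) :
    Carried c e E' w' κ (A ∪ B) (Lab.join c P Q hi hl) := by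
  obtain ⟨m, φ, x⟩ := P
  obtain ⟨n, χ, y⟩ := Q
  dsimp only at hi hl h
  rcases hP with ⟨ψ, h1, h2⟩ | ⟨rfl, ⟨hu, hinv⟩, ⟨σ, h3⟩, h4⟩
  · rcases hQ with ⟨ψ', h1', h2'⟩ | ⟨rfl, ⟨hu, hinv⟩, ⟨σ, h3⟩, h4⟩
    · dsimp only at h1 h2 h1' h2'
      refine Or.inl ⟨_, h1.join ⟨m, ψ, x⟩ ⟨n, ψ', y⟩ hi hl h1' hd (hE' _ _ (fun hf => ?_) ?_),
        (joinLab_comp _ _ _ _ _).trans (by rw [h2, h2']; rfl)⟩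
      swap
      · exact (congrFun h2 _).trans (h.trans (congrFun h2' 0).symm)
      have h3 := h1'.mem_set 0
      dsimp only at hf h3
      rw [← hf] at h3
      exact Set.disjoint_left.1 hd (h1.mem_set ⟨i, Nat.lt_succ_of_le hi.2⟩) h3
    · dsimp only at h1 h2 h3 h4
      obtain rfl : n = 1 := Nat.succ_injective (Fin.equiv_iff_eq.1 ⟨σ⟩)
      have hy : y = e := h3.trans (hinv σ)
      obtain rfl : m = l := by omega
      refine Or.inl ⟨ψ, ?_, h2.trans ?_⟩
      · rw [Set.union_empty]
        simp only [Lab.join]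
        rw [show c m 1 m i hi hl x y = x from hy ▸ hu.comp_unit m i hi x]
        exact h1
      · funext t
        exact (joinLab_const_right hi hl _ χ h4 h t).symm
  · dsimp only at h3 h4
    obtain rfl : m = 1 := Nat.succ_injective (Fin.equiv_iff_eq.1 ⟨σ⟩)
    have hx : x = e := h3.trans (hinv σ)
    obtain rfl : n = l := by omega
    obtain rfl : i = 1 := by omega
    replace hx : c 1 n n 1 hi hl x y = y := hx ▸ hu.unit_comp n y
    have hlab : joinLab hi hl φ χ = χ := by
      funext t
      exact joinLab_const_left hi hl φ χ h4 h t
    have e : Lab.join c ⟨1, φ, x⟩ ⟨n, χ, y⟩ hi hl = ⟨n, χ, y⟩ := by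
      simp only [Lab.join, hx, hlab]
    rw [e, Set.empty_union]
    exact hQ

/-- An iterated composition is carried to another graph in which the vertex v is replaced by the set
A' v with the same value. The graphs are compared through labels in K: flags joined by E get the
same label, and different flags of the new graph with the same label must be joined by E'. This
serves isomorphisms, where each A' v is a single vertex, and substitution, where it may also be
empty. -/
theorem Val.transport (κ : Flag r → K) (κ' : Flag r' → K) (A' : V → Set V')
    (hE : ∀ f g, E f g → κ f = κ g) (hE' : ∀ f g, f ≠ g → κ' f = κ' g → E' f g)
    (hd : ∀ u v, u ≠ v → Disjoint (A' u) (A' v))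
    (hv : ∀ v, Carried c e E' w' κ' (A' v) ⟨r v, fun j => κ ⟨v, j⟩, w v⟩)
    {A : Set V} {P : Lab W (Flag r)} (h : Val c E w A P) :
    Carried c e E' w' κ' (⋃ v ∈ A, A' v) ⟨P.n, κ ∘ P.lab, P.val⟩ := by
  induction h with
  | single v =>
    have := hv v
    simp only [Set.mem_singleton_iff, Set.iUnion_iUnion_eq_left]
    exact this
  | perm P σ _ ih => exact ih.perm σ
  | @join A B P Q l i hi hl hP hQ hAB he ih ih' =>
    rw [Set.biUnion_union]
    have := Carried.join hE' ih ih' ?_ hi hl (hE _ _ he)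
    · simp only [Lab.join] at this ⊢
      rwa [joinLab_comp]
    · simp only [Set.disjoint_iUnion_left, Set.disjoint_iUnion_right]
      intro u hu v hv
      exact hd _ _ fun h => Set.disjoint_left.1 hAB (h ▸ hv) hu

end transport

/-! ### Invariance of the value of a tree -/

section invariance
variable {k : Type u} [CommRing k] {W W' : CycMod.{u, v} k} {V V' : Type} [Fintype V]
  [Fintype V'] {r : V → ℕ} {r' : V' → ℕ} {n n' : ℕ} {c : Comp.{u, v} k W.X} {e : W.X 1}

theorem CTree.eqvGen_edge_iff (T : CTree V r n) (x y : Ends V r n) :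
    Relation.EqvGen T.edge x y ↔ x = y ∨ T.edge x y := by
  constructor
  · intro h
    induction h with
    | rel x y h => exact Or.inr h
    | refl x => exact Or.inl rfl
    | symm x y _ ih => exact ih.imp Eq.symm (T.symm _ _)
    | trans x y z _ _ ih ih' =>
      rcases ih with rfl | ih
      · exact ih'
      · rcases ih' with rfl | ih'
        · exact Or.inr ih
        · exact Or.inl (T.edge_unique (T.symm _ _ ih) ih')
  · rintro (rfl | h)
    · exact .refl _
    · exact .rel _ _ h

/-- The value is compatible with isomorphisms of trees and with relabeling the legs. -/
theorem CTree.Evals.iso {T : CTree V r n} {w : ∀ v, W.X (r v)} {x : W.X n}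
    (h : T.Evals c e w x) (T' : CTree V' r' n') (w' : ∀ v, W.X (r' v)) (ε : V' ≃ V)
    (φ : ∀ v, Fin (r' v + 1) ≃ Fin (r (ε v) + 1)) (l : Fin (n' + 1) ≃ Fin (n + 1))
    (hT : ∀ x y, T'.edge x y ↔ T.edge (CTree.Ends.map ε φ l x) (CTree.Ends.map ε φ l y))
    (hw : ∀ v, w' v = W.tr (φ v) (w (ε v))) : T'.Evals c e w' (W.tr l x) := by
  rcases h with ⟨χ, hχ, hx⟩ | ⟨hV, σ, rfl⟩
  -- The labels are the edges of T: two ends get the same label if and only if they are equal or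
  -- joined.
  · have hK : ∀ x y, Relation.EqvGen T.edge x y ↔ Quot.mk T.edge x = Quot.mk T.edge y :=
      fun x y => Quot.eq.symm
    have := hx.transport (c := c) (e := e) (w' := w') (E' := T'.flagEdge) (r' := r')
      (fun f => Quot.mk T.edge (.inl f))
      (fun f => Quot.mk T.edge (CTree.Ends.map ε φ l (.inl f))) (fun v => {ε.symm v})
      (fun f g h => Quot.sound h) ?_ ?_ ?_
    · rcases this with ⟨ψ, h1, h2⟩ | ⟨h1, -⟩
      · refine Or.inl ⟨ψ ∘ l, fun j => ?_, ?_⟩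
        · rw [hT]
          have h3 := congrFun h2 (l j)
          simp only [Function.comp] at h3
          rw [← hK, T.eqvGen_edge_iff] at h3
          -- The flags have the same label, so they are equal or joined; but the flag of a leg is
          -- joined to that leg and not to a flag.
          rcases h3 with h3 | h3
          · exact h3 ▸ hχ (l j)
          · have := T.edge_unique (T.symm _ _ h3) (T.symm _ _ (hχ (l j)))
            simp [CTree.Ends.map_inl] at this
        · have h3 : ⋃ v ∈ Set.univ, ({ε.symm v} : Set V') = Set.univ := by
            ext v
            simp only [Set.mem_univ, Set.iUnion_true, Set.mem_iUnion, Set.mem_singleton_iff, iff_true]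
            exact ⟨ε v, (ε.symm_apply_apply v).symm⟩
          rw [h3] at h1
          exact h1.perm _ l
      · exfalso
        have : ε.symm (χ 0).1 ∈ (∅ : Set V') := h1 ▸ by simp
        exact this
    · intro f g hne hfg
      rw [← hK, T.eqvGen_edge_iff] at hfg
      rcases hfg with hfg | hfg
      · exact absurd (Sum.inl_injective ((CTree.Ends.map ε φ l).injective hfg)) hne
      · exact (hT _ _).2 hfg
    · intro u v huv
      simpa using huv
    · intro v
      obtain ⟨v, rfl⟩ := ε.surjective v
      refine Or.inl ⟨fun j => ⟨v, (φ v).symm j⟩, ?_, ?_⟩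
      · have := (Val.single (c := c) (E := T'.flagEdge) (w := w') v).perm _ (φ v).symm
        rw [ε.symm_apply_apply]
        refine Eq.mp (congrArg _ ?_) this
        simp only [Lab.perm, hw, ← W.tr_trans, Equiv.symm_trans_self, W.tr_refl]
        rfl
      · funext j
        simp [CTree.Ends.map_inl]
  · exact Or.inr ⟨ε.isEmpty, l.trans σ, (W.tr_trans _ _ _).symm⟩

/-- The value of a tree that arises by substitution. -/
theorem CTree.Evals.subst {T : CTree V r n} {w : ∀ v, W.X (r v)} {x : W.X n}
    (h : T.Evals c e w x) {U : V → Type} [∀ v, Fintype (U v)] {s : ∀ v, U v → ℕ}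
    {S : ∀ v, CTree (U v) (s v) (r v)} {y : ∀ v u, W.X (s v u)}
    (hS : ∀ v, (S v).Evals c e (y v) (w v))
    (he : (∃ v, IsEmpty (U v)) → IsOperadicUnit W.res c e ∧ ∀ σ, W.act 1 σ e = e) :
    (T.subst S).Evals c e (fun p => y p.1 p.2) x := by
  rcases h with ⟨φ, hφ, hx⟩ | ⟨hV, σ, rfl⟩
  -- The labels are the wires that arise by gluing the edges of T and of all the S v. Two different
  -- flags of the substituted tree on the same wire are joined there by definition.
  · let R : CTree.Wire V r U s n → CTree.Wire V r U s n → Prop := CTree.Step T S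
    have hK : ∀ x y, Relation.EqvGen R x y ↔ Quot.mk R x = Quot.mk R y := fun x y => Quot.eq.symm
    let κ' : Flag (fun p : Σ v, U v => s p.1 p.2) → Quot R := fun f =>
      Quot.mk R (CTree.Wire.ofEnd (.inl f))
    let κ : Flag r → Quot R := fun f => Quot.mk R (CTree.Wire.ofOuter (.inl f))
    have hκ' : ∀ f g, f ≠ g → κ' f = κ' g → (T.subst S).flagEdge f g := fun f g hne hfg =>
      ⟨fun h => hne (Sum.inl_injective h), (hK _ _).2 hfg⟩
    have := hx.transport (c := c) (e := e) (w' := fun p : Σ v, U v => y p.1 p.2)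
      (E' := (T.subst S).flagEdge) κ κ' (fun v => {p | p.1 = v})
      (fun f g h => Quot.sound (.outer _ _ h)) hκ' ?_ ?_
    · have hu : ⋃ v ∈ (Set.univ : Set V), {p : Σ v, U v | p.1 = v} = Set.univ := by
        ext p; simp
      rw [hu] at this
      rcases this with ⟨ψ, h1, h2⟩ | ⟨h1, -, h2, -⟩
      · refine Or.inl ⟨ψ, fun j => ⟨by simp, ?_⟩, h1⟩
        refine .symm _ _ ((hK _ _).2 ((congrFun h2 j).trans ?_))
        exact Quot.sound (.outer _ _ (T.symm _ _ (hφ j)))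
      -- Here no S v has vertices, so the resulting tree has none either and its value is the unit.
      · exact Or.inr ⟨Set.univ_eq_empty_iff.1 h1, h2⟩
    · intro u v huv
      rw [Set.disjoint_left]
      rintro p rfl h
      exact huv h
    · intro v
      -- The decoration w v is itself an iterated composition over the vertices of S v, which is
      -- transported into the big tree, or it is the unit, if S v has no vertices.
      rcases hS v with ⟨χ, hχ, hw⟩ | ⟨hU, τ, hτ⟩
      · have := hw.transport (c := c) (e := e) (w' := fun p : Σ v, U v => y p.1 p.2)
          (E' := (T.subst S).flagEdge) (fun f => Quot.mk R (.inl ⟨v, .inl f⟩)) κ'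
          (fun u => {(⟨v, u⟩ : Σ v, U v)}) (fun f g h => Quot.sound (.inner v _ _ h)) hκ' ?_ ?_
        · have hu : ⋃ u ∈ (Set.univ : Set (U v)), {(⟨v, u⟩ : Σ v, U v)} = {p | p.1 = v} := by
            ext ⟨v', u⟩
            simp only [Set.mem_univ, Set.iUnion_true, Set.mem_iUnion, Set.mem_singleton_iff,
              Set.mem_ofPred_eq]
            constructor
            · rintro ⟨u', h⟩
              exact congrArg Sigma.fst h
            · rintro rfl
              exact ⟨u, rfl⟩
          rw [hu] at this
          have hlab : (fun f => Quot.mk R (.inl ⟨v, .inl f⟩)) ∘ χ = fun j => κ ⟨v, j⟩ := by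
            funext j
            exact (Quot.sound (.inner v _ _ (hχ j))).symm
          rw [← hlab]
          exact this
        · intro u u' huu
          simpa using huu
        · intro u
          exact Or.inl ⟨_, Val.single (⟨v, u⟩ : Σ v, U v), rfl⟩
      -- The two legs of S v are joined to each other, so the two flags at v lie on one wire.
      · have hr := (S v).eq_one_of_isEmpty
        refine Or.inr ⟨?_, he ⟨v, hU⟩, ⟨τ, hτ⟩, fun (i j : Fin (r v + 1)) => ?_⟩
        · ext ⟨v', u⟩
          simp only [Set.mem_ofPred_eq, Set.mem_empty_iff_false, iff_false]
          rintro rfl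
          exact hU.elim u
        · by_cases hij : i = j
          · rw [hij]
          · have h1 := (S v).edge_opp (.inr i)
            rcases ho : (S v).opp (.inr i) with f | i'
            · exact hU.elim f.1
            · have h2 := (S v).opp_ne (.inr i)
              rw [ho] at h1 h2
              have h3 : i' ≠ i := fun h => h2 (by rw [h])
              obtain rfl : i' = j := by
                have := Fin.val_ne_of_ne h3
                have := Fin.val_ne_of_ne hij
                exact Fin.ext (by omega)
              exact Quot.sound (.inner v _ _ h1)
  · exact Or.inr ⟨⟨fun p => hV.elim p.1⟩, σ, rfl⟩

theorem Val.map {c' : Comp.{u, v} k W'.X} {f : W ⟶ W'} (hf : PreservesComp c c' f)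
    {V : Type} {r : V → ℕ} {E : Flag r → Flag r → Prop} {w : ∀ v, W.X (r v)} {A : Set V}
    {P : Lab W (Flag r)} (h : Val c E w A P) :
    Val c' E (fun v => f.app _ (w v)) A ⟨P.n, P.lab, f.app _ P.val⟩ := by
  induction h with
  | single v => exact .single v
  | perm P σ _ ih =>
    have := ih.perm ⟨P.n, P.lab, f.app _ P.val⟩ σ
    simp only [Lab.perm, ← CycMod.hom_tr] at this
    exact this
  | join P Q hi hl _ _ hd he ih ih' =>
    have := ih.join ⟨P.n, P.lab, f.app _ P.val⟩ ⟨Q.n, Q.lab, f.app _ Q.val⟩ hi hl ih' hd he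
    simp only [Lab.join, ← hf _ _ _ _ hi hl] at this
    exact this

/-- In a composition the vertex v belongs to only one of the two parts, which are disjoint; the
value of the other part does not depend on the decoration of v, which is the second clause.
Bilinearity of the composition then carries linear combinations along. -/
theorem Val.update {V : Type} [DecidableEq V] {r : V → ℕ} {E : Flag r → Flag r → Prop}
    {w : ∀ v, W.X (r v)} (v : V) (a b : k) (x y : W.X (r v)) {A : Set V} {P : Lab W (Flag r)}
    (h : Val c E (Function.update w v (a • x + b • y)) A P) :
    (v ∈ A → ∃ p q, P.val = a • p + b • q ∧ Val c E (Function.update w v x) A ⟨P.n, P.lab, p⟩ ∧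
      Val c E (Function.update w v y) A ⟨P.n, P.lab, q⟩) ∧
    (v ∉ A → ∀ z, Val c E (Function.update w v z) A P) := by
  induction h with
  | single u =>
    constructor
    · intro hv
      obtain rfl : v = u := hv
      refine ⟨x, y, by simp, ?_, ?_⟩
      · have := Val.single (c := c) (E := E) (w := Function.update w v x) v
        rwa [Function.update_self] at this
      · have := Val.single (c := c) (E := E) (w := Function.update w v y) v
        rwa [Function.update_self] at this
    · intro hv z
      have := Val.single (c := c) (E := E) (w := Function.update w v z) u
      rw [Function.update_of_ne (fun h => hv h.symm)] at this ⊢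
      exact this
  | perm P σ _ ih =>
    refine ⟨fun hv => ?_, fun hv z => (ih.2 hv z).perm _ σ⟩
    obtain ⟨p, q, h1, h2, h3⟩ := ih.1 hv
    refine ⟨W.tr σ p, W.tr σ q, ?_, h2.perm ⟨P.n, P.lab, p⟩ σ, h3.perm ⟨P.n, P.lab, q⟩ σ⟩
    exact (congrArg (W.tr σ) h1).trans (by rw [map_add, map_smul, map_smul]; rfl)
  | @join A B P Q l i hi hl _ _ hd he ih ih' =>
    constructor
    · rintro (hv | hv)
      · obtain ⟨p, q, h1, h2, h3⟩ := ih.1 hv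
        have hv' := Set.disjoint_left.1 hd hv
        refine ⟨_, _, ?_, h2.join ⟨P.n, P.lab, p⟩ Q hi hl (ih'.2 hv' x) hd he,
          h3.join ⟨P.n, P.lab, q⟩ Q hi hl (ih'.2 hv' y) hd he⟩
        exact (congrArg (c _ _ _ _ hi hl · Q.val) h1).trans (by
          simp only [map_add, map_smul, LinearMap.add_apply, LinearMap.smul_apply]; rfl)
      · obtain ⟨p, q, h1, h2, h3⟩ := ih'.1 hv
        have hv' := Set.disjoint_right.1 hd hv
        refine ⟨_, _, ?_, (ih.2 hv' x).join P ⟨Q.n, Q.lab, p⟩ hi hl h2 hd he,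
          (ih.2 hv' y).join P ⟨Q.n, Q.lab, q⟩ hi hl h3 hd he⟩
        exact (congrArg (c _ _ _ _ hi hl P.val) h1).trans (by
          simp only [map_add, map_smul]; rfl)
    · intro hv z
      exact (ih.2 (fun h => hv (Or.inl h)) z).join _ _ hi hl (ih'.2 (fun h => hv (Or.inr h)) z) hd he

end invariance

/-! ### The algebra given by the compositions -/

section eval
variable {k : Type u} [CommRing k] {ext : Prop} {W : CycMod.{u, v} k} {V V' : Type} [Fintype V]
  [Fintype V'] {r : V → ℕ} {r' : V' → ℕ} {n n' : ℕ} {c : Comp.{u, v} k W.X} {e : W.X 1}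

theorem CTree.Evals.update [DecidableEq V] {T : CTree V r n} {w : ∀ v, W.X (r v)} {v : V}
    {a b : k} {x y : W.X (r v)} {z : W.X n}
    (h : T.Evals c e (Function.update w v (a • x + b • y)) z) :
    ∃ p q, z = a • p + b • q ∧ T.Evals c e (Function.update w v x) p ∧
      T.Evals c e (Function.update w v y) q := by
  rcases h with ⟨φ, hφ, hz⟩ | ⟨hV, -⟩
  · obtain ⟨p, q, h1, h2, h3⟩ := (hz.update v a b x y).1 trivial
    exact ⟨p, q, h1, Or.inl ⟨φ, hφ, h2⟩, Or.inl ⟨φ, hφ, h3⟩⟩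
  · exact (hV.false v).elim

theorem CTree.Evals.add [DecidableEq V] (hc : IsCyclicOperad ext W c e) (hV : ext ∨ Nonempty V)
    {T : CTree V r n} {w : ∀ v, W.X (r v)} {v : V} {x y : W.X (r v)} {p q z : W.X n}
    (hz : T.Evals c e (Function.update w v (x + y)) z)
    (hp : T.Evals c e (Function.update w v x) p) (hq : T.Evals c e (Function.update w v y) q) :
    z = p + q := by
  rw [← one_smul k x, ← one_smul k y] at hz
  obtain ⟨p', q', rfl, h1, h2⟩ := hz.update
  rw [one_smul, one_smul, h1.unique hc hV hp, h2.unique hc hV hq]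

theorem CTree.Evals.smul [DecidableEq V] (hc : IsCyclicOperad ext W c e) (hV : ext ∨ Nonempty V)
    {T : CTree V r n} {w : ∀ v, W.X (r v)} {v : V} {a : k} {x : W.X (r v)} {p z : W.X n}
    (hz : T.Evals c e (Function.update w v (a • x)) z)
    (hp : T.Evals c e (Function.update w v x) p) : z = a • p := by
  -- The scalar multiple is written as a • x + 0 • x, to fit the form in which linearity is
  -- available.
  rw [← add_zero (a • x), ← zero_smul k x] at hz
  obtain ⟨p', q', rfl, h1, h2⟩ := hz.update
  rw [zero_smul, add_zero, h1.unique hc hV hp]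

theorem CTree.Evals.of_dIso {T : CTree V r n} {w : ∀ v, W.X (r v)} {T' : CTree V' r' n}
    {w' : ∀ v, W.X (r' v)} {x : W.X n} (h : T.Evals c e w x) (H : DIso W T w T' w') :
    T'.Evals c e w' x := by
  obtain ⟨ε, φ, h1, h2⟩ := H
  have := h.iso T' w' ε φ (.refl _) h1 h2
  rwa [W.tr_refl] at this

theorem CTree.Evals.relegs {T : CTree V r n} {w : ∀ v, W.X (r v)} {x : W.X n}
    (h : T.Evals c e w x) (l : Fin (n' + 1) ≃ Fin (n + 1)) :
    (T.relegs l).Evals c e w (W.tr l x) :=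
  h.iso (T.relegs l) w (.refl _) (fun _ => .refl _) l (fun _ _ => Iff.rfl)
    (fun _ => (W.tr_refl _).symm)

theorem CTree.corolla_evals (x : W.X n) : (CTree.corolla n).Evals c e (fun _ => x) x := by
  refine Or.inl ⟨fun j => ⟨(), j⟩, fun j => Or.inr ⟨j, rfl, rfl⟩, ?_⟩
  have := Val.single (c := c) (E := (CTree.corolla n).flagEdge) (w := fun _ => x) ()
  rwa [show ({()} : Set Unit) = Set.univ from Set.eq_univ_of_forall fun _ => rfl] at this

/-- The value of the tree with two vertices is the composition. -/
theorem graft_val {m n l i : ℕ} (h : 1 ≤ i ∧ i ≤ m) (hl : l + 1 = m + n)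
    (w : ∀ b, W.X (arity m n b)) :
    Val c (graft h hl).flagEdge w Set.univ
      ⟨l, joinLab h hl (fun j => ⟨false, j⟩) (fun j => ⟨true, j⟩),
        c m n l i h hl (w false) (w true)⟩ := by
  have := (Val.single (c := c) (E := (graft h hl).flagEdge) (w := w) false).join _ _ h hl
    (Val.single true) (by simp) (Or.inl .join)
  rwa [show ({false} ∪ {true} : Set Bool) = Set.univ by ext b; cases b <;> simp] at this

theorem graft_isLegs {m n l i : ℕ} (h : 1 ≤ i ∧ i ≤ m) (hl : l + 1 = m + n) :
    (graft h hl).IsLegs (joinLab h hl (fun j => ⟨false, j⟩) (fun j => ⟨true, j⟩)) := by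
  intro t
  unfold joinLab
  rcases hs : slots h hl t with j | j
  · exact Or.inl (.left t j hs)
  · exact Or.inl (.right t j hs)

/-- The values of the decorated trees. -/
noncomputable def eval (hc : IsCyclicOperad ext W c e) (n : ℕ) : PsiX ext W n →ₗ[k] W.X n :=
  PsiX.lift (fun D => (D.tree.exists_evals c e D.dec).choose)
    (fun D D' H => CTree.Evals.unique hc D'.ok
      ((D.tree.exists_evals c e D.dec).choose_spec.of_dIso H)
      (D'.tree.exists_evals c e D'.dec).choose_spec)
    (fun D _ _ _ => CTree.Evals.add hc D.ok (CTree.exists_evals c e _ _).choose_spec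
      (CTree.exists_evals c e _ _).choose_spec (CTree.exists_evals c e _ _).choose_spec)
    (fun D _ _ _ => CTree.Evals.smul hc D.ok (CTree.exists_evals c e _ _).choose_spec
      (CTree.exists_evals c e _ _).choose_spec)

theorem eval_cls (hc : IsCyclicOperad ext W c e) (h : ext ∨ Nonempty V) {T : CTree V r n}
    {w : ∀ v, W.X (r v)} {x : W.X n} (hx : T.Evals c e w x) : eval hc n (PsiX.cls h T w) = x := by
  refine (PsiX.lift_mk _ _ _ _ _).trans ?_
  refine CTree.Evals.unique hc (PsiX.reindex (W := W) h T w).ok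
    (CTree.exists_evals c e _ _).choose_spec (hx.of_dIso ?_)
  exact ⟨(Fintype.equivFin V).symm, fun _ => .refl _, fun _ _ => Iff.rfl,
    fun _ => (W.tr_refl _).symm⟩

/-- The values of the decorated trees, as a morphism. -/
noncomputable def evalHom (hc : IsCyclicOperad ext W c e) : Psi ext W ⟶ W where
  app n := eval hc n
  equivariant n σ x := by
    change eval hc n (PsiX.relabel σ x) = W.act n σ (eval hc n x)
    refine PsiX.lin_ext_cls (f := eval hc n ∘ₗ PsiX.relabel σ)
      (g := W.act n σ ∘ₗ eval hc n) (fun D => ?_) x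
    obtain ⟨y, hy⟩ := D.tree.exists_evals c e D.dec
    rw [LinearMap.comp_apply, LinearMap.comp_apply, PsiX.relabel_cls, eval_cls hc D.ok hy,
      eval_cls hc D.ok (hy.relegs σ)]
    rfl

/-- The unit axiom is the value of a corolla. Associativity says that evaluating the trees at the
vertices first and the outer tree afterwards gives the value of the substituted tree. -/
theorem evalHom_isAlgebra (hc : IsCyclicOperad ext W c e) :
    IsAlgebra (treeMonad ext k) W (evalHom hc) where
  unit := CycMod.hom_ext fun n x => eval_cls hc _ (CTree.corolla_evals x)
  assoc := Psi_hom_ext fun n D => by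
    change eval hc n (PsiX.map (evalHom hc) n (PsiX.cls (W := Psi ext W) D.ok D.tree D.dec)) =
      eval hc n (PsiX.mu n (PsiX.cls (W := Psi ext W) D.ok D.tree D.dec))
    refine (congrArg (eval hc n) (PsiX.map_cls _ _ _ _)).trans
      (Eq.trans ?_ (congrArg (eval hc n) (PsiX.mu_cls _ _ _)).symm)
    -- Both sides are multilinear in the decorations, so these may be taken to be classes of
    -- decorated trees.
    have hmulti : ∀ x : ∀ v, PsiX ext W (D.r v),
        eval hc n (PsiX.cls D.ok D.tree fun v => eval hc (D.r v) (x v)) =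
          eval hc n (PsiX.substMulti D.ok D.tree x) := by
      intro x
      let F : MultilinearMap k (fun v => PsiX ext W (D.r v)) (W.X n) :=
        { toFun := fun x => eval hc n (PsiX.cls D.ok D.tree fun v => eval hc (D.r v) (x v))
          map_update_add' := fun x v y z => by
            have h : ∀ y : PsiX ext W (D.r v),
                (fun u => eval hc (D.r u) (Function.update x v y u)) =
                  Function.update (fun u => eval hc (D.r u) (x u)) v (eval hc (D.r v) y) :=
              fun y => funext fun u => Function.apply_update (fun u => eval hc (D.r u)) x v y u
            simp only [h, map_add]
            rw [PsiX.cls_add, map_add]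
          map_update_smul' := fun x v a y => by
            have h : ∀ y : PsiX ext W (D.r v),
                (fun u => eval hc (D.r u) (Function.update x v y u)) =
                  Function.update (fun u => eval hc (D.r u) (x u)) v (eval hc (D.r v) y) :=
              fun y => funext fun u => Function.apply_update (fun u => eval hc (D.r u)) x v y u
            simp only [h, map_smul]
            rw [PsiX.cls_smul, map_smul] }
      refine PsiX.multi_ext_cls F ((eval hc n).compMultilinearMap
        (PsiX.substMulti D.ok D.tree)) (fun E => ?_) x
      rw [LinearMap.compMultilinearMap_apply, PsiX.substMulti_cls]
      choose y hy using fun v => (E v).tree.exists_evals c e (E v).dec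
      obtain ⟨z, hz⟩ := D.tree.exists_evals c e y
      have h1 : (fun v => eval hc (D.r v) (PsiX.cls (E v).ok (E v).tree (E v).dec)) = y :=
        funext fun v => eval_cls hc _ (hy v)
      refine (congrArg (fun y => eval hc n (PsiX.cls D.ok D.tree y)) h1).trans ?_
      rw [eval_cls hc _ hz, eval_cls hc _ (hz.subst hy fun ⟨v, hv⟩ => ?_)]
      -- The unit matters only when a tree without vertices is substituted, which the condition on
      -- decorated trees permits only if `ext` holds.
      have hext : ext := (E v).ok.resolve_right fun ⟨u⟩ => hv.elim u
      exact ⟨hc.unit hext, hc.invariant hext⟩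
    exact hmulti D.dec

theorem circ_evalHom (hc : IsCyclicOperad ext W c e) :
    circ (ext := ext) (W := W) (evalHom hc) = c := by
  funext m n l i h hl
  refine LinearMap.ext fun p => LinearMap.ext fun q => ?_
  exact eval_cls hc _ (Or.inl ⟨_, graft_isLegs h hl, graft_val h hl (graftDec p q)⟩)

end eval

/-! ### The compositions given by an algebra -/

section algebra
variable {k : Type u} [CommRing k] {ext : Prop} {W : CycMod.{u, v} k} {a : Psi ext W ⟶ W}
  {V : Type} {r : V → ℕ} {n n' : ℕ}

theorem IsAlgebra.app_corolla (ha : IsAlgebra (treeMonad ext k) W a) (x : W.X n) :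
    a.app n (PsiX.cls (Or.inr ⟨()⟩) (CTree.corolla n) (fun _ => x)) = x :=
  congrArg (fun f : W ⟶ W => f.app n x) ha.unit

/-- The associativity axiom evaluated on a tree decorated by classes of trees, where the
multiplication is substitution. -/
theorem IsAlgebra.app_subst (ha : IsAlgebra (treeMonad ext k) W a) [Fintype V]
    (h : ext ∨ Nonempty V) (T : CTree V r n) {U : V → Type} [∀ v, Fintype (U v)]
    {s : ∀ v, U v → ℕ} (h' : ∀ v, ext ∨ Nonempty (U v)) (S : ∀ v, CTree (U v) (s v) (r v))
    (w : ∀ v u, W.X (s v u)) :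
    a.app n (PsiX.cls h T fun v => a.app (r v) (PsiX.cls (h' v) (S v) (w v))) =
      a.app n (PsiX.cls (ok_sigma h h') (T.subst S) fun p => w p.1 p.2) := by
  have h1 := congrArg (fun f : Psi ext (Psi ext W) ⟶ W => f.app n
    (PsiX.cls (W := Psi ext W) h T fun v => PsiX.cls (h' v) (S v) (w v))) ha.assoc
  refine (congrArg (a.app n) (PsiX.map_cls _ _ _ _)).symm.trans (h1.trans ?_)
  exact congrArg (a.app n) ((PsiX.mu_cls _ _ _).trans (PsiX.substMulti_cls _ _ _ _ _))

theorem app_relegs (a : Psi ext W ⟶ W) [Fintype V] (h : ext ∨ Nonempty V) (T : CTree V r n)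
    (w : ∀ v, W.X (r v)) (l : Fin (n' + 1) ≃ Fin (n + 1)) :
    a.app n' (PsiX.cls h (T.relegs l) w) = W.tr l (a.app n (PsiX.cls h T w)) := by
  refine (congrArg (a.app n') ?_).trans (CycMod.hom_tr a l _)
  exact (PsiX.relabel_cls _ _ _ _).symm.trans (Psi_tr _ _).symm

/-- The tree `S` is the part on the vertices `A` of the graph with the edges `E`, where the legs
belong to the flags given by `φ`. -/
structure IsSubtree (E : Flag r → Flag r → Prop) (A : Set V) (φ : Fin (n + 1) → Flag r)
    {U : Type} [Fintype U] (ι : U → V) (S : CTree U (fun u => r (ι u)) n) : Prop where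
  injective : ι.Injective
  range_eq : Set.range ι = A
  edge : ∀ f g : Flag (fun u => r (ι u)), S.edge (.inl f) (.inl g) → E ⟨ι f.1, f.2⟩ ⟨ι g.1, g.2⟩
  leg : ∀ j, ∃ f : Flag (fun u => r (ι u)),
    S.edge (.inr j) (.inl f) ∧ (⟨ι f.1, f.2⟩ : Flag r) = φ j

theorem IsSubtree.flag_injective {U : Type} {ι : U → V} (hι : ι.Injective)
    {f g : Flag (fun u => r (ι u))} (h : (⟨ι f.1, f.2⟩ : Flag r) = ⟨ι g.1, g.2⟩) : f = g := by
  obtain ⟨u, f⟩ := f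
  obtain ⟨u', g⟩ := g
  obtain rfl : u = u' := hι (congrArg Sigma.fst h)
  simpa using h

theorem flag_finCongr {a b : V} (h : a = b) (j : Fin (r b + 1)) (h' : r b + 1 = r a + 1) :
    (⟨a, finCongr h' j⟩ : Flag r) = ⟨b, j⟩ := by
  subst h
  rfl

/-- The vertices are those of A, the flags of the legs are listed by φ, and every other flag has the
unique partner that E prescribes. So nothing is left to choose. -/
theorem IsSubtree.dIso {E : Flag r → Flag r → Prop} (hE : ∀ f g g', E f g → E f g' → g = g')
    {A : Set V} {φ : Fin (n + 1) → Flag r} {U U' : Type} [Fintype U] [Fintype U'] {ι : U → V}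
    {ι' : U' → V} {S : CTree U (fun u => r (ι u)) n} {S' : CTree U' (fun u => r (ι' u)) n}
    (h : IsSubtree E A φ ι S) (h' : IsSubtree E A φ ι' S') (w : ∀ v, W.X (r v)) :
    DIso W S (fun u => w (ι u)) S' (fun u => w (ι' u)) := by
  let ε : U' ≃ U := (Equiv.ofInjective ι' h'.injective).trans
    ((Equiv.setCongr (h'.range_eq.trans h.range_eq.symm)).trans (Equiv.ofInjective ι h.injective).symm)
  have hε : ∀ u, ι (ε u) = ι' u := fun u =>
    Equiv.apply_ofInjective_symm h.injective _
  let m : ∀ u, Fin (r (ι' u) + 1) ≃ Fin (r (ι (ε u)) + 1) := fun u =>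
    finCongr (congrArg (fun v => r v + 1) (hε u).symm)
  have hm : ∀ f : Flag (fun u => r (ι' u)),
      (⟨ι (ε f.1), m f.1 f.2⟩ : Flag r) = ⟨ι' f.1, f.2⟩ := fun f =>
    flag_finCongr (hε f.1) f.2 _
  refine ⟨ε, m, CTree.edge_iff_of_imp _ _ _ ?_, fun u =>
    (W.tr_finCongr w (hε u)).symm⟩
  have hleg : ∀ j (g : Flag (fun u => r (ι' u))), S'.edge (.inr j) (.inl g) →
      S.edge (.inr j) (.inl ⟨ε g.1, m g.1 g.2⟩) := by
    intro j g hg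
    obtain ⟨g', h1, h2⟩ := h'.leg j
    obtain rfl : g' = g := Sum.inl_injective (S'.edge_unique h1 hg)
    obtain ⟨f, h3, h4⟩ := h.leg j
    have h5 : f = ⟨ε g'.1, m g'.1 g'.2⟩ :=
      IsSubtree.flag_injective h.injective (h4.trans (h2.symm.trans (hm g').symm))
    exact h5 ▸ h3
  rintro (f | j) (g | j') hfg
  · have h1 := h'.edge _ _ hfg
    have h2 := S.edge_opp (.inl ⟨ε f.1, m f.1 f.2⟩)
    rcases ho : S.opp (.inl ⟨ε f.1, m f.1 f.2⟩) with g' | j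
    · rw [ho] at h2
      have h3 := h.edge _ _ h2
      rw [hm f] at h3
      have h4 : g' = ⟨ε g.1, m g.1 g.2⟩ :=
        IsSubtree.flag_injective h.injective ((hE _ _ _ h3 h1).trans (hm g).symm)
      rw [h4] at h2
      exact h2
    -- If the flag belonged to the leg j in S, it would belong to the leg j in S' too, since the
    -- legs have the same flags; but there it is joined to a flag.
    · rw [ho] at h2
      obtain ⟨f', h3, h4⟩ := h'.leg j
      have h5 := S.edge_unique (S.symm _ _ h2) (hleg j f' h3)
      have h6 : f' = f := by
        refine IsSubtree.flag_injective h'.injective ?_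
        rw [← hm f', ← hm f]
        exact congrArg (fun f : Flag (fun u => r (ι u)) => (⟨ι f.1, f.2⟩ : Flag r))
          (Sum.inl_injective h5).symm
      rw [h6] at h3
      have := S'.edge_unique hfg (S'.symm _ _ h3)
      simp at this
  · exact S.symm _ _ (hleg j' f (S'.symm _ _ hfg))
  · exact hleg j g hfg
  · obtain ⟨f, h1, -⟩ := h'.leg j
    have := S'.edge_unique hfg h1
    simp at this

/-- The value of `a` on a part of the graph is given by `P`. -/
def Realized (a : Psi ext W ⟶ W) (E : Flag r → Flag r → Prop) (w : ∀ v, W.X (r v)) (A : Set V)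
    (n : ℕ) (φ : Fin (n + 1) → Flag r) (x : W.X n) : Prop :=
  ∃ (U : Type) (_ : Fintype U) (hU : Nonempty U) (ι : U → V) (S : CTree U (fun u => r (ι u)) n),
    IsSubtree E A φ ι S ∧ a.app n (PsiX.cls (Or.inr hU) S (fun u => w (ι u))) = x

theorem CTree.subst_edge {V : Type} [Fintype V] {r : V → ℕ} {T : CTree V r n} {U : V → Type}
    [∀ v, Fintype (U v)] {s : ∀ v, U v → ℕ} {S : ∀ v, CTree (U v) (s v) (r v)}
    {x y : Ends (Σ v, U v) (fun p => s p.1 p.2) n} (h : x ≠ y)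
    (h' : Relation.EqvGen (CTree.Step T S) (CTree.Wire.ofEnd x) (CTree.Wire.ofEnd y)) :
    (T.subst S).edge x y := ⟨h, h'⟩

/-- Substitution into the two-vertex tree keeps the edges of both parts and adds one edge, between
the flags that belong to the leg i of the first and the leg 0 of the second part. The remaining legs
are numbered as `slots` prescribes. -/
theorem IsSubtree.graft {E : Flag r → Flag r → Prop} (hE : ∀ f g, E f g → E g f)
    {m n l i : ℕ} (hi : 1 ≤ i ∧ i ≤ m) (hl : l + 1 = m + n) {A : Bool → Set V}
    {φ : ∀ b, Fin (arity m n b + 1) → Flag r} {U : Bool → Type} [∀ b, Fintype (U b)]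
    {ι : ∀ b, U b → V} {S : ∀ b, CTree (U b) (fun u => r (ι b u)) (arity m n b)}
    (h : ∀ b, IsSubtree E (A b) (φ b) (ι b) (S b)) (hd : Disjoint (A false) (A true))
    (he : E (φ false (⟨i, Nat.lt_succ_of_le hi.2⟩ : Fin (m + 1))) (φ true (0 : Fin (n + 1)))) :
    IsSubtree E (A false ∪ A true) (joinLab hi hl (φ false) (φ true))
      (fun p : Σ b, U b => ι p.1 p.2) ((CycOp.graft hi hl).subst S) := by
  have hin : ∀ b (f g : Flag (fun u => r (ι b u))), (S b).edge (.inl f) (.inl g) →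
      ((CycOp.graft hi hl).subst S).edge (.inl ⟨⟨b, f.1⟩, f.2⟩) (.inl ⟨⟨b, g.1⟩, g.2⟩) := by
    intro b f g hfg
    refine CTree.subst_edge (fun h0 => (S b).irrefl (.inl g) ?_) (.rel _ _ (.inner b _ _ hfg))
    have h1 : f = g := by
      obtain ⟨u, f⟩ := f
      obtain ⟨u', g⟩ := g
      simp only [Sum.inl.injEq, Sigma.mk.injEq] at h0
      obtain ⟨⟨-, h1⟩, h2⟩ := h0
      cases h1
      cases h2
      rfl
    rwa [h1] at hfg
  -- A flag that belongs to the leg t of its part continues along the edge of the two-vertex tree at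
  -- t.
  have hout : ∀ b t (f : Flag (fun u => r (ι b u))) (x : Ends Bool (arity m n) l),
      (S b).edge (.inr t) (.inl f) → (CycOp.graft hi hl).edge (.inl ⟨b, t⟩) x →
      Relation.EqvGen (CTree.Step (CycOp.graft hi hl) S)
        (CTree.Wire.ofEnd (.inl ⟨⟨b, f.1⟩, f.2⟩)) (CTree.Wire.ofOuter x) := fun b t f x hf hx =>
    .trans _ _ _ (.symm _ _ (.rel _ _ (.inner b _ _ hf))) (.rel _ _ (.outer _ _ hx))
  have hjoin : ∀ b b' t t', (CycOp.graft hi hl).edge (.inl ⟨b, t⟩) (.inl ⟨b', t'⟩) →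
      b ≠ b' ∧ E (φ b t) (φ b' t') := by
    rintro b b' t t' (h1 | h1)
    · cases h1
      exact ⟨by simp, he⟩
    · cases h1
      exact ⟨by simp, hE _ _ he⟩
  constructor
  · rintro ⟨b, u⟩ ⟨b', u'⟩ hu
    have h1 : ∀ b u, ι b u ∈ A b := fun b u => (h b).range_eq ▸ ⟨u, rfl⟩
    dsimp only at hu
    have hb : b = b' := by
      have h2 := h1 b u
      have h3 := h1 b' u'
      rw [← hu] at h3
      rcases b with _ | _ <;> rcases b' with _ | _
      · rfl
      · exact absurd h3 (Set.disjoint_left.1 hd h2)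
      · exact absurd h2 (Set.disjoint_left.1 hd h3)
      · rfl
    subst hb
    rw [(h b).injective hu]
  · ext v
    simp only [Set.mem_range, Sigma.exists, Bool.exists_bool, ← (h _).range_eq, Set.mem_union]
  · rintro ⟨⟨b, u⟩, j⟩ ⟨⟨b', u'⟩, j'⟩ hfg
    -- Since partners are unique, it is enough to follow the wire from the first flag: it ends in
    -- the same part, or leaves through a leg t and reaches the other part along the new edge. It
    -- cannot reach a leg of the whole tree, because it ends in a flag.
    have h1 := (S b).edge_opp (.inl ⟨u, j⟩)
    rcases ho : (S b).opp (.inl ⟨u, j⟩) with g | t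
    · rw [ho] at h1
      have h2 := Sum.inl_injective (CTree.edge_unique _ hfg (hin b _ _ h1))
      rw [h2]
      exact (h b).edge _ _ h1
    · rw [ho] at h1
      obtain ⟨f, h3, h4⟩ := (h b).leg t
      obtain rfl := Sum.inl_injective ((S b).edge_unique ((S b).symm _ _ h1) h3)
      have h5 := (CycOp.graft hi hl).edge_opp (.inl ⟨b, t⟩)
      rcases hg : (CycOp.graft hi hl).opp (.inl ⟨b, t⟩) with ⟨b', t'⟩ | s
      · rw [hg] at h5
        obtain ⟨h6, h7⟩ := hjoin _ _ _ _ h5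
        obtain ⟨f', h8, h9⟩ := (h b').leg t'
        have h10 : ((CycOp.graft hi hl).subst S).edge (.inl ⟨⟨b, u⟩, j⟩)
            (.inl ⟨⟨b', f'.1⟩, f'.2⟩) :=
          CTree.subst_edge (fun h0 => h6 (by simp at h0; exact h0.1.1))
            (.trans _ _ _ (hout b t _ _ h3 h5) (.rel _ _ (.inner b' _ _ h8)))
        rw [Sum.inl_injective (CTree.edge_unique _ hfg h10)]
        dsimp only at h4 ⊢
        rw [h4, h9]
        exact h7
      · rw [hg] at h5
        have h10 : ((CycOp.graft hi hl).subst S).edge (.inl ⟨⟨b, u⟩, j⟩) (.inr s) :=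
          CTree.subst_edge (by simp) (hout b t _ _ h3 h5)
        have := CTree.edge_unique _ hfg h10
        simp at this
  · intro s
    have hs : ∃ b t, (CycOp.graft hi hl).edge (.inr s) (.inl ⟨b, t⟩) ∧
        joinLab hi hl (φ false) (φ true) s = φ b t := by
      unfold joinLab
      rcases hs : slots hi hl s with j | j
      · exact ⟨false, j.1, Or.inl (.left s j hs), rfl⟩
      · exact ⟨true, j.1, Or.inl (.right s j hs), rfl⟩
    obtain ⟨b, t, h1, h2⟩ := hs
    obtain ⟨f, h3, h4⟩ := (h b).leg t
    exact ⟨⟨⟨b, f.1⟩, f.2⟩, CTree.symm _ _ _ (CTree.subst_edge (by simp)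
      (hout b t f _ h3 (CTree.symm _ _ _ h1))), h4.trans h2.symm⟩

/-- A composition is the value on a two-vertex tree decorated by the values of two subtrees. By
associativity of the algebra this is its value on the substituted tree. -/
theorem IsAlgebra.realized (ha : IsAlgebra (treeMonad ext k) W a) {E : Flag r → Flag r → Prop}
    (hE : ∀ f g, E f g → E g f) {w : ∀ v, W.X (r v)} {A : Set V} {P : Lab W (Flag r)}
    (h : Val (circ (ext := ext) (W := W) a) E w A P) : Realized a E w A P.n P.lab P.val := by
  induction h with
  | single v =>
    refine ⟨Unit, inferInstance, ⟨()⟩, fun _ => v, CTree.corolla (r v), ⟨fun _ _ _ => rfl, ?_, ?_,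
      fun j => ⟨⟨(), j⟩, Or.inr ⟨j, rfl, rfl⟩, rfl⟩⟩, ha.app_corolla (w v)⟩
    · exact Set.range_const
    · rintro f g (⟨j, -, h⟩ | ⟨j, h, -⟩) <;> simp at h
  | perm P σ _ ih =>
    obtain ⟨U, _, hU, ι, S, hS, hval⟩ := ih
    refine ⟨U, inferInstance, hU, ι, S.relegs σ, ⟨hS.injective, hS.range_eq, hS.edge,
      fun j => hS.leg (σ j)⟩, ?_⟩
    exact (app_relegs a _ _ _ σ).trans (congrArg (W.tr σ) hval)
  | @join A B P Q l i hi hl _ _ hd he ih ih' =>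
    obtain ⟨m, φ, x⟩ := P
    obtain ⟨n, ψ, y⟩ := Q
    let A' : Bool → Set V := fun b => cond b B A
    let φ' : ∀ b, Fin (arity m n b + 1) → Flag r := fun b => match b with
      | false => φ
      | true => ψ
    have h : ∀ b, Realized a E w (A' b) (arity m n b) (φ' b) (graftDec x y b) := by
      rintro (_ | _)
      · exact ih
      · exact ih'
    choose U _ hU ι S hS hval using h
    refine ⟨Σ b, U b, inferInstance, ⟨⟨false, (hU false).some⟩⟩, fun p => ι p.1 p.2,
      (graft hi hl).subst S, IsSubtree.graft hE hi hl hS hd he, ?_⟩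
    refine (ha.app_subst (Or.inr ⟨true⟩) (graft hi hl) (fun b => Or.inr (hU b)) S
      (fun b u => w (ι b u))).symm.trans ?_
    exact congrArg (fun z => a.app l (PsiX.cls (Or.inr ⟨true⟩) (graft hi hl) z)) (funext hval)

/-- Both elements are values on isomorphic decorated trees. Only the symmetry and functionality of E
are used, so small graphs can be written down without checking that they are trees. -/
theorem IsAlgebra.val_unique (ha : IsAlgebra (treeMonad ext k) W a) {E : Flag r → Flag r → Prop}
    (hE : ∀ f g, E f g → E g f) (hE' : ∀ f g g', E f g → E f g' → g = g') {w : ∀ v, W.X (r v)}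
    {A : Set V} {φ : Fin (n + 1) → Flag r} {x y : W.X n}
    (hx : Val (circ (ext := ext) (W := W) a) E w A ⟨n, φ, x⟩)
    (hy : Val (circ (ext := ext) (W := W) a) E w A ⟨n, φ, y⟩) : x = y := by
  obtain ⟨U, _, hU, ι, S, hS, hval⟩ := ha.realized hE hx
  obtain ⟨U', _, hU', ι', S', hS', hval'⟩ := ha.realized hE hy
  dsimp only at hval hval'
  rw [← hval, ← hval', PsiX.cls_iso _ _ _ _ _ _ (hS.dIso hE' hS' w)]

/-- The tree T is itself the part on all its vertices, so it is isomorphic to the tree that realizes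
the iterated composition. -/
theorem IsAlgebra.app_cls_of_val (ha : IsAlgebra (treeMonad ext k) W a) [Fintype V]
    (hV : ext ∨ Nonempty V) {T : CTree V r n} {w : ∀ v, W.X (r v)} {φ : Fin (n + 1) → Flag r}
    (hφ : T.IsLegs φ) {x : W.X n}
    (hx : Val (circ (ext := ext) (W := W) a) T.flagEdge w Set.univ ⟨n, φ, x⟩) :
    a.app n (PsiX.cls hV T w) = x := by
  obtain ⟨U, _, hU, ι, S, hS, hval⟩ := ha.realized (E := T.flagEdge) (fun f g h => T.symm _ _ h) hx
  have hT : IsSubtree T.flagEdge Set.univ φ (fun v => v) T :=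
    ⟨Function.injective_id, Set.range_id, fun _ _ h => h, fun j => ⟨φ j, hφ j, rfl⟩⟩
  refine Eq.trans ?_ hval
  exact congrArg (a.app n) (PsiX.cls_iso _ _ _ _ _ _ (hS.dIso (E := T.flagEdge) (fun f g g' h h' =>
    Sum.inl_injective (T.edge_unique h h')) hT w)).symm

end algebra

/-! ### The axioms for the compositions given by an algebra -/

section identities
variable {k : Type u} [CommRing k] {ext : Prop} {W : CycMod.{u, v} k} {a : Psi ext W ⟶ W}

/-- The values on the flags of two vertices that are joined by one edge are unique. -/
theorem IsAlgebra.graft_val_unique (ha : IsAlgebra (treeMonad ext k) W a) {m n l i t : ℕ}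
    (hi : 1 ≤ i ∧ i ≤ m) (hl : l + 1 = m + n) {w : ∀ b, W.X (arity m n b)} {A : Set Bool}
    {φ ψ : Fin (t + 1) → Flag (arity m n)} {x y : W.X t} (hφ : φ = ψ)
    (hx : Val (circ (ext := ext) (W := W) a) (graft hi hl).flagEdge w A ⟨t, φ, x⟩)
    (hy : Val (circ (ext := ext) (W := W) a) (graft hi hl).flagEdge w A ⟨t, ψ, y⟩) : x = y := by
  subst hφ
  exact ha.val_unique (E := (graft hi hl).flagEdge) (fun _ _ h => (graft hi hl).symm _ _ h)
    (fun _ _ _ h h' => Sum.inl_injective ((graft hi hl).edge_unique h h')) hx hy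

theorem graft_flagEdge {m n l i : ℕ} (hi : 1 ≤ i ∧ i ≤ m) (hl : l + 1 = m + n) {x : Fin (m + 1)}
    {y : Fin (n + 1)} (hx : (x : ℕ) = i) (hy : y = 0) :
    (graft hi hl).flagEdge ⟨false, x⟩ ⟨true, y⟩ := by
  subst hx hy
  exact Or.inl .join

theorem bool_union : ({false} ∪ {true} : Set Bool) = Set.univ := by
  ext b; cases b <;> simp

/-- Both sides are values on one two-vertex graph, in which the flag τ(i) of p is joined to the flag
0 of q, and their labels agree. The cyclicity conditions below are proved in the same way. -/
theorem IsAlgebra.circ_equivariance (ha : IsAlgebra (treeMonad ext k) W a) {m n l i : ℕ}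
    (hi : 1 ≤ i ∧ i ≤ m) (hl : l + 1 = m + n) (τ : Sig m) (σ : Sig n) (p : W.X m) (q : W.X n) :
    circ (ext := ext) (W := W) a m n l i hi hl (W.act m τ.1 p) (W.act n σ.1 q) =
      W.act l (insertPerm hi hl τ σ).1 (circ (ext := ext) (W := W) a m n l
        (τ.1 ⟨i, Nat.lt_succ_of_le hi.2⟩ : ℕ) (Sig.pos τ hi) hl p q) := by
  have h1 := (graft_val (c := circ (ext := ext) (W := W) a) (Sig.pos τ hi) hl (graftDec p q)).perm _
    (insertPerm hi hl τ σ).1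
  let c := circ (ext := ext) (W := W) a
  let E := (graft (Sig.pos τ hi) hl).flagEdge
  have h2 : Val c E (graftDec p q) _ _ :=
    ((Val.single false).perm ⟨m, fun j => ⟨false, j⟩, p⟩ τ.1).join _ _ hi hl
    ((Val.single true).perm ⟨n, fun j => ⟨true, j⟩, q⟩ σ.1) (by simp)
    (graft_flagEdge _ hl (x := τ.1 ⟨i, Nat.lt_succ_of_le hi.2⟩) (y := σ.1 0) rfl σ.2)
  rw [bool_union] at h2
  exact ha.graft_val_unique _ hl (joinLab_insertPerm hi hl τ σ _ _) h2 h1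

theorem IsAlgebra.circ_rotate_one (ha : IsAlgebra (treeMonad ext k) W a) {m n l : ℕ}
    (hm : 1 ≤ 1 ∧ 1 ≤ m) (hn : 1 ≤ n ∧ n ≤ n) (hl : l + 1 = m + n) (hl' : l + 1 = n + m)
    (p : W.X m) (q : W.X n) :
    W.act l (finRotate (l + 1)) (circ (ext := ext) (W := W) a m n l 1 hm hl p q) =
      circ (ext := ext) (W := W) a n m l n hn hl' (W.act n (finRotate (n + 1)) q)
        (W.act m (finRotate (m + 1)) p) := by
  have h1 := (graft_val (c := circ (ext := ext) (W := W) a) hm hl (graftDec p q)).perm _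
    (finRotate (l + 1))
  let c := circ (ext := ext) (W := W) a
  let E := (graft hm hl).flagEdge
  -- The same edge read from its other end: the slot n of q τ_n carries the flag 0 of q, and the
  -- slot 0 of p τ_m carries the flag 1 of p.
  have h2 : Val c E (graftDec p q) _ _ :=
    ((Val.single true).perm ⟨n, fun j => ⟨true, j⟩, q⟩ (finRotate (n + 1))).join _ _ hn hl'
    ((Val.single false).perm ⟨m, fun j => ⟨false, j⟩, p⟩ (finRotate (m + 1))) (by simp)
    ((graft hm hl).symm _ _ (graft_flagEdge _ hl ((finRotate_val _).trans (by simp; omega))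
      (Fin.ext ((finRotate_val _).trans (by simp)))))
  rw [Set.union_comm, bool_union] at h2
  exact ha.graft_val_unique _ hl (joinLab_finRotate_one hm hn hl hl' _ _).symm h1 h2

theorem IsAlgebra.circ_rotate_succ (ha : IsAlgebra (treeMonad ext k) W a) {m n l i i' : ℕ}
    (hi : 1 ≤ i ∧ i ≤ m) (hi' : 1 ≤ i' ∧ i' ≤ m) (hl : l + 1 = m + n) (h : i' + 1 = i)
    (p : W.X m) (q : W.X n) :
    W.act l (finRotate (l + 1)) (circ (ext := ext) (W := W) a m n l i hi hl p q) =
      circ (ext := ext) (W := W) a m n l i' hi' hl (W.act m (finRotate (m + 1)) p) q := by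
  have h1 := (graft_val (c := circ (ext := ext) (W := W) a) hi hl (graftDec p q)).perm _
    (finRotate (l + 1))
  let c := circ (ext := ext) (W := W) a
  let E := (graft hi hl).flagEdge
  have h2 : Val c E (graftDec p q) _ _ :=
    ((Val.single false).perm ⟨m, fun j => ⟨false, j⟩, p⟩ (finRotate (m + 1))).join _
    ⟨n, fun j => ⟨true, j⟩, q⟩ hi' hl (Val.single true) (by simp)
    (graft_flagEdge _ hl ((finRotate_val _).trans (by simp only; split_ifs <;> omega)) rfl)
  rw [bool_union] at h2
  exact ha.graft_val_unique _ hl (joinLab_finRotate_succ hi hi' hl h _ _).symm h1 h2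

/-- The numbers of flags of three vertices. -/
abbrev arity₃ (a b c : ℕ) : Fin 3 → ℕ
  | 0 => a
  | 1 => b
  | 2 => c

/-- The decoration of three vertices. -/
def dec₃ {a b c : ℕ} (f : W.X a) (g : W.X b) (h : W.X c) : ∀ v, W.X (arity₃ a b c v)
  | 0 => f
  | 1 => g
  | 2 => h

/-- The relation that joins `x` to `y` and `x'` to `y'`. -/
def TwoEdges {F : Type} (x y x' y' f g : F) : Prop :=
  (f = x ∧ g = y ∨ f = y ∧ g = x) ∨ (f = x' ∧ g = y' ∨ f = y' ∧ g = x')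

/-- The four inequalities say that the two edges have no flag in common, so every flag has at most
one partner. -/
theorem IsAlgebra.val_unique₃ (ha : IsAlgebra (treeMonad ext k) W a) {V : Type} {r : V → ℕ}
    {w : ∀ v, W.X (r v)} {x y x' y' : Flag r} (h1 : x ≠ x') (h2 : x ≠ y') (h3 : y ≠ x')
    (h4 : y ≠ y') {A B : Set V} (hAB : A = B) {n : ℕ} {φ ψ : Fin (n + 1) → Flag r}
    {p q : W.X n} (hφ : φ = ψ)
    (hx : Val (circ (ext := ext) (W := W) a) (TwoEdges x y x' y') w A ⟨n, φ, p⟩)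
    (hy : Val (circ (ext := ext) (W := W) a) (TwoEdges x y x' y') w B ⟨n, ψ, q⟩) : p = q := by
  subst hφ hAB
  refine ha.val_unique ?_ ?_ hx hy
  · rintro f g ((⟨rfl, rfl⟩ | ⟨rfl, rfl⟩) | (⟨rfl, rfl⟩ | ⟨rfl, rfl⟩)) <;> simp [TwoEdges]
  · rintro f g g' ((⟨rfl, rfl⟩ | ⟨rfl, rfl⟩) | (⟨rfl, rfl⟩ | ⟨rfl, rfl⟩))
      ((⟨h5, rfl⟩ | ⟨h5, rfl⟩) | (⟨h5, rfl⟩ | ⟨h5, rfl⟩)) <;>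
      first
        | rfl
        | exact h5
        | exact h5.symm
        | exact absurd h5 (by assumption)
        | exact absurd h5.symm (by assumption)

/-! ### The associativity axioms as identities on three vertices -/

section assoc
variable {n₀ n₁ n₂ : ℕ} {i j i' j' s s' t : ℕ}

/-- The vertex of f is joined to that of g at its flag j and to that of h at its flag i; the two
sides contract these edges in different orders. -/
theorem IsAlgebra.circ_assoc_before (ha : IsAlgebra (treeMonad ext k) W a)
    (hj : 1 ≤ j ∧ j ≤ n₀) (hs : s + 1 = n₀ + n₁)
    (hi : 1 ≤ i ∧ i ≤ s) (ht : t + 1 = s + n₂) (hi' : 1 ≤ i ∧ i ≤ n₀) (hs' : s' + 1 = n₀ + n₂)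
    (hj' : 1 ≤ j' ∧ j' ≤ s') (ht' : t + 1 = s' + n₁) (hij : i < j) (hjj : j' + 1 = j + n₂)
    (f : W.X n₀) (g : W.X n₁) (h : W.X n₂) :
    circ (ext := ext) (W := W) a s n₂ t i hi ht (circ (ext := ext) (W := W) a n₀ n₁ s j hj hs f g) h =
      circ (ext := ext) (W := W) a s' n₁ t j' hj' ht'
        (circ (ext := ext) (W := W) a n₀ n₂ s' i hi' hs' f h) g := by
  let c := circ (ext := ext) (W := W) a
  let r := arity₃ n₀ n₁ n₂
  let φ₀ : Fin (n₀ + 1) → Flag r := fun x => ⟨0, x⟩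
  let φ₁ : Fin (n₁ + 1) → Flag r := fun x => ⟨1, x⟩
  let φ₂ : Fin (n₂ + 1) → Flag r := fun x => ⟨2, x⟩
  let x := φ₀ ⟨j, Nat.lt_succ_of_le hj.2⟩
  let x' := φ₀ ⟨i, Nat.lt_succ_of_le hi'.2⟩
  have h0 : Val c (TwoEdges x (φ₁ 0) x' (φ₂ 0)) (dec₃ f g h) {0} ⟨n₀, φ₀, f⟩ := .single 0
  have h1 : Val c (TwoEdges x (φ₁ 0) x' (φ₂ 0)) (dec₃ f g h) {1} ⟨n₁, φ₁, g⟩ := .single 1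
  have h2 : Val c (TwoEdges x (φ₁ 0) x' (φ₂ 0)) (dec₃ f g h) {2} ⟨n₂, φ₂, h⟩ := .single 2
  refine ha.val_unique₃ ?_ ?_ ?_ ?_ (Set.union_right_comm {0} {1} {2})
    (joinLab_assoc_before hj hs hi ht hi' hs' hj' ht' hij hjj φ₀ φ₁ φ₂)
    ((h0.join ⟨n₀, φ₀, f⟩ ⟨n₁, φ₁, g⟩ hj hs h1 (by simp) (Or.inl (Or.inl ⟨rfl, rfl⟩))).join
      ⟨s, joinLab hj hs φ₀ φ₁, _⟩ ⟨n₂, φ₂, h⟩ hi ht h2 (by simp)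
      (Or.inr (Or.inl ⟨joinLab_lt _ _ _ _ _ hij, rfl⟩)))
    ((h0.join ⟨n₀, φ₀, f⟩ ⟨n₂, φ₂, h⟩ hi' hs' h2 (by simp) (Or.inr (Or.inl ⟨rfl, rfl⟩))).join
      ⟨s', joinLab hi' hs' φ₀ φ₂, _⟩ ⟨n₁, φ₁, g⟩ hj' ht' h1 (by simp)
      (Or.inl (Or.inl ⟨(joinLab_ge _ _ _ _ _ (by simp only; omega)).trans
        (congrArg φ₀ (Fin.ext (by simp only; omega))), rfl⟩)))
  · intro h3
    simp [x, x', φ₀] at h3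
    omega
  · intro h3
    exact absurd (congrArg Sigma.fst h3) (by simp [x, φ₀, φ₂])
  · intro h3
    exact absurd (congrArg Sigma.fst h3) (by simp [x', φ₀, φ₁])
  · intro h3
    exact absurd (congrArg Sigma.fst h3) (by simp [φ₁, φ₂])

/-- This is the preceding axiom read from right to left, with g and h exchanged. -/
theorem IsAlgebra.circ_assoc_after (ha : IsAlgebra (treeMonad ext k) W a)
    (hj : 1 ≤ j ∧ j ≤ n₀) (hs : s + 1 = n₀ + n₁)
    (hi : 1 ≤ i ∧ i ≤ s) (ht : t + 1 = s + n₂) (hi' : 1 ≤ i' ∧ i' ≤ n₀) (hs' : s' + 1 = n₀ + n₂)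
    (hj' : 1 ≤ j ∧ j ≤ s') (ht' : t + 1 = s' + n₁) (hij : j + n₁ ≤ i) (hii : i' + n₁ = i + 1)
    (f : W.X n₀) (g : W.X n₁) (h : W.X n₂) :
    circ (ext := ext) (W := W) a s n₂ t i hi ht (circ (ext := ext) (W := W) a n₀ n₁ s j hj hs f g) h =
      circ (ext := ext) (W := W) a s' n₁ t j hj' ht'
        (circ (ext := ext) (W := W) a n₀ n₂ s' i' hi' hs' f h) g :=
  (ha.circ_assoc_before hi' hs' hj' ht' hj hs hi ht (by omega) (by omega) f h g).symm

/-- The three vertices form a chain f, g, h, with h joined to the flag i' = i - j + 1 of g. -/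
theorem IsAlgebra.circ_assoc_inside (ha : IsAlgebra (treeMonad ext k) W a)
    (hj : 1 ≤ j ∧ j ≤ n₀) (hs : s + 1 = n₀ + n₁)
    (hi : 1 ≤ i ∧ i ≤ s) (ht : t + 1 = s + n₂) (hi' : 1 ≤ i' ∧ i' ≤ n₁) (hs' : s' + 1 = n₁ + n₂)
    (ht' : t + 1 = n₀ + s') (hij : j ≤ i) (hij' : i < n₁ + j) (hii : i' + j = i + 1)
    (f : W.X n₀) (g : W.X n₁) (h : W.X n₂) :
    circ (ext := ext) (W := W) a s n₂ t i hi ht (circ (ext := ext) (W := W) a n₀ n₁ s j hj hs f g) h =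
      circ (ext := ext) (W := W) a n₀ s' t j hj ht' f
        (circ (ext := ext) (W := W) a n₁ n₂ s' i' hi' hs' g h) := by
  let c := circ (ext := ext) (W := W) a
  let r := arity₃ n₀ n₁ n₂
  let φ₀ : Fin (n₀ + 1) → Flag r := fun x => ⟨0, x⟩
  let φ₁ : Fin (n₁ + 1) → Flag r := fun x => ⟨1, x⟩
  let φ₂ : Fin (n₂ + 1) → Flag r := fun x => ⟨2, x⟩
  let x := φ₀ ⟨j, Nat.lt_succ_of_le hj.2⟩
  let x' := φ₁ ⟨i', Nat.lt_succ_of_le hi'.2⟩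
  have h0 : Val c (TwoEdges x (φ₁ 0) x' (φ₂ 0)) (dec₃ f g h) {0} ⟨n₀, φ₀, f⟩ := .single 0
  have h1 : Val c (TwoEdges x (φ₁ 0) x' (φ₂ 0)) (dec₃ f g h) {1} ⟨n₁, φ₁, g⟩ := .single 1
  have h2 : Val c (TwoEdges x (φ₁ 0) x' (φ₂ 0)) (dec₃ f g h) {2} ⟨n₂, φ₂, h⟩ := .single 2
  refine ha.val_unique₃ ?_ ?_ ?_ ?_ (Set.union_assoc {0} {1} {2})
    (joinLab_assoc_inside hj hs hi ht hi' hs' ht' hij hij' hii φ₀ φ₁ φ₂)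
    ((h0.join ⟨n₀, φ₀, f⟩ ⟨n₁, φ₁, g⟩ hj hs h1 (by simp) (Or.inl (Or.inl ⟨rfl, rfl⟩))).join
      ⟨s, joinLab hj hs φ₀ φ₁, _⟩ ⟨n₂, φ₂, h⟩ hi ht h2 (by simp)
      (Or.inr (Or.inl ⟨(joinLab_mid _ _ _ _ _ hij (by simp only; omega)).trans
        (congrArg φ₁ (Fin.ext (by simp only; omega))), rfl⟩)))
    (h0.join ⟨n₀, φ₀, f⟩ ⟨s', joinLab hi' hs' φ₁ φ₂, _⟩ hj ht'
      (h1.join ⟨n₁, φ₁, g⟩ ⟨n₂, φ₂, h⟩ hi' hs' h2 (by simp) (Or.inr (Or.inl ⟨rfl, rfl⟩))) (by simp)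
      (Or.inl (Or.inl ⟨rfl, (joinLab_lt _ _ _ _ _ (by simp; omega)).trans
        (congrArg φ₁ (Fin.ext (by simp)))⟩)))
  · intro h3
    exact absurd (congrArg Sigma.fst h3) (by simp [x, x', φ₀, φ₁])
  · intro h3
    exact absurd (congrArg Sigma.fst h3) (by simp [x, φ₀, φ₂])
  · intro h3
    simp [x', φ₁, Fin.ext_iff] at h3
    omega
  · intro h3
    exact absurd (congrArg Sigma.fst h3) (by simp [φ₁, φ₂])

end assoc

theorem IsAlgebra.isNonunitalCyclic (ha : IsAlgebra (treeMonad ext k) W a) :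
    IsNonunitalCyclic W (circ (ext := ext) (W := W) a) where
  operad :=
    { assoc_before := fun _ _ _ _ _ _ _ _ _ hj hs hi ht hi' hs' hj' ht' h1 h2 =>
        ha.circ_assoc_before hj hs hi ht hi' hs' hj' ht' h1 h2
      assoc_inside := fun _ _ _ _ _ _ _ _ _ hj hs hi ht hi' hs' ht' h1 h2 h3 =>
        ha.circ_assoc_inside hj hs hi ht hi' hs' ht' h1 h2 h3
      assoc_after := fun _ _ _ _ _ _ _ _ _ hj hs hi ht hi' hs' hj' ht' h1 h2 =>
        ha.circ_assoc_after hj hs hi ht hi' hs' hj' ht' h1 h2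
      equivariance := fun _ _ _ _ hi hl τ σ p q => ha.circ_equivariance hi hl τ σ p q }
  rotate_one _ _ _ hm hn hl hl' p q := ha.circ_rotate_one hm hn hl hl' p q
  rotate_succ _ _ _ _ _ hi hi' hl h p q := ha.circ_rotate_succ hi hi' hl h p q

end identities

/-! ### The exceptional tree -/

/-- The exceptional tree. -/
def exceptional : CTree Empty (fun v => v.elim) 1 where
  edge x y := x ≠ y
  symm _ _ h := h.symm
  irrefl _ h := h rfl
  existsUnique x := by
    rcases x with ⟨v, -⟩ | x
    · exact v.elim
    · refine ⟨.inr (1 - x), fun h => ?_, ?_⟩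
      · have := Sum.inr_injective h
        revert this
        revert x
        decide
      · rintro (⟨v, -⟩ | y) h
        · exact v.elim
        · have h1 : x ≠ y := fun h' => h (congrArg _ h')
          revert h1
          clear h
          revert x y
          exact fun x y h => congrArg Sum.inr (by revert x y; decide)
  connected P hP := by
    have key : ∀ x y : Fin 2, P (.inr x) → P (.inr y) := fun x y hx => by
      by_cases h : x = y
      · rwa [← h]
      · exact hP (.inr x) (.inr y) (fun h' => h (Sum.inr_injective h')) hx
    rintro (v | x) (v' | y) h
    · exact v.elim
    · exact v.elim
    · exact v'.elim
    · exact key x y h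
  card := by simp

theorem exceptional_edge : exceptional.edge (.inr 0) (.inr 1) :=
  fun h => absurd (Sum.inr_injective h) (by decide)

theorem graft_edge_left {m n l i : ℕ} (hi : 1 ≤ i ∧ i ≤ m) (hl : l + 1 = m + n) {t : Fin (l + 1)}
    {j : {j : Fin (m + 1) // (j : ℕ) ≠ i}} (h : slots hi hl t = .inl j) :
    (graft hi hl).edge (.inl ⟨false, j.1⟩) (.inr t) := Or.inr (.left t j h)

theorem graft_edge_right {m n l i : ℕ} (hi : 1 ≤ i ∧ i ≤ m) (hl : l + 1 = m + n) {t : Fin (l + 1)}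
    {j : {j : Fin (n + 1) // (j : ℕ) ≠ 0}} (h : slots hi hl t = .inr j) :
    (graft hi hl).edge (.inl ⟨true, j.1⟩) (.inr t) := Or.inr (.right t j h)

section unit
variable {k : Type u} [CommRing k] {ext : Prop} {W : CycMod.{u, v} k} {a : Psi ext W ⟶ W} {n : ℕ}

/-- The value of an algebra on the exceptional tree. -/
noncomputable def excValue (hext : ext) (a : Psi ext W ⟶ W) : W.X 1 :=
  a.app 1 (PsiX.cls (Or.inl hext) exceptional fun v => v.elim)

/-- A tree without vertices has just two legs, joined to each other, so any numbering of the legs by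
0 and 1 identifies it with the exceptional tree. The freedom in σ also yields the invariance of the
unit. -/
theorem app_cls_of_isEmpty (hext : ext) (a : Psi ext W ⟶ W) {V : Type} [Fintype V] [IsEmpty V]
    {r : V → ℕ} (h : ext ∨ Nonempty V) (T : CTree V r n) (w : ∀ v, W.X (r v))
    (σ : Fin (n + 1) ≃ Fin 2) : a.app n (PsiX.cls h T w) = W.tr σ (excValue hext a) := by
  rw [excValue]
  refine Eq.trans ?_ (app_relegs a (Or.inl hext) exceptional _ σ)
  refine congrArg (a.app n) (PsiX.cls_iso _ _ _ _ _ _ ?_).symm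
  refine ⟨Equiv.equivOfIsEmpty V Empty, fun v => isEmptyElim v, ?_, fun v => isEmptyElim v⟩
  -- In the exceptional tree being joined means being different, so only irreflexivity and
  -- injectivity remain to be used.
  apply CTree.edge_iff_of_imp
  intro x y hxy h
  refine T.irrefl x ?_
  have h1 := (CTree.Ends.map _ _ _).injective ((CTree.Ends.map _ _ _).injective h)
  rwa [← h1] at hxy

theorem act_excValue (hext : ext) (a : Psi ext W ⟶ W) (σ : Equiv.Perm (Fin 2)) :
    W.act 1 σ (excValue hext a) = excValue hext a := by
  have h := app_cls_of_isEmpty hext a (Or.inl hext) exceptional (fun v => v.elim)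
  exact (h σ).symm.trans ((h (.refl _)).trans (W.tr_refl _))

/-- Write the unit as the value on the exceptional tree and the other element as the value on a
corolla. The composite is then the value on the two-vertex tree with these trees substituted; its
only vertex has its flag j on the leg j, so it is the corolla. -/
theorem IsAlgebra.isOperadicUnit (ha : IsAlgebra (treeMonad ext k) W a) (hext : ext) :
    IsOperadicUnit W.res (circ (ext := ext) (W := W) a) (excValue hext a) where
  comp_unit m i hi f := by
    let U : Bool → Type := fun b => match b with
      | false => Unit
      | true => Empty
    let _ : ∀ b, Fintype (U b) := fun b => match b with
      | false => inferInstanceAs (Fintype Unit)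
      | true => inferInstanceAs (Fintype Empty)
    let s : ∀ b, U b → ℕ := fun b => match b with
      | false => fun _ => m
      | true => fun v => v.elim
    let S : ∀ b, CTree (U b) (s b) (arity m 1 b) := fun b => match b with
      | false => CTree.corolla m
      | true => exceptional
    let w : ∀ b u, W.X (s b u) := fun b => match b with
      | false => fun _ => f
      | true => fun v => v.elim
    have hdec : graftDec f (excValue hext a) =
        fun b => a.app (arity m 1 b) (PsiX.cls (Or.inl hext) (S b) (w b)) := by
      funext b
      cases b with
      | false => exact (ha.app_corolla f).symm
      | true => rfl
    have hl : m + 1 = m + 1 := rfl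
    change a.app m (PsiX.cls (Or.inr ⟨true⟩) (graft hi hl) (graftDec f (excValue hext a))) = f
    rw [hdec, ha.app_subst (Or.inr ⟨true⟩) (graft hi hl) (fun _ => Or.inl hext) S w]
    refine Eq.trans (congrArg (a.app m) (PsiX.cls_iso _ _ _ _ _ _ ?_)) (ha.app_corolla f)
    have hV : ∀ p : Σ b, U b, p = ⟨false, ()⟩ := by
      rintro ⟨_ | _, v⟩
      · rfl
      · exact (v : Empty).elim
    refine ⟨⟨fun _ => ⟨false, ()⟩, fun _ => (), fun _ => rfl, fun p => (hV p).symm⟩,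
      fun _ => .refl _, CTree.edge_iff_of_imp _ _ _ ?_, fun _ => (W.tr_refl _).symm⟩
    have key : ∀ j : Fin (m + 1),
        ((graft hi hl).subst S).edge (.inl ⟨⟨false, ()⟩, j⟩) (.inr j) := by
      intro j
      refine CTree.subst_edge (by simp) (.trans _ _ _
        (.rel _ _ (CTree.Step.inner
        (T := graft hi hl) (S := S) false (.inl (⟨(), j⟩ : Σ _ : Unit, Fin (m + 1))) (.inr j)
        (Or.inl ⟨j, rfl, rfl⟩))) ?_)
      by_cases hj : (j : ℕ) = i
      -- The flag i reaches the leg i through the exceptional tree: it enters at the end 0 and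
      -- leaves at the end 1, whose slot takes the place of the slot i.
      · have hs : slots hi hl j = .inr ⟨1, by simp⟩ := by
          simp [slots, hj]
        have h1 : CTree.Step (graft hi hl) S (.inl ⟨false, .inr j⟩) (.inl ⟨true, .inr (0 : Fin 2)⟩) :=
          CTree.Step.outer (.inl ⟨false, j⟩) (.inl ⟨true, (0 : Fin 2)⟩) (graft_flagEdge hi hl hj rfl)
        have h2 : CTree.Step (graft hi hl) S (.inl ⟨true, .inr (0 : Fin 2)⟩)
            (.inl ⟨true, .inr (1 : Fin 2)⟩) :=
          CTree.Step.inner true _ _ exceptional_edge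
        have h3 : CTree.Step (graft hi hl) S (.inl ⟨true, .inr (1 : Fin 2)⟩) (.inr j) :=
          CTree.Step.outer (T := graft hi hl) (S := S) (.inl ⟨true, (1 : Fin 2)⟩) (.inr j)
            (graft_edge_right hi hl hs)
        exact .trans _ _ _ (.rel _ _ h1) (.trans _ _ _ (.rel _ _ h2) (.rel _ _ h3))
      · have hs : slots hi hl j = .inl ⟨j, hj⟩ := by
          simp only [slots, Equiv.coe_fn_mk]
          split_ifs with h1 h2
          · rfl
          · omega
          · rfl
        exact .rel _ _ (CTree.Step.outer (S := S) _ _ (graft_edge_left hi hl hs))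
    rintro x y (⟨j, rfl, rfl⟩ | ⟨j, rfl, rfl⟩)
    · exact key j
    · exact CTree.symm _ _ _ (key j)
  unit_comp n g := by
    let U : Bool → Type := fun b => match b with
      | false => Empty
      | true => Unit
    let _ : ∀ b, Fintype (U b) := fun b => match b with
      | false => inferInstanceAs (Fintype Empty)
      | true => inferInstanceAs (Fintype Unit)
    let s : ∀ b, U b → ℕ := fun b => match b with
      | false => fun v => v.elim
      | true => fun _ => n
    let S : ∀ b, CTree (U b) (s b) (arity 1 n b) := fun b => match b with
      | false => exceptional
      | true => CTree.corolla n
    let w : ∀ b u, W.X (s b u) := fun b => match b with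
      | false => fun v => v.elim
      | true => fun _ => g
    have hdec : graftDec (excValue hext a) g =
        fun b => a.app (arity 1 n b) (PsiX.cls (Or.inl hext) (S b) (w b)) := by
      funext b
      cases b with
      | false => rfl
      | true => exact (ha.app_corolla g).symm
    have hi : 1 ≤ 1 ∧ 1 ≤ 1 := ⟨le_rfl, le_rfl⟩
    have hl : n + 1 = 1 + n := Nat.add_comm n 1
    change a.app n (PsiX.cls (Or.inr ⟨true⟩) (graft hi hl) (graftDec (excValue hext a) g)) = g
    rw [hdec, ha.app_subst (Or.inr ⟨true⟩) (graft hi hl) (fun _ => Or.inl hext) S w]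
    refine Eq.trans (congrArg (a.app n) (PsiX.cls_iso _ _ _ _ _ _ ?_)) (ha.app_corolla g)
    have hV : ∀ p : Σ b, U b, p = ⟨true, ()⟩ := by
      rintro ⟨_ | _, v⟩
      · exact (v : Empty).elim
      · rfl
    refine ⟨⟨fun _ => ⟨true, ()⟩, fun _ => (), fun _ => rfl, fun p => (hV p).symm⟩,
      fun _ => .refl _, CTree.edge_iff_of_imp _ _ _ ?_, fun _ => (W.tr_refl _).symm⟩
    have key : ∀ j : Fin (n + 1),
        ((graft hi hl).subst S).edge (.inl ⟨⟨true, ()⟩, j⟩) (.inr j) := by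
      intro j
      refine CTree.subst_edge (by simp) (.trans _ _ _
        (.rel _ _ (CTree.Step.inner
        (T := graft hi hl) (S := S) true (.inl (⟨(), j⟩ : Σ _ : Unit, Fin (n + 1))) (.inr j)
        (Or.inl ⟨j, rfl, rfl⟩))) ?_)
      by_cases hj : (j : ℕ) = 0
      -- Now the exceptional tree stands at the first vertex: the flag 0 of the corolla enters it at
      -- the end 1 and leaves at the end 0, which is the leg 0.
      · have hs : slots hi hl j = .inl ⟨0, by simp⟩ := by
          obtain rfl : j = 0 := Fin.ext hj
          exact slots_zero hi hl
        have h1 : CTree.Step (graft hi hl) S (.inl ⟨true, .inr j⟩) (.inl ⟨false, .inr (1 : Fin 2)⟩) :=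
          CTree.Step.outer (.inl ⟨true, j⟩) (.inl ⟨false, (1 : Fin 2)⟩)
            ((graft hi hl).symm _ _ (graft_flagEdge hi hl rfl (Fin.ext hj)))
        have h2 : CTree.Step (graft hi hl) S (.inl ⟨false, .inr (1 : Fin 2)⟩)
            (.inl ⟨false, .inr (0 : Fin 2)⟩) :=
          CTree.Step.inner false _ _ (CTree.symm _ _ _ exceptional_edge)
        have h3 : CTree.Step (graft hi hl) S (.inl ⟨false, .inr (0 : Fin 2)⟩) (.inr j) :=
          CTree.Step.outer (T := graft hi hl) (S := S) (.inl ⟨false, (0 : Fin 2)⟩) (.inr j)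
            (graft_edge_left hi hl hs)
        exact .trans _ _ _ (.rel _ _ h1) (.trans _ _ _ (.rel _ _ h2) (.rel _ _ h3))
      · have hs : slots hi hl j = .inr ⟨j, hj⟩ := by
          simp only [slots, Equiv.coe_fn_mk]
          split_ifs with h1 h2
          · omega
          · simp
          · omega
        exact .rel _ _ (CTree.Step.outer (S := S) _ _ (graft_edge_right hi hl hs))
    rintro x y (⟨j, rfl, rfl⟩ | ⟨j, rfl, rfl⟩)
    · exact key j
    · exact CTree.symm _ _ _ (key j)

end unit

/-! ### The comparison -/

section comparison
variable {k : Type u} [CommRing k] {ext : Prop} {W W' : CycMod.{u, v} k} {a b : Psi ext W ⟶ W}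
  {a' : Psi ext W' ⟶ W'} {n : ℕ}

/-- The usual argument: e = e ∘_1 e' = e'. -/
theorem IsOperadicUnit.unique {S : SigmaMod.{u, v} k} {c : Comp.{u, v} k S.X} {e e' : S.X 1}
    (h : IsOperadicUnit S c e) (h' : IsOperadicUnit S c e') : e = e' :=
  (h'.comp_unit 1 1 ⟨le_rfl, le_rfl⟩ e).symm.trans (h.unit_comp 1 e')

/-- On trees with vertices the value is an iterated composition; on trees without vertices it is the
operadic unit, which is unique. Thus the compositions determine the algebra. -/
theorem IsAlgebra.app_cls (ha : IsAlgebra (treeMonad ext k) W a) {e : W.X 1}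
    (he : ext → IsOperadicUnit W.res (circ (ext := ext) (W := W) a) e) {V : Type} [Fintype V]
    {r : V → ℕ} (h : ext ∨ Nonempty V) {T : CTree V r n} {w : ∀ v, W.X (r v)} {x : W.X n}
    (hx : T.Evals (circ (ext := ext) (W := W) a) e w x) : a.app n (PsiX.cls h T w) = x := by
  rcases hx with ⟨φ, hφ, hx⟩ | ⟨hV, σ, rfl⟩
  · exact ha.app_cls_of_val h hφ hx
  · have hext : ext := h.resolve_right fun ⟨v⟩ => hV.elim v
    rw [app_cls_of_isEmpty hext a h T w σ, (ha.isOperadicUnit hext).unique (he hext)]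

theorem IsAlgebra.exists_unit (ha : IsAlgebra (treeMonad ext k) W a) :
    ∃ e : W.X 1, ext → IsOperadicUnit W.res (circ (ext := ext) (W := W) a) e := by
  by_cases hext : ext
  · exact ⟨_, fun _ => ha.isOperadicUnit hext⟩
  · exact ⟨0, fun h => absurd h hext⟩

theorem IsAlgebra.eq_of_circ_eq (ha : IsAlgebra (treeMonad ext k) W a)
    (hb : IsAlgebra (treeMonad ext k) W b)
    (h : circ (ext := ext) (W := W) a = circ (ext := ext) (W := W) b) : a = b := by
  obtain ⟨e, he⟩ := ha.exists_unit
  refine Psi_hom_ext fun n D => ?_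
  obtain ⟨x, hx⟩ := D.tree.exists_evals (circ (ext := ext) (W := W) a) e D.dec
  rw [ha.app_cls he D.ok hx, hb.app_cls (h ▸ he) D.ok (h ▸ hx)]

theorem IsAlgebraHom.preservesComp {f : W ⟶ W'} (hf : IsAlgebraHom (treeMonad ext k) a a' f) :
    PreservesComp (circ (ext := ext) (W := W) a) (circ (ext := ext) (W := W') a') f := by
  intro m n l i h hl p q
  have h1 := congrArg (fun g : Psi ext W ⟶ W' => g.app l
    (PsiX.cls (Or.inr ⟨true⟩) (graft h hl) (graftDec p q))) hf
  refine h1.symm.trans (congrArg (a'.app l) ((PsiX.map_cls _ _ _ _).trans ?_))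
  refine congrArg (PsiX.cls _ _) (funext fun b => ?_)
  cases b <;> rfl

theorem IsAlgebraHom.app_excValue {f : W ⟶ W'} (hf : IsAlgebraHom (treeMonad ext k) a a' f)
    (hext : ext) : f.app 1 (excValue hext a) = excValue hext a' := by
  have h1 := congrArg (fun g : Psi ext W ⟶ W' => g.app 1
    (PsiX.cls (Or.inl hext) exceptional fun v => v.elim)) hf
  refine h1.symm.trans (congrArg (a'.app 1) ((PsiX.map_cls _ _ _ _).trans ?_))
  exact congrArg (PsiX.cls _ _) (funext fun v => v.elim)

/-- A map that preserves compositions carries iterated compositions to iterated compositions;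
preservation of the unit is needed only for trees without vertices. -/
theorem IsAlgebra.isAlgebraHom (ha : IsAlgebra (treeMonad ext k) W a)
    (ha' : IsAlgebra (treeMonad ext k) W' a') {f : W ⟶ W'}
    (hf : PreservesComp (circ (ext := ext) (W := W) a) (circ (ext := ext) (W := W') a') f)
    (hu : ext → PreservesUnit (circ (ext := ext) (W := W) a) (circ (ext := ext) (W := W') a') f) :
    IsAlgebraHom (treeMonad ext k) a a' f := by
  obtain ⟨e, he⟩ := ha.exists_unit
  refine Psi_hom_ext fun n D => ?_
  obtain ⟨x, hx⟩ := D.tree.exists_evals (circ (ext := ext) (W := W) a) e D.dec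
  change a'.app n (PsiX.map f n (PsiX.cls D.ok D.tree D.dec)) =
    f.app n (a.app n (PsiX.cls D.ok D.tree D.dec))
  rw [ha.app_cls he D.ok hx, PsiX.map_cls]
  rcases hx with ⟨φ, hφ, hx⟩ | ⟨hV, σ, rfl⟩
  · exact ha'.app_cls_of_val D.ok hφ (hx.map hf)
  · have hext : ext := D.ok.resolve_right fun ⟨v⟩ => hV.elim v
    rw [app_cls_of_isEmpty hext a' D.ok D.tree _ σ, CycMod.hom_tr,
      hu hext e _ (he hext) (ha'.isOperadicUnit hext)]

end comparison
end CycOp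

theorem mainTheorem8 (k : Type u) [CommRing k] :
    -- the structures of a non-unital cyclic operad on `W`
    (∀ W : CycMod.{u, v} k,
      Set.BijOn (fun a : (PsiPlus.{u, v} k).obj W ⟶ W => circ a)
        {a | IsAlgebra (PsiPlus k) W a} {c | IsNonunitalCyclic W c}) ∧
    -- and their morphisms
    (∀ (W W' : CycMod.{u, v} k) (a : (PsiPlus.{u, v} k).obj W ⟶ W)
      (a' : (PsiPlus.{u, v} k).obj W' ⟶ W'),
      IsAlgebra (PsiPlus k) W a → IsAlgebra (PsiPlus k) W' a' → ∀ f : W ⟶ W',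
        (IsAlgebraHom (PsiPlus k) a a' f ↔ PreservesComp (circ a) (circ a') f)) ∧
    -- the structures of a unital cyclic operad on `W`
    (∀ W : CycMod.{u, v} k,
      Set.BijOn (fun a : (GammaPlus.{u, v} k).obj W ⟶ W => circ a)
        {a | IsAlgebra (GammaPlus k) W a} {c | IsUnitalCyclic W c}) ∧
    -- and their morphisms
    (∀ (W W' : CycMod.{u, v} k) (a : (GammaPlus.{u, v} k).obj W ⟶ W)
      (a' : (GammaPlus.{u, v} k).obj W' ⟶ W'),
      IsAlgebra (GammaPlus k) W a → IsAlgebra (GammaPlus k) W' a' → ∀ f : W ⟶ W',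
        (IsAlgebraHom (GammaPlus k) a a' f ↔
          PreservesComp (circ a) (circ a') f ∧ PreservesUnit (circ a) (circ a') f)) := by
  refine ⟨fun W => ⟨fun a ha => IsAlgebra.isNonunitalCyclic ha, fun a ha b hb h =>
      IsAlgebra.eq_of_circ_eq ha hb h, fun c hc => ?_⟩, fun W W' a a' ha ha' f =>
      ⟨fun hf => hf.preservesComp, fun hf => IsAlgebra.isAlgebraHom ha ha' hf False.elim⟩,
    fun W => ⟨fun a ha => ⟨IsAlgebra.isNonunitalCyclic ha, excValue trivial a,
      IsAlgebra.isOperadicUnit ha trivial, act_excValue trivial a⟩, fun a ha b hb h =>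
      IsAlgebra.eq_of_circ_eq ha hb h, fun c hc => ?_⟩, fun W W' a a' ha ha' f =>
      ⟨fun hf => ⟨hf.preservesComp, fun e e' he he' => ?_⟩, fun hf =>
        IsAlgebra.isAlgebraHom ha ha' hf.1 fun _ => hf.2⟩⟩
  · have h : IsCyclicOperad False W c 0 := ⟨hc, False.elim, False.elim⟩
    exact ⟨evalHom h, evalHom_isAlgebra h, circ_evalHom h⟩
  · obtain ⟨e, he, hinv⟩ := hc.exists_unit
    have h : IsCyclicOperad True W c e := ⟨hc.toIsNonunitalCyclic, fun _ => he, fun _ => hinv⟩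
    exact ⟨evalHom h, evalHom_isAlgebra h, circ_evalHom h⟩
  -- By uniqueness the given operadic units are the values on the exceptional tree, which algebra
  -- morphisms preserve.
  · rw [he.unique (IsAlgebra.isOperadicUnit ha trivial),
      he'.unique (IsAlgebra.isOperadicUnit ha' trivial)]
    exact hf.app_excValue trivial
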